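/- \textbf{Theorem B.} Let $\mu\ge 1$ be an integer and let $P_\varepsilon(x)$ be a polynomial of degree $\mu+1$ in $x$ whose coefficients are real analytic functions of $\varepsilon$ near $0$, with $P_0(x)=x^{\mu+1}$. Assume that $P_\varepsilon$ has a real root for all small $\varepsilon\ge 0$ and let $\vartheta_\varepsilon$ be its biggest real root. Let $\rho\ge1$ be an integer and $\sigma$ a real analytic function at $0$ such that $\vartheta_\varepsilon=\sigma(\varepsilon^{1/\rho})$ for all small $\varepsilon\geq 0$ (such $\rho,\sigma$ exist by Puiseux's theorem), and set $$\mathcal Q(s,z)=\frac{P_{z^\rho}\bigl(s+\sigma(z)\bigr)}{s}=\sum_{i,j\ge 0}q_{ij}s^iz^j .$$ Assume that for some integer $\nu\ge1$: (H1) $q_{ij}=0$ whenever $\frac i\mu+\frac j\nu<1$; (H2) $\displaystyle\sum_{\frac i\mu+\frac j\nu=1}q_{ij}\sin^i\theta\cos^j\theta>0$ for all $\theta\in[0,\frac\pi2]$. Let $A$ be an open subset of $\mathbb R^\alpha$, let $V_a(x)$ be a real function, real analytic in $(x,a)$ for $|x|\le1$ and $a\in A$, with $V_a(0)>0$, and let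 $U_a(x,y)$ be a real function, real analytic in $(x,y,a)$ for $|x|,|y|\le1$ and $a\in A$, whose Taylor series at $(x,y)=(0,0)$ is, for every $a\in A$, absolutely convergent with sum $U_a$ on $|x|,|y|\le1$ (analytic on a set always means on a neighbourhood of it). Let $\mathcal T(s;\varepsilon,a)$ be the Dulac time of $$\frac{1}{yU_a(x,y)}\bigl(P_\varepsilon(x)\partial_x-V_a(x)y\partial_y\bigr)$$ between $\{y=1\}$ and $\{x=1\}$, i.e. the time that the trajectory starting at $(s+\vartheta_\varepsilon,1)$, $s>0$, spends to arrive at $\{x=1\}$ inside $|x|,|y|\le 1$; in other words the integral of the time form $yU_a(x,y)\,d\tau$ along the solution of $\frac{dx}{d\tau}=P_\varepsilon(x)$, $\frac{dy}{d\tau}=-V_a(x)y$ from that point to $\{x=1\}$ (so that $U_a$ may have zeros). Then there exist functions $c_j(z,a)$, $j\ge0$, such that for all integers $\ell,k\ge0$ and every compact set $K_a\subset A$ there exists $\varepsilon_0\in(0,1]$ with the following properties: $c_0,\dots,c_\ell$ are real analytic on $[0,\varepsilon_0^{1/\rho}]\times K_a$ (which contains $[0,\varepsilon_0]\times K_a$);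 for all $(\varepsilon,a)\in[0,\varepsilon_0]\times K_a$ the Dulac time is defined for all $s\in(0,s_0)$, with some $s_0>0$ independent of $(\varepsilon,a)$, and, for every $s>0$ for which it is defined, it can be written as $$\mathcal T(s;\varepsilon,a)=\sum_{j=0}^{\ell}c_j(\varepsilon^{1/\rho},a)s^j+s^\ell h_\ell(s;\varepsilon,a),$$ where $h_\ell$ is $k$ times continuously differentiable in $s\in(0,s_0)$ and, with $\Theta=s\partial_s$, $$\Theta^r h_\ell(s;\varepsilon,a)\to0\quad\text{as } s\to0^+,\ \text{uniformly in }(\varepsilon,a)\in[0,\varepsilon_0]\times K_a,\quad r=0,1,\dots,k.$$ -/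

import Mathlib

open Set Filter Topology

namespace SaddleNode

noncomputable section

/-- The biggest real root of a (nonzero) real polynomial that has a real root. -/
def biggestRoot (p : Polynomial ℝ) : ℝ := sSup {x : ℝ | p.IsRoot x}

/-- `Q(s, z) = P(s + σ(z); z ^ ρ) / s`, as a polynomial in `s` for each `z`.
`Polynomial.taylor r p` is `p (X + r)` and `Polynomial.divX` removes the constant term
(which is zero when `σ z` is a root of `P (z ^ ρ)`) and divides by `X`. -/
def Q (P : ℝ → Polynomial ℝ) (ρ : ℕ) (σ : ℝ → ℝ) (z : ℝ) : Polynomial ℝ :=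
  (Polynomial.taylor (σ z) (P (z ^ ρ))).divX

/-- The Taylor coefficient `q i j` of `s ^ i * z ^ j` in `Q(s, z)` at `(0, 0)`. -/
def q (P : ℝ → Polynomial ℝ) (ρ : ℕ) (σ : ℝ → ℝ) (i j : ℕ) : ℝ :=
  iteratedDeriv j (fun z => (Q P ρ σ z).coeff i) 0 / (j.factorial : ℝ)

/-- Condition (H1): only the monomials `s ^ i * z ^ j` with `i / μ + j / ν ≥ 1` occur in the
Taylor expansion of `Q(s, z)`. -/
def H1 (P : ℝ → Polynomial ℝ) (ρ : ℕ) (σ : ℝ → ℝ) (μ ν : ℕ) : Prop :=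
  ∀ i j : ℕ, (i : ℝ) / μ + (j : ℝ) / ν < 1 → q P ρ σ i j = 0

/-- Condition (H2): the principal `(μ, ν)`-quasi-homogeneous part of `Q(s, z)` is positive
definite on the first quadrant. -/
def H2 (P : ℝ → Polynomial ℝ) (ρ : ℕ) (σ : ℝ → ℝ) (μ ν : ℕ) : Prop :=
  ∀ θ ∈ Icc (0 : ℝ) (Real.pi / 2),
    0 < ∑ ij ∈ (Finset.range (μ + 1) ×ˢ Finset.range (ν + 1)).filter
          (fun ij => ij.1 * ν + ij.2 * μ = μ * ν),
        q P ρ σ ij.1 ij.2 * Real.sin θ ^ ij.1 * Real.cos θ ^ ij.2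

/-- `T` is the time that the trajectory of `(1 / (y u(x, y))) (p(x) ∂_x - v(x) y ∂_y)` starting
at `(x₀, 1)` spends to arrive at `{x = 1}` (inside `|x|, |y| ≤ 1`).

The orbit is parametrized by the time `τ` of the regular field `p(x) ∂_x - v(x) y ∂_y`, and the
time `t` of the given field along it is determined by `dt = y u(x, y) dτ`. Where `u ≠ 0`, this is
the reparametrization of the orbit by the time of the given field; the field has poles on
`{u = 0}`, and the orbit may cross them. -/
def IsDulacTime (p : Polynomial ℝ) (v : ℝ → ℝ) (u : ℝ → ℝ → ℝ) (x₀ T : ℝ) : Prop :=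
  ∃ τ₁ : ℝ, 0 ≤ τ₁ ∧ ∃ x y t : ℝ → ℝ,
    x 0 = x₀ ∧ y 0 = 1 ∧ t 0 = 0 ∧ x τ₁ = 1 ∧ t τ₁ = T ∧
    ∀ τ ∈ Icc 0 τ₁,
      |x τ| ≤ 1 ∧ |y τ| ≤ 1 ∧
      HasDerivWithinAt x (p.eval (x τ)) (Icc 0 τ₁) τ ∧
      HasDerivWithinAt y (-(v (x τ) * y τ)) (Icc 0 τ₁) τ ∧
      HasDerivWithinAt t (y τ * u (x τ) (y τ)) (Icc 0 τ₁) τ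

/-- `u` has an absolutely convergent Taylor series at the origin on `|x|, |y| ≤ 1`. -/
def HasAbsConvTaylorSeries (u : ℝ → ℝ → ℝ) : Prop :=
  ∃ c : ℕ × ℕ → ℝ, Summable (fun ij => |c ij|) ∧
    ∀ x y : ℝ, |x| ≤ 1 → |y| ≤ 1 →
      HasSum (fun ij : ℕ × ℕ => c ij * x ^ ij.1 * y ^ ij.2) (u x y)

/-- The differential operator `Θ = s ∂_s`. -/
def Theta (f : ℝ → ℝ) : ℝ → ℝ := fun s => s * deriv f s

end

end SaddleNode

/-!
# The Dulac time of an unfolding of a saddle-node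

Write `z = ε ^ (1 / ρ)` and let `s` be the distance of `x` to the biggest root `σ(z)`, so that the
field becomes `s Q(s, z) ∂_s - V y ∂_y`. The time `T(s, y)` spent by the orbit from the point
`(s, y)` satisfies the transport equation `s Q ∂_s T - V y ∂_y T + y U = 0`, that is, with
`T = y f`, `q = Q / V` and `u = U / V`,

  `∂_y (y f) = q s ∂_s f + u`,

and the Dulac time is `T(s, 1)`. The coefficients `c_j` are those of the formal power series
solution `f = ∑ fₙ(y; z, a) sⁿ`, evaluated at `y = 1`. The equation for `fₙ` is
`∂_y (y fₙ) - n q(0; z, a) fₙ = rₙ`, where `rₙ` comes from the lower coefficients. The operator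
`f ↦ ∂_y (y f)` has the averaging operator `L φ (y) = ∫₀¹ φ(t y) dt` as a right inverse on
`C([0, 1])`, which has norm at most one, and `q(0; 0, a) = 0` because `P_0 = x ^ (μ + 1)`; so
`fₙ = (1 - n q(0; z, a) L)⁻¹ L rₙ` for small `z`. Since `u` and `q` are analytic as maps from
`(s, z, a)` to `C([0, 1])` and `ℝ` (`analyticAt_toC`), the `fₙ` are analytic in `(z, a)`, also where
the saddle-node bifurcates (`analyticAt_formalCoeff`).

The partial sum of order `N` solves the equation up to `O(s ^ (N + 1))` in `C([0, 1])`
(`eventually_defect`). Along an orbit, `x ^ (N + 1) y` decreases fast enough to absorb the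
singularity of `dx / (x q)`, as `(N + 1) q ≤ 1 / 2` for small `s` and `z`; hence the time integral
up to a small `x = η` differs from the partial sum by `O(s ^ (N + 1))` (`near_estimate`). Beyond
`η` the polynomial is bounded away from zero and the orbit has height `O(s ^ (N + 1))`. This gives
`T = ∑_{n ≤ N} c_n sⁿ + O(s ^ (N + 1))`, uniformly in the parameters
(`IsUniformFamily.rateBound_remainder`).

For the derivatives, note that `q Θ T[u] = T[∂_y (y u)] - u(s, 1)`, where `T[u]` is the time
integral at `y = 1` (`hasDerivAt_orbitTime`), and the partial sums obey the same relation up to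
`O(s ^ (N + 1))`. Hence `Θ` of a remainder is a remainder of the same kind divided by `q`
(`IsUniformFamily.theta_remainder`). The hypotheses (H1) and (H2) enter through the lower bound
`Q(s, z) ≥ c s ^ μ` (`exists_Q_lower_bound`), so that each `Θ` costs a bounded power of `s`, which
is compensated by taking `N` large (`IsUniformFamily.thetaBound_remainder`).
-/

namespace SaddleNode

noncomputable section

/-! ### Analytic families of continuous functions -/

open Classical in
/-- The element of `C(X, F)` with underlying function `f`, and `0` if `f` is not continuous. -/
def toC {X F : Type*} [TopologicalSpace X] [TopologicalSpace F] [Zero F] (f : X → F) : C(X, F) :=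
  if h : Continuous f then ⟨f, h⟩ else 0

lemma toC_apply {X F : Type*} [TopologicalSpace X] [TopologicalSpace F] [Zero F] {f : X → F}
    (h : Continuous f) (x : X) : toC f x = f x := by
  simp [toC, h]

section Nemytskii

variable {X E F : Type*} [TopologicalSpace X] [CompactSpace X]
  [NormedAddCommGroup E] [NormedSpace ℝ E] [NormedAddCommGroup F] [NormedSpace ℝ F]

/-- A continuous multilinear map acts pointwise on continuous functions. -/
def pointwiseMultilinear (X : Type*) [TopologicalSpace X] [CompactSpace X] {n : ℕ}
    (P : E [×n]→L[ℝ] F) : C(X, E) [×n]→L[ℝ] C(X, F) :=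
  MultilinearMap.mkContinuous
    { toFun := fun φ => ⟨fun x => P (fun i => φ i x), by fun_prop⟩
      map_update_add' := by
        intro _ m i x y
        ext t
        have h : ∀ z : C(X, E), (fun j => (Function.update m i z) j t)
            = Function.update (fun j => m j t) i (z t) := by
          intro z
          ext j
          by_cases hj : j = i
          · subst hj; simp
          · simp [hj]
        simp [h]
      map_update_smul' := by
        intro _ m i c x
        ext t
        have h : ∀ z : C(X, E), (fun j => (Function.update m i z) j t)
            = Function.update (fun j => m j t) i (z t) := by
          intro z
          ext j
          by_cases hj : j = i
          · subst hj; simp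
          · simp [hj]
        simp [h] }
    ‖P‖ (by
      intro φ
      rw [ContinuousMap.norm_le _ (by positivity)]
      intro x
      refine (P.le_opNorm _).trans ?_
      gcongr with i
      exact (φ i).norm_coe_le_norm x)

lemma pointwiseMultilinear_apply {n : ℕ} (P : E [×n]→L[ℝ] F) (φ : Fin n → C(X, E)) (x : X) :
    pointwiseMultilinear X P φ x = P (fun i => φ i x) := rfl

lemma norm_pointwiseMultilinear_le {n : ℕ} (P : E [×n]→L[ℝ] F) :
    ‖pointwiseMultilinear X P‖ ≤ ‖P‖ :=
  MultilinearMap.mkContinuous_norm_le _ (norm_nonneg _) _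

/-- The superposition operator `φ ↦ g ∘ φ` is analytic near the constant function `e`, because
the power series of `g` at `e` can be applied pointwise. -/
lemma hasFPowerSeriesOnBall_superposition [CompleteSpace F] {g : E → F}
    {P : FormalMultilinearSeries ℝ E F} {e : E} {r : ENNReal} (h : HasFPowerSeriesOnBall g P e r) :
    HasFPowerSeriesOnBall (fun φ : C(X, E) => toC (fun x => g (φ x)))
      (fun n => pointwiseMultilinear X (P n)) (ContinuousMap.const X e) r := by
  set R : FormalMultilinearSeries ℝ C(X, E) C(X, F) := fun n => pointwiseMultilinear X (P n)
  have hr : P.radius ≤ R.radius := FormalMultilinearSeries.radius_le_of_le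
    (fun n => norm_pointwiseMultilinear_le (P n))
  refine ⟨h.r_le.trans hr, h.r_pos, ?_⟩
  intro ψ hψ
  have hψx : ∀ x, ψ x ∈ Metric.eball (0 : E) r := by
    intro x
    rw [mem_eball_zero_iff] at hψ ⊢
    refine lt_of_le_of_lt ?_ hψ
    simpa [enorm_le_iff_norm_le] using ψ.norm_coe_le_norm x
  have hcont : Continuous (fun x => g ((ContinuousMap.const X e + ψ) x)) := by
    rw [continuous_iff_continuousAt]
    intro x
    have hmem : (ContinuousMap.const X e + ψ) x ∈ Metric.eball e r := by
      have := hψx x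
      rw [mem_eball_zero_iff] at this
      simpa [Metric.mem_eball, edist_eq_enorm_sub] using this
    exact ContinuousAt.comp (f := fun x => (ContinuousMap.const X e + ψ) x)
      (h.continuousOn.continuousAt (Metric.isOpen_eball.mem_nhds hmem))
      (ContinuousMap.continuous _).continuousAt
  have hsum : Summable (fun n => R n fun _ => ψ) :=
    R.summable (Metric.eball_subset_eball (h.r_le.trans hr) hψ)
  have heq : toC (fun x => g ((ContinuousMap.const X e + ψ) x)) = ∑' n, R n fun _ => ψ := by
    ext x
    rw [toC_apply hcont]
    have h1 := (ContinuousMap.evalCLM ℝ x).hasSum hsum.hasSum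
    exact (h.hasSum (hψx x)).unique h1
  rw [heq]
  exact hsum.hasSum

/-- The continuous linear map sending `p` to the constant function `(p, 0)`. -/
def constInl (X : Type*) [TopologicalSpace X] [CompactSpace X] (E : Type*) [NormedAddCommGroup E]
    [NormedSpace ℝ E] : E →L[ℝ] C(X, E × ℝ) :=
  LinearMap.mkContinuous
    { toFun := fun p => ContinuousMap.const X (p, 0)
      map_add' := by intro p q; ext x <;> simp
      map_smul' := by intro c p; ext x <;> simp } 1 (by
        intro p
        rw [ContinuousMap.norm_le _ (by positivity)]
        intro x
        simp)

/-- A family `p ↦ g (p, w ·)` is analytic if `w` takes its values in a single ball of convergence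
of `g`: it is the superposition operator along the affine map `p ↦ (p, 0) + (0, w)`. -/
lemma analyticAt_toC_of_mem_ball [CompleteSpace F] {g : E × ℝ → F}
    {P : FormalMultilinearSeries ℝ (E × ℝ) F} {p₀ : E} {t₀ : ℝ} {r : ℝ} (hr : 0 < r)
    (h : HasFPowerSeriesOnBall g P (p₀, t₀) (ENNReal.ofReal r)) (w : C(X, ℝ))
    (hw : ∀ x, |w x - t₀| ≤ r / 2) :
    AnalyticAt ℝ (fun p => toC (fun x => g (p, w x))) p₀ := by
  have h1 := hasFPowerSeriesOnBall_superposition (X := X) h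
  let ι : C(X, E × ℝ) := ⟨fun x => (0, w x), by fun_prop⟩
  have hmem : constInl X E p₀ + ι ∈
      Metric.eball (ContinuousMap.const X (p₀, t₀)) (ENNReal.ofReal r) := by
    rw [Metric.mem_eball, edist_dist, ENNReal.ofReal_lt_ofReal_iff hr]
    refine lt_of_le_of_lt ?_ (half_lt_self hr)
    rw [ContinuousMap.dist_le (by positivity)]
    intro x
    simp [constInl, ι, Prod.dist_eq, Real.dist_eq, hw x]
  have h2 := h1.analyticAt_of_mem hmem
  have h3 : AnalyticAt ℝ (fun p => constInl X E p + ι) p₀ :=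
    ((constInl X E).analyticAt p₀).add analyticAt_const
  have h4 := AnalyticAt.comp (g := fun φ : C(X, E × ℝ) => toC (fun x => g (φ x)))
    (f := fun p => constInl X E p + ι) h2 h3
  refine h4.congr (Eventually.of_forall fun p => ?_)
  simp [constInl, ι]

end Nemytskii

section Families

variable {E F : Type*} [NormedAddCommGroup E] [NormedSpace ℝ E]
  [NormedAddCommGroup F] [NormedSpace ℝ F]

lemma eventually_forall_analyticAt [CompleteSpace F] {g : E × ℝ → F} {p₀ : E}
    (h : ∀ t ∈ Icc (0 : ℝ) 1, AnalyticAt ℝ g (p₀, t)) :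
    ∀ᶠ p in 𝓝 p₀, ∀ t ∈ Icc (0 : ℝ) 1, AnalyticAt ℝ g (p, t) := by
  refine isCompact_Icc.eventually_forall_of_forall_eventually ?_
  intro t ht
  exact (h t ht).eventually_analyticAt

/-- If `g` is analytic on a neighbourhood of `{p₀} × [0, 1]` then `p ↦ g (p, ·)` is analytic at
`p₀` as a map into the space of continuous functions on `[0, 1]`.

On a subinterval so short that it stays within the ball of convergence at one of its points this
is the analyticity of the superposition operator; the general case follows by telescoping along a
subdivision of `[0, 1]`. -/
theorem analyticAt_toC [CompleteSpace F] {g : E × ℝ → F} {p₀ : E}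
    (h : ∀ t ∈ Icc (0 : ℝ) 1, AnalyticAt ℝ g (p₀, t)) :
    AnalyticAt ℝ (fun p => toC (fun t : unitInterval => g (p, (t : ℝ)))) p₀ := by
  have key : ∀ t : unitInterval, ∃ r : ℝ, 0 < r ∧ ∃ P : FormalMultilinearSeries ℝ (E × ℝ) F,
      HasFPowerSeriesOnBall g P (p₀, (t : ℝ)) (ENNReal.ofReal r) := by
    intro t
    obtain ⟨P, r, hP⟩ := h t t.2
    obtain ⟨r', hr'0, hr'⟩ := ENNReal.lt_iff_exists_nnreal_btwn.1 hP.r_pos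
    refine ⟨r', by exact_mod_cast hr'0, P, ?_⟩
    rw [ENNReal.ofReal_coe_nnreal]
    exact hP.mono hr'0 hr'.le
  choose r hr P hP using key
  let c : unitInterval → Set unitInterval := fun t => {x | |(x : ℝ) - t| < r t / 2}
  have hc1 : ∀ i, IsOpen (c i) := fun i => isOpen_lt (by fun_prop) continuous_const
  have hc2 : univ ⊆ ⋃ i, c i := fun t _ => mem_iUnion.2 ⟨t, by
    have := hr t
    simp only [c, mem_ofPred_eq, sub_self, abs_zero]; positivity⟩
  obtain ⟨τ, hτ0, hmono, ⟨m, hm⟩, hτ⟩ :=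
    exists_monotone_Icc_subset_open_cover_unitInterval hc1 hc2
  have hcont : ∀ᶠ p in 𝓝 p₀, ∀ w : C(unitInterval, unitInterval),
      Continuous (fun t : unitInterval => g (p, (w t : ℝ))) := by
    filter_upwards [eventually_forall_analyticAt h] with p hp w
    rw [continuous_iff_continuousAt]
    intro t
    exact ContinuousAt.comp (f := fun t : unitInterval => (p, (w t : ℝ)))
      (hp _ (w t).2).continuousAt (by fun_prop)
  -- telescoping: going from `min t (τ n)` to `min t (τ (n + 1))` only involves the values of `g` on
  -- one of the short intervals
  have main : ∀ n : ℕ, AnalyticAt ℝ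
      (fun p => toC (fun t : unitInterval => g (p, ((min t (τ n) : unitInterval) : ℝ)))) p₀ := by
    intro n
    induction n with
    | zero =>
      have := analyticAt_toC_of_mem_ball (hr 0) (hP 0)
        (⟨fun t => ((min t (τ 0) : unitInterval) : ℝ), by fun_prop⟩ : C(unitInterval, ℝ)) (by
          intro x
          have h0 : min x (τ 0) = 0 := by
            rw [hτ0]; exact min_eq_right x.2.1
          simp only [ContinuousMap.coe_mk, h0, sub_self, abs_zero]
          have := hr 0
          positivity)
      exact this
    | succ n ih =>
      obtain ⟨i, hi⟩ := hτ n
      have hstep : τ n ≤ τ (n + 1) := hmono (Nat.le_succ n)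
      let w : C(unitInterval, unitInterval) :=
        ⟨fun t => max (τ n) (min t (τ (n + 1))), by fun_prop⟩
      have hw : ∀ t, w t ∈ c i := fun t => hi ⟨le_max_left _ _, max_le hstep (min_le_right _ _)⟩
      have h1 := analyticAt_toC_of_mem_ball (hr i) (hP i)
        (⟨fun t => (w t : ℝ), by fun_prop⟩ : C(unitInterval, ℝ)) (fun t => (hw t).le)
      have h2 := analyticAt_toC_of_mem_ball (X := unitInterval) (hr i) (hP i)
        (⟨fun t => (τ n : ℝ), by fun_prop⟩ : C(unitInterval, ℝ))
        (fun t => le_of_lt (hi ⟨le_rfl, hstep⟩))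
      refine ((ih.add h1).sub h2).congr ?_
      filter_upwards [hcont] with p hp
      ext t
      have c1 := hp ⟨fun t => min t (τ n), by fun_prop⟩
      have c2 := hp ⟨fun t => min t (τ (n + 1)), by fun_prop⟩
      have c3 := hp ⟨fun t => τ n, by fun_prop⟩
      have c4 := hp w
      simp only [ContinuousMap.coe_mk] at c1 c2 c3 c4
      simp only [Pi.add_apply, Pi.sub_apply, ContinuousMap.add_apply, ContinuousMap.sub_apply,
        ContinuousMap.coe_mk]
      rw [toC_apply c1, toC_apply c2, toC_apply c3, toC_apply c4]
      simp only [w, ContinuousMap.coe_mk]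
      rcases le_total t (τ n) with ht | ht
      · rw [min_eq_left ht, min_eq_left (ht.trans hstep), max_eq_left ht]; simp
      · rw [min_eq_right ht, max_eq_right (le_min ht hstep)]; simp
  refine (main m).congr (Eventually.of_forall fun p => ?_)
  have : ∀ t : unitInterval, min t (τ m) = t := fun t => by
    rw [hm m le_rfl]; exact min_eq_left t.2.2
  simp only [this]

/-- Integration over `[0, 1]`, as a continuous linear functional on `C([0, 1], F)`. -/
def integralCLM (F : Type*) [NormedAddCommGroup F] [NormedSpace ℝ F] :
    C(unitInterval, F) →L[ℝ] F :=
  LinearMap.mkContinuous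
    { toFun := fun φ => ∫ t in (0 : ℝ)..1, φ (projIcc 0 1 zero_le_one t)
      map_add' := by
        intro φ ψ
        simp only [ContinuousMap.add_apply]
        exact intervalIntegral.integral_add
          ((φ.continuous.comp continuous_projIcc).intervalIntegrable _ _)
          ((ψ.continuous.comp continuous_projIcc).intervalIntegrable _ _)
      map_smul' := by
        intro c φ
        simp } 1 (by
        intro φ
        refine (intervalIntegral.norm_integral_le_of_norm_le_const (C := ‖φ‖)
          (fun t _ => φ.norm_coe_le_norm _)).trans ?_
        simp)

lemma integralCLM_apply (φ : C(unitInterval, F)) :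
    integralCLM F φ = ∫ t in (0 : ℝ)..1, φ (projIcc 0 1 zero_le_one t) := rfl

lemma integralCLM_toC {f : ℝ → F} (hf : ContinuousOn f (Icc 0 1)) :
    integralCLM F (toC (fun t : unitInterval => f t)) = ∫ t in (0 : ℝ)..1, f t := by
  have hc : Continuous (fun t : unitInterval => f t) := hf.domRestrict
  rw [integralCLM_apply]
  refine intervalIntegral.integral_congr fun t ht => ?_
  rw [uIcc_of_le zero_le_one] at ht
  simp only [toC_apply hc]
  rw [projIcc_of_mem zero_le_one ht]

/-- Integrals of analytic families over `[0, 1]` depend analytically on the parameter. -/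
theorem analyticAt_integral [CompleteSpace F] {g : E × ℝ → F} {p₀ : E}
    (h : ∀ t ∈ Icc (0 : ℝ) 1, AnalyticAt ℝ g (p₀, t)) :
    AnalyticAt ℝ (fun p => ∫ t in (0 : ℝ)..1, g (p, t)) p₀ := by
  refine (((integralCLM F).analyticAt _).comp (analyticAt_toC h)).congr ?_
  filter_upwards [eventually_forall_analyticAt h] with p hp
  simp only [Function.comp_def]
  rw [integralCLM_toC (f := fun t => g (p, t))]
  intro t ht
  exact (ContinuousAt.comp (f := fun t : ℝ => (p, t)) (hp t ht).continuousAt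
    (by fun_prop)).continuousWithinAt

end Families

/-! ### Division by the first variable -/

section Hadamard

variable {E F : Type*} [NormedAddCommGroup E] [NormedSpace ℝ E]
  [NormedAddCommGroup F] [NormedSpace ℝ F]

/-- The partial derivative of `G (s, p)` with respect to `s`. -/
def partialFst (G : ℝ × E → F) : ℝ × E → F := fun w => fderiv ℝ G w (1, 0)

lemma analyticAt_partialFst [CompleteSpace F] {G : ℝ × E → F} {w : ℝ × E}
    (h : AnalyticAt ℝ G w) : AnalyticAt ℝ (partialFst G) w :=
  ((ContinuousLinearMap.apply ℝ F ((1, 0) : ℝ × E)).analyticAt _).comp h.fderiv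

lemma hasDerivAt_fst_of_analyticAt {G : ℝ × E → F} {s : ℝ} {p : E}
    (h : AnalyticAt ℝ G (s, p)) :
    HasDerivAt (fun s => G (s, p)) (partialFst G (s, p)) s := by
  have h1 : HasDerivAt (fun s : ℝ => (s, p)) ((1 : ℝ), (0 : E)) s :=
    (hasDerivAt_id s).prodMk (hasDerivAt_const s p)
  exact h.differentiableAt.hasFDerivAt.comp_hasDerivAt s h1

/-- The quotient `(G (s, p) - G (0, p)) / s`, written as an integral so that it is analytic
at `s = 0`. -/
def quot (G : ℝ × E → F) : ℝ × E → F :=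
  fun w => ∫ t in (0 : ℝ)..1, partialFst G (t * w.1, w.2)

/-- A property that holds near `s = 0` holds on the segments from `(0, p)` to nearby `(s, p)`. -/
lemma eventually_star {E : Type*} [TopologicalSpace E] {φ : ℝ × E → Prop} {p₀ : E}
    (h : ∀ᶠ w in 𝓝 ((0 : ℝ), p₀), φ w) :
    ∀ᶠ w in 𝓝 ((0 : ℝ), p₀), ∀ t ∈ Icc (0 : ℝ) 1, φ (t * w.1, w.2) := by
  refine isCompact_Icc.eventually_forall_of_forall_eventually ?_
  intro t _
  have hc : Tendsto (fun x : (ℝ × E) × ℝ => (x.2 * x.1.1, x.1.2)) (𝓝 (((0 : ℝ), p₀), t))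
      (𝓝 ((0 : ℝ), p₀)) := by
    have : Continuous (fun x : (ℝ × E) × ℝ => (x.2 * x.1.1, x.1.2)) := by fun_prop
    simpa using this.tendsto (((0 : ℝ), p₀), t)
  exact hc.eventually h

lemma analyticAt_quot [CompleteSpace F] {G : ℝ × E → F} {p₀ : E}
    (h : AnalyticAt ℝ G (0, p₀)) : AnalyticAt ℝ (quot G) (0, p₀) := by
  refine analyticAt_integral
    (g := fun x : (ℝ × E) × ℝ => partialFst G (x.2 * x.1.1, x.1.2)) ?_
  intro t _
  have h1 : AnalyticAt ℝ (partialFst G) (t * 0, p₀) := by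
    rw [mul_zero]; exact analyticAt_partialFst h
  refine AnalyticAt.comp (g := partialFst G)
    (f := fun x : (ℝ × E) × ℝ => (x.2 * x.1.1, x.1.2)) h1 ?_
  exact (analyticAt_snd.mul (analyticAt_fst.comp analyticAt_fst)).prod
    (analyticAt_snd.comp analyticAt_fst)

/-- Division with remainder by the first variable. -/
lemma eventually_eq_add_smul_quot [CompleteSpace F] {G : ℝ × E → F} {p₀ : E}
    (h : AnalyticAt ℝ G (0, p₀)) :
    ∀ᶠ w in 𝓝 ((0 : ℝ), p₀), G w = G (0, w.2) + w.1 • quot G w := by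
  filter_upwards [eventually_star h.eventually_analyticAt] with w hw
  have hd : ∀ t ∈ uIcc (0 : ℝ) 1, HasDerivAt (fun t => G (t * w.1, w.2))
      (w.1 • partialFst G (t * w.1, w.2)) t := by
    intro t ht
    rw [uIcc_of_le zero_le_one] at ht
    have := (hasDerivAt_fst_of_analyticAt (hw t ht)).scomp t
      ((hasDerivAt_id t).mul_const w.1)
    simpa [Function.comp_def] using this
  have hcont : ContinuousOn (fun t => w.1 • partialFst G (t * w.1, w.2)) (uIcc (0 : ℝ) 1) := by
    rw [uIcc_of_le zero_le_one]
    intro t ht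
    refine ContinuousAt.continuousWithinAt (ContinuousAt.const_smul ?_ _)
    exact ContinuousAt.comp (f := fun t : ℝ => (t * w.1, w.2)) (g := partialFst G)
      (analyticAt_partialFst (hw t ht)).continuousAt (by fun_prop)
  have := intervalIntegral.integral_eq_sub_of_hasDerivAt hd hcont.intervalIntegrable
  rw [intervalIntegral.integral_smul] at this
  simp only [one_mul, zero_mul, Prod.mk.eta] at this
  rw [quot, this]
  abel

/-- Continuous linear maps commute with division by the first variable. -/
lemma eventually_quot_map {F' : Type*} [NormedAddCommGroup F'] [NormedSpace ℝ F']
    [CompleteSpace F] [CompleteSpace F'] (L : F →L[ℝ] F') {G : ℝ × E → F} {G' : ℝ × E → F'} {p₀ : E}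
    (h : AnalyticAt ℝ G (0, p₀)) (hL : ∀ᶠ w in 𝓝 ((0 : ℝ), p₀), L (G w) = G' w) :
    ∀ᶠ w in 𝓝 ((0 : ℝ), p₀), L (quot G w) = quot G' w := by
  filter_upwards [eventually_star h.eventually_analyticAt,
    eventually_star hL.eventually_nhds] with w hw hw'
  have hint : IntervalIntegrable (fun t => partialFst G (t * w.1, w.2))
      MeasureTheory.volume 0 1 := by
    refine ContinuousOn.intervalIntegrable ?_
    rw [uIcc_of_le zero_le_one]
    intro t ht
    exact (ContinuousAt.comp (f := fun t : ℝ => (t * w.1, w.2)) (g := partialFst G)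
      (analyticAt_partialFst (hw t ht)).continuousAt (by fun_prop)).continuousWithinAt
  rw [quot, quot, ← ContinuousLinearMap.intervalIntegral_comp_comm L hint]
  refine intervalIntegral.integral_congr fun t ht => ?_
  rw [uIcc_of_le zero_le_one] at ht
  have h1 : G' =ᶠ[𝓝 (t * w.1, w.2)] fun w => L (G w) := by
    filter_upwards [hw' t ht] with x hx using hx.symm
  simp only [partialFst]
  rw [h1.fderiv_eq]
  have h2 := (L.hasFDerivAt.comp _ (hw t ht).differentiableAt.hasFDerivAt).fderiv
  rw [Function.comp_def] at h2
  rw [h2]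
  rfl

/-- The `n`-fold quotient, i.e. `s⁻ⁿ` times the Taylor remainder of order `n` in `s`. -/
def taylorQuot (G : ℝ × E → F) (n : ℕ) : ℝ × E → F := quot^[n] G

/-- The `n`-th Taylor coefficient of `G (s, p)` with respect to `s` at `s = 0`. -/
def taylorCoeff (G : ℝ × E → F) (n : ℕ) (p : E) : F := taylorQuot G n (0, p)

lemma taylorQuot_succ (G : ℝ × E → F) (n : ℕ) : taylorQuot G (n + 1) = quot (taylorQuot G n) :=
  Function.iterate_succ_apply' _ _ _

lemma analyticAt_taylorQuot [CompleteSpace F] {G : ℝ × E → F} {p₀ : E}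
    (h : AnalyticAt ℝ G (0, p₀)) (n : ℕ) : AnalyticAt ℝ (taylorQuot G n) (0, p₀) := by
  induction n with
  | zero => exact h
  | succ n ih => rw [taylorQuot_succ]; exact analyticAt_quot ih

lemma analyticAt_taylorCoeff [CompleteSpace F] {G : ℝ × E → F} {p₀ : E}
    (h : AnalyticAt ℝ G (0, p₀)) (n : ℕ) : AnalyticAt ℝ (taylorCoeff G n) p₀ :=
  AnalyticAt.comp (g := taylorQuot G n) (f := fun p => ((0 : ℝ), p))
    (analyticAt_taylorQuot h n) (analyticAt_const.prod analyticAt_id)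

/-- Taylor's formula in the first variable. -/
lemma eventually_taylor [CompleteSpace F] {G : ℝ × E → F} {p₀ : E}
    (h : AnalyticAt ℝ G (0, p₀)) (n : ℕ) :
    ∀ᶠ w in 𝓝 ((0 : ℝ), p₀),
      G w = ∑ i ∈ Finset.range n, w.1 ^ i • taylorCoeff G i w.2 + w.1 ^ n • taylorQuot G n w := by
  induction n with
  | zero => exact Eventually.of_forall fun w => by simp [taylorQuot]
  | succ n ih =>
    filter_upwards [ih, eventually_eq_add_smul_quot (analyticAt_taylorQuot h n)] with w h1 h2
    rw [h1, h2, Finset.sum_range_succ, taylorQuot_succ, taylorCoeff, smul_add, smul_smul, pow_succ,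
      add_assoc]

lemma eventually_taylorQuot_map {F' : Type*} [NormedAddCommGroup F'] [NormedSpace ℝ F']
    [CompleteSpace F] [CompleteSpace F'] (L : F →L[ℝ] F') {G : ℝ × E → F} {G' : ℝ × E → F'} {p₀ : E}
    (h : AnalyticAt ℝ G (0, p₀)) (hL : ∀ᶠ w in 𝓝 ((0 : ℝ), p₀), L (G w) = G' w) (n : ℕ) :
    ∀ᶠ w in 𝓝 ((0 : ℝ), p₀), L (taylorQuot G n w) = taylorQuot G' n w := by
  induction n with
  | zero => exact hL
  | succ n ih =>
    rw [taylorQuot_succ, taylorQuot_succ]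
    exact eventually_quot_map L (analyticAt_taylorQuot h n) ih

lemma eventually_taylorCoeff_map {F' : Type*} [NormedAddCommGroup F'] [NormedSpace ℝ F']
    [CompleteSpace F] [CompleteSpace F'] (L : F →L[ℝ] F') {G : ℝ × E → F} {G' : ℝ × E → F'} {p₀ : E}
    (h : AnalyticAt ℝ G (0, p₀)) (hL : ∀ᶠ w in 𝓝 ((0 : ℝ), p₀), L (G w) = G' w) (n : ℕ) :
    ∀ᶠ p in 𝓝 p₀, L (taylorCoeff G n p) = taylorCoeff G' n p := by
  have hc : Tendsto (fun p : E => ((0 : ℝ), p)) (𝓝 p₀) (𝓝 (0, p₀)) := by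
    have : Continuous (fun p : E => ((0 : ℝ), p)) := by fun_prop
    exact this.tendsto p₀
  exact hc.eventually (eventually_taylorQuot_map L h hL n)

end Hadamard

/-! ### The averaging operator -/

/-- The averaging operator `(L φ)(y) = ∫₀¹ φ(t y) dt = y⁻¹ ∫₀^y φ` on `C([0, 1], ℝ)`, the right
inverse of the differential operator `f ↦ (y f)'`. -/
def avg : C(unitInterval, ℝ) →L[ℝ] C(unitInterval, ℝ) :=
  LinearMap.mkContinuous
    { toFun := fun φ =>
        ⟨fun y => ∫ t in (0 : ℝ)..1, φ (projIcc 0 1 zero_le_one t * y), by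
          refine intervalIntegral.continuous_parametric_intervalIntegral_of_continuous' ?_ _ _
          exact φ.continuous.comp
            ((continuous_projIcc.comp continuous_snd).mul continuous_fst)⟩
      map_add' := by
        intro φ ψ
        ext y
        exact intervalIntegral.integral_add
          ((φ.continuous.comp (continuous_projIcc.mul continuous_const)).intervalIntegrable _ _)
          ((ψ.continuous.comp (continuous_projIcc.mul continuous_const)).intervalIntegrable _ _)
      map_smul' := by
        intro c φ
        ext y
        simp } 1 (by
        intro φ
        rw [ContinuousMap.norm_le _ (by positivity)]
        intro y
        refine (intervalIntegral.norm_integral_le_of_norm_le_const (C := ‖φ‖)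
          (fun t _ => φ.norm_coe_le_norm _)).trans ?_
        simp)

lemma avg_apply (φ : C(unitInterval, ℝ)) (y : unitInterval) :
    avg φ y = ∫ t in (0 : ℝ)..1, φ (projIcc 0 1 zero_le_one t * y) := rfl

lemma norm_avg_le : ‖avg‖ ≤ 1 := LinearMap.mkContinuous_norm_le _ zero_le_one _

/-- The primitive `y ↦ ∫₀^y φ` of a continuous function on `[0, 1]`, extended to the real line
by taking `φ` constant outside `[0, 1]`. -/
def primitive (φ : C(unitInterval, ℝ)) (y : ℝ) : ℝ :=
  ∫ t in (0 : ℝ)..y, φ (projIcc 0 1 zero_le_one t)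

lemma hasDerivAt_primitive (φ : C(unitInterval, ℝ)) (y : ℝ) :
    HasDerivAt (primitive φ) (φ (projIcc 0 1 zero_le_one y)) y := by
  have hc : Continuous fun t : ℝ => φ (projIcc 0 1 zero_le_one t) :=
    φ.continuous.comp continuous_projIcc
  exact intervalIntegral.integral_hasDerivAt_right (hc.intervalIntegrable _ _)
    (hc.stronglyMeasurableAtFilter _ _) hc.continuousAt

lemma primitive_eq (φ : C(unitInterval, ℝ)) {y : ℝ} (hy : y ∈ Icc (0 : ℝ) 1) :
    primitive φ y = y * avg φ ⟨y, hy⟩ := by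
  have h := intervalIntegral.mul_integral_comp_mul_right (a := 0) (b := 1)
    (f := fun t => φ (projIcc 0 1 zero_le_one t)) (c := y)
  rw [zero_mul, one_mul] at h
  rw [primitive, avg_apply, ← h]
  congr 1
  refine intervalIntegral.integral_congr fun t ht => ?_
  rw [uIcc_of_le zero_le_one] at ht
  have h1 : t * y ∈ Icc (0 : ℝ) 1 := ⟨mul_nonneg ht.1 hy.1, mul_le_one₀ ht.2 hy.1 hy.2⟩
  rw [projIcc_of_mem zero_le_one ht, projIcc_of_mem zero_le_one h1]
  rfl

/-! ### The formal solution -/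

section Formal

variable {B : Type*} [NormedAddCommGroup B] [NormedSpace ℝ B]

/-- The operator `(1 - κ L)⁻¹ L`. If `L` is the right inverse `avg` of `f ↦ (y f)'` and `|κ| < 1`,
it maps `r` to the solution `f` of `(y f)' - κ f = r`. -/
def resolvent (L : B →L[ℝ] B) (κ : ℝ) : B →L[ℝ] B := Ring.inverse (1 - κ • L) * L

lemma isUnit_one_sub_smul [CompleteSpace B] {L : B →L[ℝ] B} (hL : ‖L‖ ≤ 1) {κ : ℝ}
    (hκ : |κ| < 1) : IsUnit (1 - κ • L) := by
  refine isUnit_one_sub_of_norm_lt_one (R := B →L[ℝ] B) ?_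
  rw [norm_smul, Real.norm_eq_abs]
  nlinarith [hL, abs_nonneg κ, norm_nonneg L]

lemma resolvent_comm [CompleteSpace B] {L : B →L[ℝ] B} (hL : ‖L‖ ≤ 1) {κ : ℝ} (hκ : |κ| < 1)
    (r : B) : resolvent L κ (L r) = L (resolvent L κ r) := by
  obtain ⟨u, hu⟩ := isUnit_one_sub_smul hL hκ
  have hc : Commute (u : B →L[ℝ] B) L := by
    rw [hu, commute_iff_eq]
    refine ContinuousLinearMap.ext fun φ => ?_
    simp [sub_apply, mul_apply_eq_comp]
  have h2 := hc.units_inv_left.eq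
  have : resolvent L κ * L = L * resolvent L κ := by
    rw [resolvent, ← hu, Ring.inverse_unit, h2, mul_assoc, h2]
  exact congrArg (fun A : B →L[ℝ] B => A r) this

lemma resolvent_eq [CompleteSpace B] {L : B →L[ℝ] B} (hL : ‖L‖ ≤ 1) {κ : ℝ} (hκ : |κ| < 1) (r : B) :
    resolvent L κ r = L r + κ • L (resolvent L κ r) := by
  have h : (1 - κ • L) * resolvent L κ = L := by
    rw [resolvent, ← mul_assoc, Ring.mul_inverse_cancel _ (isUnit_one_sub_smul hL hκ), one_mul]
  have h1 := congrArg (fun A : B →L[ℝ] B => A r) h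
  simp only [mul_apply_eq_comp, sub_apply, one_apply_eq_self, smul_apply] at h1
  rw [← h1]
  abel

lemma analyticAt_resolvent [CompleteSpace B] {L : B →L[ℝ] B} (hL : ‖L‖ ≤ 1) {κ : ℝ}
    (hκ : |κ| < 1) : AnalyticAt ℝ (resolvent L) κ := by
  obtain ⟨u, hu⟩ := isUnit_one_sub_smul hL hκ
  have h1 := analyticAt_inverse (𝕜 := ℝ) (A := B →L[ℝ] B) u
  rw [hu] at h1
  have h2 : AnalyticAt ℝ (fun κ : ℝ => 1 - κ • L) κ :=
    analyticAt_const.sub (analyticAt_id.smul analyticAt_const)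
  exact (AnalyticAt.comp (g := Ring.inverse) (f := fun κ : ℝ => 1 - κ • L) h1 h2).mul
    analyticAt_const

/-- The coefficients of the formal power series solution `f = ∑ fₙ sⁿ` of the equation
`∂_y (y f) = q s ∂_s f + u`, where `q = ∑ qₙ sⁿ` and `u = ∑ uₙ sⁿ`. The equation for `fₙ` is
`(y fₙ)' - n q₀ fₙ = uₙ + ∑_{j < n} j q_{n - j} f_j`. -/
def formalCoeff (L : B →L[ℝ] B) (q : ℕ → ℝ) (u : ℕ → B) (n : ℕ) : B :=
  resolvent L (n * q 0) (u n + ∑ j : Fin n, ((j : ℕ) * q (n - j)) • formalCoeff L q u j)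

lemma formalCoeff_eq (L : B →L[ℝ] B) (q : ℕ → ℝ) (u : ℕ → B) (n : ℕ) :
    formalCoeff L q u n = resolvent L (n * q 0)
      (u n + ∑ j ∈ Finset.range n, ((j : ℕ) * q (n - j)) • formalCoeff L q u j) := by
  rw [formalCoeff, Finset.sum_range fun j => ((j : ℕ) * q (n - j)) • formalCoeff L q u j]

lemma abs_mul_lt_of_le {n N : ℕ} (h : n ≤ N) {x c : ℝ} (hx : |N * x| < c) : |n * x| < c := by
  refine lt_of_le_of_lt ?_ hx
  rw [abs_mul, abs_mul]
  gcongr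

/-- If `u = L u'` then also `f = L f'` for the formal solutions, which for `L = avg` means that
`∂_y (y f) = f'`, and the equation solved by `f` expresses `f'` through `f`. -/
lemma formalCoeff_map [CompleteSpace B] {L : B →L[ℝ] B} (hL : ‖L‖ ≤ 1) {q : ℕ → ℝ}
    {u u' : ℕ → B} {N : ℕ} (hq : |N * q 0| < 1) (hu : ∀ n ≤ N, L (u' n) = u n) :
    ∀ n ≤ N, L (formalCoeff L q u' n) = formalCoeff L q u n ∧
      formalCoeff L q u' n =
        u n + ∑ j ∈ Finset.range (n + 1), ((j : ℕ) * q (n - j)) • formalCoeff L q u j := by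
  intro n
  induction n using Nat.strong_induction_on with
  | _ n ih =>
    intro hn
    have hκ : |n * q 0| < 1 := abs_mul_lt_of_le hn hq
    have hr : L (u' n + ∑ j ∈ Finset.range n, ((j : ℕ) * q (n - j)) • formalCoeff L q u' j)
        = u n + ∑ j ∈ Finset.range n, ((j : ℕ) * q (n - j)) • formalCoeff L q u j := by
      rw [map_add, hu n hn, map_sum]
      congr 1
      refine Finset.sum_congr rfl fun j hj => ?_
      have hj' := Finset.mem_range.1 hj
      rw [map_smul, (ih j hj' (hj'.le.trans hn)).1]
    have h1 : L (formalCoeff L q u' n) = formalCoeff L q u n := by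
      rw [formalCoeff_eq L q u' n, formalCoeff_eq L q u n, ← resolvent_comm hL hκ, hr]
    refine ⟨h1, ?_⟩
    have h2 := resolvent_eq hL hκ
      (u' n + ∑ j ∈ Finset.range n, ((j : ℕ) * q (n - j)) • formalCoeff L q u' j)
    rw [← formalCoeff_eq L q u' n, h1, hr] at h2
    rw [h2, Finset.sum_range_succ, Nat.sub_self, add_assoc]

lemma analyticAt_formalCoeff [CompleteSpace B] {L : B →L[ℝ] B} (hL : ‖L‖ ≤ 1) {E : Type*}
    [NormedAddCommGroup E] [NormedSpace ℝ E] {p₀ : E}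
    {q : E → ℕ → ℝ} {u : E → ℕ → B}
    (hq : ∀ n, AnalyticAt ℝ (fun p => q p n) p₀) (hu : ∀ n, AnalyticAt ℝ (fun p => u p n) p₀)
    (n : ℕ) (hn : |n * q p₀ 0| < 1) :
    AnalyticAt ℝ (fun p => formalCoeff L (q p) (u p) n) p₀ := by
  induction n using Nat.strong_induction_on with
  | _ n ih =>
    have hA : AnalyticAt ℝ (fun p => resolvent L (n * q p 0)) p₀ :=
      AnalyticAt.comp (g := resolvent L) (f := fun p => n * q p 0) (analyticAt_resolvent hL hn)
        (analyticAt_const.mul (hq 0))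
    have hB : AnalyticAt ℝ (fun p => u p n + ∑ j ∈ Finset.range n,
        ((j : ℕ) * q p (n - j)) • formalCoeff L (q p) (u p) j) p₀ := by
      refine (hu n).add (Finset.analyticAt_fun_sum _ fun j hj => ?_)
      have hj' := Finset.mem_range.1 hj
      exact (analyticAt_const.mul (hq _)).smul (ih j hj' (abs_mul_lt_of_le hj'.le hn))
    have hC := ((ContinuousLinearMap.id ℝ (B →L[ℝ] B)
      ).analyticAt_bilinear _).comp₂ hA hB
    simp_rw [formalCoeff_eq L _ _ n]
    exact hC

/-- The partial sums of the formal solution solve the equation up to a multiple of `s ^ (N + 1)`,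
which is expressed through the Taylor remainders of `q` and `u`. -/
lemma formalCoeff_remainder {q : ℕ → ℝ} {u f d : ℕ → B} {N : ℕ} {s Q : ℝ}
    {U Ur : B} {qr : ℕ → ℝ}
    (hd : ∀ n ≤ N, d n = u n + ∑ j ∈ Finset.range (n + 1), ((j : ℕ) * q (n - j)) • f j)
    (hU : U = ∑ n ∈ Finset.range (N + 1), s ^ n • u n + s ^ (N + 1) • Ur)
    (hQ : ∀ m ≤ N + 1, Q = ∑ n ∈ Finset.range m, s ^ n * q n + s ^ m * qr m) :
    U + Q • ∑ n ∈ Finset.range (N + 1), (n * s ^ n) • f n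
        - ∑ n ∈ Finset.range (N + 1), s ^ n • d n
      = s ^ (N + 1) • (Ur + ∑ n ∈ Finset.range (N + 1), (n * qr (N + 1 - n)) • f n) := by
  have h1 : ∑ n ∈ Finset.range (N + 1), s ^ n • d n = ∑ n ∈ Finset.range (N + 1), s ^ n • u n
      + ∑ n ∈ Finset.range (N + 1), ∑ i ∈ Finset.range (N + 1 - n),
        (s ^ (n + i) * (n * q i)) • f n := by
    rw [← Finset.sum_range_diag_flip (N + 1) (fun n i => (s ^ (n + i) * (n * q i)) • f n),
      ← Finset.sum_add_distrib]
    refine Finset.sum_congr rfl fun n hn => ?_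
    rw [hd n (Nat.lt_succ_iff.1 (Finset.mem_range.1 hn)), smul_add, Finset.smul_sum]
    congr 1
    refine Finset.sum_congr rfl fun j hj => ?_
    rw [smul_smul, Nat.add_sub_cancel' (Nat.lt_succ_iff.1 (Finset.mem_range.1 hj))]
  have h2 : Q • ∑ n ∈ Finset.range (N + 1), (n * s ^ n) • f n
      = ∑ n ∈ Finset.range (N + 1), ∑ i ∈ Finset.range (N + 1 - n),
        (s ^ (n + i) * (n * q i)) • f n
      + s ^ (N + 1) • ∑ n ∈ Finset.range (N + 1), (n * qr (N + 1 - n)) • f n := by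
    rw [Finset.smul_sum, Finset.smul_sum, ← Finset.sum_add_distrib]
    refine Finset.sum_congr rfl fun n hn => ?_
    have hn' := Finset.mem_range.1 hn
    rw [← Finset.sum_smul, smul_smul, smul_smul, ← add_smul]
    congr 1
    have h3 : s ^ (N + 1) = s ^ n * s ^ (N + 1 - n) := by
      rw [← pow_add, Nat.add_sub_cancel' hn'.le]
    rw [hQ (N + 1 - n) (Nat.sub_le _ _), add_mul, Finset.sum_mul, h3]
    congr 1
    · refine Finset.sum_congr rfl fun i _ => ?_
      ring
    · ring
  rw [h1, h2, hU, smul_add]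
  abel

end Formal

/-! ### Uniform bounds for the iterates of `s ∂_s` -/

section ThetaBound

variable {ι : Type*} {S : Set ι} {δ : ℝ}

/-- The functions `g p`, `p ∈ S`, are continuous and `O(s ^ M)` on `(0, δ)`, uniformly in `p`. -/
def RateBound (S : Set ι) (δ : ℝ) (M : ℤ) (g : ι → ℝ → ℝ) : Prop :=
  (∀ p ∈ S, ContinuousOn (g p) (Ioo 0 δ)) ∧ ∃ C, ∀ p ∈ S, ∀ s ∈ Ioo 0 δ, |g p s| ≤ C * s ^ M

/-- `ThetaBound S δ k M g` says that the functions `g p`, `p ∈ S`, are `k` times continuously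
differentiable on `(0, δ)` and that `Θ^r (g p) = O(s ^ M)` there, uniformly in `p ∈ S`, for all
`r ≤ k`. -/
def ThetaBound (S : Set ι) (δ : ℝ) : ℕ → ℤ → (ι → ℝ → ℝ) → Prop
  | 0, M, g => RateBound S δ M g
  | k + 1, M, g => RateBound S δ M g ∧ (∀ p ∈ S, DifferentiableOn ℝ (g p) (Ioo 0 δ)) ∧
      ThetaBound S δ k M (fun p => Theta (g p))

lemma Theta_congr {f g : ℝ → ℝ} (h : EqOn f g (Ioo 0 δ)) :
    EqOn (Theta f) (Theta g) (Ioo 0 δ) := by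
  intro s hs
  have : f =ᶠ[𝓝 s] g := by
    filter_upwards [isOpen_Ioo.mem_nhds hs] with x hx using h hx
  change s * deriv f s = s * deriv g s
  rw [this.deriv_eq]

lemma ThetaBound.congr {k : ℕ} {M : ℤ} {f g : ι → ℝ → ℝ} (hf : ThetaBound S δ k M f)
    (h : ∀ p ∈ S, EqOn (f p) (g p) (Ioo 0 δ)) : ThetaBound S δ k M g := by
  induction k generalizing f g with
  | zero =>
    obtain ⟨h1, C, h2⟩ := hf
    refine ⟨fun p hp => (h1 p hp).congr (h p hp).symm, C, fun p hp s hs => ?_⟩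
    rw [← h p hp hs]; exact h2 p hp s hs
  | succ k ih =>
    obtain ⟨⟨h1, C, h2⟩, h3, h4⟩ := hf
    refine ⟨⟨fun p hp => (h1 p hp).congr (h p hp).symm, C, fun p hp s hs => ?_⟩,
      fun p hp => (h3 p hp).congr (h p hp).symm, ih h4 fun p hp => Theta_congr (h p hp)⟩
    rw [← h p hp hs]; exact h2 p hp s hs

lemma ThetaBound.rate {k : ℕ} {M : ℤ} {f : ι → ℝ → ℝ} (hf : ThetaBound S δ k M f) :
    RateBound S δ M f := by
  cases k with
  | zero => exact hf
  | succ k => exact hf.1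

lemma ThetaBound.of_succ {k : ℕ} {M : ℤ} {f : ι → ℝ → ℝ} (hf : ThetaBound S δ (k + 1) M f) :
    ThetaBound S δ k M f := by
  induction k generalizing f with
  | zero => exact hf.1
  | succ k ih => exact ⟨hf.1, hf.2.1, ih hf.2.2⟩

lemma ThetaBound.of_le {k r : ℕ} {M : ℤ} {f : ι → ℝ → ℝ} (hf : ThetaBound S δ k M f)
    (hr : r ≤ k) : ThetaBound S δ r M f := by
  induction k, hr using Nat.le_induction with
  | base => exact hf
  | succ k _ ih => exact ih hf.of_succ

lemma ThetaBound.mono_exponent {k : ℕ} {M M' : ℤ} {f : ι → ℝ → ℝ} (hf : ThetaBound S δ k M f)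
    (hδ : δ ≤ 1) (h : M' ≤ M) : ThetaBound S δ k M' f := by
  have key : ∀ f : ι → ℝ → ℝ, RateBound S δ M f → RateBound S δ M' f := by
    rintro f ⟨h1, C, h2⟩
    refine ⟨h1, |C|, fun p hp s hs => (h2 p hp s hs).trans ?_⟩
    have hs0 : 0 < s := hs.1
    have hs1 : s ≤ 1 := hs.2.le.trans hδ
    have : s ^ M ≤ s ^ M' := zpow_le_zpow_right_of_le_one₀ hs0 hs1 h
    have h3 : (0 : ℝ) ≤ s ^ M := by positivity
    calc C * s ^ M ≤ |C| * s ^ M := by gcongr; exact le_abs_self C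
      _ ≤ |C| * s ^ M' := by gcongr
  induction k generalizing f with
  | zero => exact key f hf
  | succ k ih => exact ⟨key f hf.1, hf.2.1, ih hf.2.2⟩

lemma ThetaBound.mono_right {k : ℕ} {M : ℤ} {f : ι → ℝ → ℝ} (hf : ThetaBound S δ k M f)
    {δ' : ℝ} (h : δ' ≤ δ) : ThetaBound S δ' k M f := by
  have key : ∀ f : ι → ℝ → ℝ, RateBound S δ M f → RateBound S δ' M f := by
    rintro f ⟨h1, C, h2⟩
    exact ⟨fun p hp => (h1 p hp).mono (Ioo_subset_Ioo_right h), C,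
      fun p hp s hs => h2 p hp s (Ioo_subset_Ioo_right h hs)⟩
  induction k generalizing f with
  | zero => exact key f hf
  | succ k ih =>
    exact ⟨key f hf.1, fun p hp => (hf.2.1 p hp).mono (Ioo_subset_Ioo_right h), ih hf.2.2⟩

lemma ThetaBound.add {k : ℕ} {M : ℤ} {f g : ι → ℝ → ℝ} (hf : ThetaBound S δ k M f)
    (hg : ThetaBound S δ k M g) : ThetaBound S δ k M (fun p s => f p s + g p s) := by
  have key : ∀ f g : ι → ℝ → ℝ, RateBound S δ M f → RateBound S δ M g →
      RateBound S δ M (fun p s => f p s + g p s) := by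
    rintro f g ⟨h1, C, h2⟩ ⟨h3, D, h4⟩
    refine ⟨fun p hp => (h1 p hp).add (h3 p hp), C + D, fun p hp s hs => ?_⟩
    calc |f p s + g p s| ≤ |f p s| + |g p s| := abs_add_le _ _
      _ ≤ C * s ^ M + D * s ^ M := add_le_add (h2 p hp s hs) (h4 p hp s hs)
      _ = (C + D) * s ^ M := by ring
  induction k generalizing f g with
  | zero => exact key f g hf hg
  | succ k ih =>
    refine ⟨key f g hf.1 hg.1, fun p hp => (hf.2.1 p hp).add (hg.2.1 p hp),
      (ih hf.2.2 hg.2.2).congr fun p hp s hs => ?_⟩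
    have h1 := (hf.2.1 p hp).differentiableAt (isOpen_Ioo.mem_nhds hs)
    have h2 := (hg.2.1 p hp).differentiableAt (isOpen_Ioo.mem_nhds hs)
    simp only [Theta]
    rw [deriv_fun_add h1 h2]
    ring

lemma ThetaBound.mul {k : ℕ} {M M' : ℤ} {f g : ι → ℝ → ℝ} (hf : ThetaBound S δ k M f)
    (hg : ThetaBound S δ k M' g) : ThetaBound S δ k (M + M') (fun p s => f p s * g p s) := by
  have key : ∀ f g : ι → ℝ → ℝ, RateBound S δ M f → RateBound S δ M' g →
      RateBound S δ (M + M') (fun p s => f p s * g p s) := by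
    rintro f g ⟨h1, C, h2⟩ ⟨h3, D, h4⟩
    refine ⟨fun p hp => (h1 p hp).mul (h3 p hp), C * D, fun p hp s hs => ?_⟩
    rw [abs_mul, zpow_add₀ hs.1.ne']
    calc |f p s| * |g p s| ≤ (C * s ^ M) * (D * s ^ M') :=
          mul_le_mul (h2 p hp s hs) (h4 p hp s hs) (abs_nonneg _)
            ((abs_nonneg _).trans (h2 p hp s hs))
      _ = C * D * (s ^ M * s ^ M') := by ring
  induction k generalizing f g with
  | zero => exact key f g hf hg
  | succ k ih =>
    refine ⟨key f g hf.1 hg.1, fun p hp => (hf.2.1 p hp).mul (hg.2.1 p hp),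
      ((ih hf.2.2 hg.of_succ).add (ih hf.of_succ hg.2.2)).congr fun p hp s hs => ?_⟩
    have h1 := (hf.2.1 p hp).differentiableAt (isOpen_Ioo.mem_nhds hs)
    have h2 := (hg.2.1 p hp).differentiableAt (isOpen_Ioo.mem_nhds hs)
    simp only [Theta]
    rw [deriv_fun_mul h1 h2]
    ring

lemma ThetaBound.zero (k : ℕ) (M : ℤ) : ThetaBound S δ k M (fun _ _ => 0) := by
  have key : RateBound S δ M (fun _ _ => 0) :=
    ⟨fun p _ => continuousOn_const, 0, fun p _ s _ => by simp⟩
  induction k with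
  | zero => exact key
  | succ k ih =>
    refine ⟨key, fun p _ => differentiableOn_const _, ih.congr fun p _ s _ => ?_⟩
    simp [Theta]

lemma ThetaBound.const {k : ℕ} {c : ι → ℝ} {C : ℝ} (hc : ∀ p ∈ S, |c p| ≤ C) :
    ThetaBound S δ k 0 (fun p _ => c p) := by
  have key : RateBound S δ 0 (fun p (_ : ℝ) => c p) :=
    ⟨fun p _ => continuousOn_const, C, fun p hp s _ => by simpa using hc p hp⟩
  cases k with
  | zero => exact key
  | succ k =>
    refine ⟨key, fun p _ => differentiableOn_const _,
      (ThetaBound.zero k 0).congr fun p _ s _ => ?_⟩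
    simp [Theta]

lemma ThetaBound.zpow (k : ℕ) (m : ℤ) : ThetaBound S δ k m (fun _ s => s ^ m) := by
  have key : RateBound S δ m (fun _ s => s ^ m) := by
    refine ⟨fun p _ s hs => ?_, 1, fun p _ s hs => ?_⟩
    · exact (continuousAt_zpow₀ s m (Or.inl hs.1.ne')).continuousWithinAt
    · rw [abs_of_nonneg (zpow_nonneg hs.1.le m), one_mul]
  induction k with
  | zero => exact key
  | succ k ih =>
    refine ⟨key, fun p _ s hs =>
      (differentiableAt_zpow.2 (Or.inl hs.1.ne')).differentiableWithinAt, ?_⟩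
    have h := (ThetaBound.const (S := S) (δ := δ) (k := k) (c := fun _ => (m : ℝ)) (C := |(m : ℝ)|)
      (fun p _ => le_rfl)).mul ih
    rw [zero_add] at h
    refine h.congr fun p _ s hs => ?_
    have hs0 : s ≠ 0 := hs.1.ne'
    simp only [Theta, deriv_zpow]
    rw [zpow_sub_one₀ hs0]
    field_simp

lemma ThetaBound.const_mul_zpow (k : ℕ) (m : ℤ) {c : ι → ℝ} {C : ℝ} (hc : ∀ p ∈ S, |c p| ≤ C) :
    ThetaBound S δ k m (fun p s => c p * s ^ m) := by
  have h := (ThetaBound.const (S := S) (δ := δ) (k := k) hc).mul (ThetaBound.zpow k m)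
  rwa [zero_add] at h

lemma ThetaBound.neg {k : ℕ} {M : ℤ} {f : ι → ℝ → ℝ} (hf : ThetaBound S δ k M f) :
    ThetaBound S δ k M (fun p s => - f p s) := by
  have h := (ThetaBound.const (S := S) (δ := δ) (k := k) (c := fun _ => (-1 : ℝ)) (C := 1)
    (fun p _ => by simp)).mul hf
  rw [zero_add] at h
  exact h.congr fun p _ s _ => by simp

lemma ThetaBound.sub {k : ℕ} {M : ℤ} {f g : ι → ℝ → ℝ} (hf : ThetaBound S δ k M f)
    (hg : ThetaBound S δ k M g) : ThetaBound S δ k M (fun p s => f p s - g p s) :=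
  (hf.add hg.neg).congr fun _ _ _ _ => (sub_eq_add_neg _ _).symm

lemma ThetaBound.sum {κ : Type*} {k : ℕ} {M : ℤ} (t : Finset κ) {f : κ → ι → ℝ → ℝ}
    (hf : ∀ i ∈ t, ThetaBound S δ k M (f i)) :
    ThetaBound S δ k M (fun p s => ∑ i ∈ t, f i p s) := by
  classical
  induction t using Finset.induction_on with
  | empty => simpa using ThetaBound.zero k M
  | insert a t ha ih =>
    have h := (hf a (Finset.mem_insert_self a t)).add
      (ih fun i hi => hf i (Finset.mem_insert_of_mem hi))
    exact h.congr fun p _ s _ => by simp [Finset.sum_insert ha]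

/-- A crude bound for the reciprocal: each application of `Θ` at most doubles the exponent. -/
lemma ThetaBound.inv {k m : ℕ} {f : ι → ℝ → ℝ} (hf : ThetaBound S δ k 0 f) {c : ℝ} (hc : 0 < c)
    (hlow : ∀ p ∈ S, ∀ s ∈ Ioo 0 δ, c * s ^ m ≤ f p s) (hδ : δ ≤ 1) :
    ThetaBound S δ k (-((m * 2 ^ k : ℕ) : ℤ)) (fun p s => (f p s)⁻¹) := by
  have hne : ∀ p ∈ S, ∀ s ∈ Ioo 0 δ, 0 < f p s := fun p hp s hs =>
    lt_of_lt_of_le (mul_pos hc (pow_pos hs.1 m)) (hlow p hp s hs)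
  have key : RateBound S δ (-(m : ℤ)) (fun p s => (f p s)⁻¹) := by
    refine ⟨fun p hp => (hf.rate.1 p hp).inv₀ fun s hs => (hne p hp s hs).ne', c⁻¹,
      fun p hp s hs => ?_⟩
    rw [abs_of_pos (inv_pos.2 (hne p hp s hs)), zpow_neg, zpow_natCast, ← mul_inv]
    exact inv_anti₀ (mul_pos hc (pow_pos hs.1 m)) (hlow p hp s hs)
  induction k with
  | zero =>
    rw [pow_zero, mul_one]
    exact key
  | succ k ih =>
    have h2 := ih hf.of_succ
    refine ⟨ThetaBound.mono_exponent (k := 0) key hδ ?_, fun p hp =>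
      (hf.2.1 p hp).inv fun s hs => (hne p hp s hs).ne', ?_⟩
    · have : m ≤ m * 2 ^ (k + 1) := Nat.le_mul_of_pos_right m (by positivity)
      exact neg_le_neg (by exact_mod_cast this)
    · have h3 := ((hf.2.2.mul h2).mul h2).neg
      have he : (0 : ℤ) + -((m * 2 ^ k : ℕ) : ℤ) + -((m * 2 ^ k : ℕ) : ℤ)
          = -((m * 2 ^ (k + 1) : ℕ) : ℤ) := by push_cast; ring
      rw [he] at h3
      refine h3.congr fun p hp s hs => ?_
      have hd := (hf.2.1 p hp).differentiableAt (isOpen_Ioo.mem_nhds hs)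
      have hs' := (hne p hp s hs).ne'
      simp only [Theta]
      rw [deriv_fun_inv'' hd hs']
      field_simp

lemma thetaBound_of_analyticOnNhd {E : Type*} [NormedAddCommGroup E] [NormedSpace ℝ E]
    {S : Set E} (hS : IsCompact S) {G : ℝ × E → ℝ} (hG : AnalyticOnNhd ℝ G (Icc 0 δ ×ˢ S)) (k : ℕ) :
    ThetaBound S δ k 0 (fun p s => G (s, p)) := by
  have key : ∀ G : ℝ × E → ℝ, AnalyticOnNhd ℝ G (Icc 0 δ ×ˢ S) →
      RateBound S δ 0 (fun p s => G (s, p)) := by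
    intro G hG
    obtain ⟨C, hC⟩ := (isCompact_Icc.prod hS).exists_bound_of_continuousOn hG.continuousOn
    refine ⟨fun p hp s hs => ?_, C, fun p hp s hs => ?_⟩
    · exact (hasDerivAt_fst_of_analyticAt
        (hG (s, p) ⟨Ioo_subset_Icc_self hs, hp⟩)).continuousAt.continuousWithinAt
    · simpa using hC (s, p) ⟨Ioo_subset_Icc_self hs, hp⟩
  induction k generalizing G with
  | zero => exact key G hG
  | succ k ih =>
    refine ⟨key G hG, fun p hp s hs => (hasDerivAt_fst_of_analyticAt
        (hG (s, p) ⟨Ioo_subset_Icc_self hs, hp⟩)).differentiableAt.differentiableWithinAt, ?_⟩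
    refine (ih (G := fun w => w.1 * partialFst G w)
      fun w hw => analyticAt_fst.mul (analyticAt_partialFst (hG w hw))).congr fun p hp s hs => ?_
    simp only [Theta]
    rw [(hasDerivAt_fst_of_analyticAt (hG (s, p) ⟨Ioo_subset_Icc_self hs, hp⟩)).deriv]

lemma ThetaBound.contDiffOn {k : ℕ} {M : ℤ} {f : ι → ℝ → ℝ} (hf : ThetaBound S δ k M f) {p : ι}
    (hp : p ∈ S) : ContDiffOn ℝ k (f p) (Ioo 0 δ) := by
  induction k generalizing f with
  | zero => simpa using hf.1 p hp
  | succ k ih =>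
    have h1 : ContDiffOn ℝ k (fun s => s⁻¹ * Theta (f p) s) (Ioo 0 δ) :=
      (contDiffOn_id.inv fun s hs => hs.1.ne').mul (ih hf.2.2)
    push_cast
    rw [contDiffOn_succ_iff_deriv_of_isOpen isOpen_Ioo]
    refine ⟨hf.2.1 p hp, by simp, h1.congr fun s hs => ?_⟩
    have hs0 : s ≠ 0 := hs.1.ne'
    simp only [Theta]
    field_simp

lemma ThetaBound.iterate {k : ℕ} {M : ℤ} {f : ι → ℝ → ℝ} (hf : ThetaBound S δ k M f) {r : ℕ}
    (hr : r ≤ k) : RateBound S δ M (fun p => Theta^[r] (f p)) := by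
  induction r generalizing f k with
  | zero => exact hf.rate
  | succ r ih =>
    obtain ⟨k, rfl⟩ : ∃ k', k = k' + 1 := ⟨k - 1, by omega⟩
    have := ih hf.2.2 (by omega)
    simpa only [Function.iterate_succ_apply] using this

lemma ThetaBound.tendstoUniformlyOn {k : ℕ} {f : ι → ℝ → ℝ} (hf : ThetaBound S δ k 1 f)
    (hδ : 0 < δ) {r : ℕ} (hr : r ≤ k) :
    TendstoUniformlyOn (fun (s : ℝ) (p : ι) => (Theta^[r] (f p)) s) (fun _ => 0) (𝓝[>] 0) S := by
  obtain ⟨-, C, hC⟩ := hf.iterate hr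
  rw [Metric.tendstoUniformlyOn_iff]
  intro e he
  have h1 : ∀ᶠ s in 𝓝[>] (0 : ℝ), s < e / (|C| + 1) :=
    (eventually_lt_nhds (by positivity)).filter_mono nhdsWithin_le_nhds
  filter_upwards [Ioo_mem_nhdsGT hδ, h1] with s hs hs1 p hp
  rw [dist_comm, Real.dist_eq, sub_zero]
  have h2 := hC p hp s hs
  rw [zpow_one] at h2
  rw [lt_div_iff₀ (by positivity)] at hs1
  nlinarith [le_abs_self C, hs.1]

end ThetaBound

/-! ### Integrals with variable endpoints -/

lemma continuousOn_of_eventually {f : ℝ → ℝ} {S : Set ℝ}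
    (hf : ∀ x ∈ S, ∀ᶠ y in 𝓝 x, ContinuousAt f y) : ContinuousOn f S :=
  fun x hx => (hf x hx).self_of_nhds.continuousWithinAt

lemma hasDerivAt_integral_right {f : ℝ → ℝ} {c x : ℝ}
    (hf : ∀ t ∈ uIcc c x, ∀ᶠ y in 𝓝 t, ContinuousAt f y) :
    HasDerivAt (fun x => ∫ t in c..x, f t) (f x) x := by
  have hx := hf x right_mem_uIcc
  obtain ⟨W, hW, hWo, hxW⟩ := eventually_nhds_iff.1 hx
  refine intervalIntegral.integral_hasDerivAt_right
    (continuousOn_of_eventually hf).intervalIntegrable ?_ hx.self_of_nhds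
  exact ContinuousOn.stronglyMeasurableAtFilter hWo
    (fun y hy => (hW y hy).continuousWithinAt) x hxW

lemma hasDerivAt_integral_left {f : ℝ → ℝ} {c x : ℝ}
    (hf : ∀ t ∈ uIcc c x, ∀ᶠ y in 𝓝 t, ContinuousAt f y) :
    HasDerivAt (fun x => ∫ t in x..c, f t) (-f x) x := by
  have h := (hasDerivAt_integral_right hf).fun_neg
  refine h.congr_of_eventuallyEq (Eventually.of_forall fun y => ?_)
  exact intervalIntegral.integral_symm _ _

/-- Differentiation of `∫_s^X F(s, x) dx` with respect to `s`. -/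
lemma hasDerivAt_integral_of_left_param {F F' : ℝ → ℝ → ℝ} {s X : ℝ} (hsX : s ≤ X)
    (hF : ∀ x ∈ Icc s X, ∀ᶠ z : ℝ × ℝ in 𝓝 (s, x), ContinuousAt (fun z : ℝ × ℝ => F z.1 z.2) z)
    (hF' : ∀ x ∈ Icc s X, ∀ᶠ z : ℝ × ℝ in 𝓝 (s, x),
      ContinuousAt (fun z : ℝ × ℝ => F' z.1 z.2) z)
    (hd : ∀ x ∈ Icc s X, ∀ᶠ z : ℝ × ℝ in 𝓝 (s, x),
      HasDerivAt (fun s => F s z.2) (F' z.1 z.2) z.1) :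
    HasDerivAt (fun s => ∫ x in s..X, F s x) (-F s s + ∫ x in s..X, F' s x) s := by
  have hslice : ∀ (G : ℝ → ℝ → ℝ) (a b : ℝ), ContinuousAt (fun z : ℝ × ℝ => G z.1 z.2) (a, b) →
      ContinuousAt (G a) b := fun G a b h =>
    ContinuousAt.comp (f := fun b => (a, b)) (g := fun z : ℝ × ℝ => G z.1 z.2) h (by fun_prop)
  have hFc := isCompact_Icc.eventually_forall_of_forall_eventually
    (P := fun r x => ContinuousAt (fun z : ℝ × ℝ => F z.1 z.2) (r, x)) hF
  have hF'c := isCompact_Icc.eventually_forall_of_forall_eventually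
    (P := fun r x => ContinuousAt (fun z : ℝ × ℝ => F' z.1 z.2) (r, x)) hF'
  have hdc := isCompact_Icc.eventually_forall_of_forall_eventually
    (P := fun r x => HasDerivAt (fun s => F s x) (F' r x) r) hd
  have hF'0 : ContinuousOn (F' s) (Icc s X) := fun x hx =>
    (hslice _ _ _ (hF' x hx).self_of_nhds).continuousWithinAt
  obtain ⟨C, hC⟩ := isCompact_Icc.exists_bound_of_continuousOn hF'0
  have hbd : ∀ᶠ r in 𝓝 s, ∀ x ∈ Icc s X, ‖F' r x‖ ≤ C + 1 := by
    refine isCompact_Icc.eventually_forall_of_forall_eventually fun x hx => ?_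
    have h1 := (hF' x hx).self_of_nhds.norm
    have h2 : ‖F' s x‖ < C + 1 := by linarith [hC x hx]
    filter_upwards [h1.eventually (eventually_lt_nhds h2)] with z hz using hz.le
  have hu : uIoc s X ⊆ Icc s X := by rw [uIoc_of_le hsX]; exact Ioc_subset_Icc_self
  have hint : ∀ᶠ r in 𝓝 s, IntervalIntegrable (F r) MeasureTheory.volume s X := by
    filter_upwards [hFc] with r hr
    refine ContinuousOn.intervalIntegrable ?_
    rw [uIcc_of_le hsX]
    exact fun x hx => (hslice _ _ _ (hr x hx)).continuousWithinAt
  -- the part of the integral between fixed endpoints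
  have hB : HasDerivAt (fun r => ∫ x in s..X, F r x) (∫ x in s..X, F' s x) s := by
    refine (intervalIntegral.hasDerivAt_integral_of_dominated_loc_of_deriv_le
      (bound := fun _ => C + 1) (F' := F') (hbd.and hdc) ?_ hint.self_of_nhds ?_ ?_ ?_ ?_).2
    · filter_upwards [hint] with r hr
      rw [uIoc_of_le hsX]
      exact hr.aestronglyMeasurable
    · rw [uIoc_of_le hsX]
      refine ContinuousOn.aestronglyMeasurable (hF'0.mono Ioc_subset_Icc_self) measurableSet_Ioc
    · exact Eventually.of_forall fun x hx r hr => hr.1 x (hu hx)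
    · exact intervalIntegrable_const
    · exact Eventually.of_forall fun x hx r hr => hr.2 x (hu hx)
  -- the part of the integral between `r` and `s`
  have hFs := hF s ⟨le_rfl, hsX⟩
  have hsq : ∀ φ : ℝ × ℝ → Prop, (∀ᶠ z in 𝓝 (s, s), φ z) →
      ∀ᶠ r in 𝓝 s, ∀ x ∈ uIcc r s, φ (r, x) := by
    intro φ hφ
    obtain ⟨e, he, hball⟩ := Metric.eventually_nhds_iff_ball.1 hφ
    filter_upwards [Metric.ball_mem_nhds s he] with r hr x hx
    refine hball _ ?_
    have hr' : |r - s| < e := by simpa [Real.dist_eq] using hr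
    have hx' : |x - s| < e := by
      rw [abs_sub_comm] at hr' ⊢
      exact (abs_sub_right_of_mem_uIcc hx).trans_lt hr'
    simp only [Metric.mem_ball, Prod.dist_eq, Real.dist_eq]
    exact max_lt hr' hx'
  have hA : HasDerivAt (fun r => ∫ x in r..s, F r x) (-F s s) s := by
    rw [hasDerivAt_iff_isLittleO, Asymptotics.isLittleO_iff]
    intro c hc
    have h1 : ∀ᶠ z in 𝓝 (s, s), |F z.1 z.2 - F s s| < c := by
      have := hFs.self_of_nhds.tendsto
      rw [Metric.tendsto_nhds] at this
      simpa [Real.dist_eq] using this c hc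
    filter_upwards [hsq _ h1, hsq _ hFs] with r hr hr2
    have hi : IntervalIntegrable (F r) MeasureTheory.volume r s :=
      ContinuousOn.intervalIntegrable fun x hx =>
        (hslice _ _ _ (hr2 x hx)).continuousWithinAt
    have h2 : ∫ x in r..s, (F r x - F s s) = (∫ x in r..s, F r x) - (s - r) * F s s := by
      rw [intervalIntegral.integral_sub hi intervalIntegrable_const,
        intervalIntegral.integral_const, smul_eq_mul]
    have h3 := intervalIntegral.norm_integral_le_of_norm_le_const (a := r) (b := s)
      (f := fun x => F r x - F s s) (C := c) fun x hx => (hr x (uIoc_subset_uIcc hx)).le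
    rw [h2] at h3
    rw [intervalIntegral.integral_same, Real.norm_eq_abs, Real.norm_eq_abs, abs_sub_comm r s]
    refine le_trans (le_of_eq ?_) h3
    rw [Real.norm_eq_abs]
    congr 1
    simp only [smul_eq_mul]
    ring
  refine (hA.add hB).congr_of_eventuallyEq ?_
  filter_upwards [hint, hsq _ hFs] with r hr hr2
  have hi : IntervalIntegrable (F r) MeasureTheory.volume r s :=
    ContinuousOn.intervalIntegrable fun x hx => (hslice _ _ _ (hr2 x hx)).continuousWithinAt
  exact (intervalIntegral.integral_add_adjacent_intervals hi hr).symm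

/-! ### The orbits and the time integral -/

/-- The orbit of `b(x) ∂_x - v(x) y ∂_y` through `(s, 1)` is the graph of `y = orbit w s x` with
`w = v / b`. -/
def orbit (w : ℝ → ℝ) (s x : ℝ) : ℝ := Real.exp (-∫ t in s..x, w t)

/-- The integral of the time form `y u(x, y) dx / b(x)` along the orbit through `(s, 1)` from
`{x = s}` to `{x = X}`, in terms of `w = v / b` and `m = 1 / b`. -/
def orbitTime (w m : ℝ → ℝ) (u : ℝ → ℝ → ℝ) (X s : ℝ) : ℝ :=
  ∫ x in s..X, orbit w s x * u x (orbit w s x) * m x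

lemma orbit_pos (w : ℝ → ℝ) (s x : ℝ) : 0 < orbit w s x := Real.exp_pos _

@[simp] lemma orbit_self (w : ℝ → ℝ) (s : ℝ) : orbit w s s = 1 := by simp [orbit]

lemma hasDerivAt_orbit {w : ℝ → ℝ} {s x : ℝ}
    (hw : ∀ t ∈ uIcc s x, ∀ᶠ y in 𝓝 t, ContinuousAt w y) :
    HasDerivAt (orbit w s) (-(w x * orbit w s x)) x := by
  have h := (hasDerivAt_integral_right hw).fun_neg.exp
  refine h.congr_deriv ?_
  rw [orbit]; ring

lemma hasDerivAt_orbit_left {w : ℝ → ℝ} {s x : ℝ}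
    (hw : ∀ t ∈ uIcc s x, ∀ᶠ y in 𝓝 t, ContinuousAt w y) :
    HasDerivAt (fun s => orbit w s x) (w s * orbit w s x) s := by
  rw [uIcc_comm] at hw
  have h := (hasDerivAt_integral_left hw).fun_neg.exp
  refine h.congr_deriv ?_
  rw [orbit]; ring

lemma orbit_mul_orbit {w : ℝ → ℝ} {s r x : ℝ} {S : Set ℝ} (hS : S.OrdConnected) (hs : s ∈ S)
    (hr : r ∈ S) (hx : x ∈ S) (hw : ContinuousOn w S) :
    orbit w s r * orbit w r x = orbit w s x := by
  rw [orbit, orbit, orbit, ← Real.exp_add, ← neg_add,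
    intervalIntegral.integral_add_adjacent_intervals]
  · exact (hw.mono (hS.uIcc_subset hs hr)).intervalIntegrable
  · exact (hw.mono (hS.uIcc_subset hr hx)).intervalIntegrable

lemma continuousAt_orbit_prod {w : ℝ → ℝ} {S : Set ℝ} (hS : S.OrdConnected)
    (hw : ∀ x ∈ S, ∀ᶠ y in 𝓝 x, ContinuousAt w y) {s x : ℝ} (hs : s ∈ S) (hx : x ∈ S) :
    ContinuousAt (fun z : ℝ × ℝ => orbit w z.1 z.2) (s, x) := by
  have h1 : ContinuousAt (fun z : ℝ × ℝ => orbit w z.1 s * orbit w s z.2) (s, x) := by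
    refine ContinuousAt.mul ?_ ?_
    · refine ContinuousAt.comp (f := fun z : ℝ × ℝ => z.1) (g := fun r => orbit w r s) ?_
        continuousAt_fst
      exact (hasDerivAt_orbit_left fun y hy => hw y (hS.uIcc_subset hs hs hy)).continuousAt
    · refine ContinuousAt.comp (f := fun z : ℝ × ℝ => z.2) (g := fun r => orbit w s r) ?_
        continuousAt_snd
      exact (hasDerivAt_orbit fun y hy => hw y (hS.uIcc_subset hs hx hy)).continuousAt
  refine h1.congr ?_
  have hint : ∀ a ∈ S, ∀ᶠ r in 𝓝 a, IntervalIntegrable w MeasureTheory.volume a r := by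
    intro a ha
    obtain ⟨e, he, hball⟩ := Metric.eventually_nhds_iff_ball.1 (hw a ha)
    filter_upwards [Metric.ball_mem_nhds a he] with r hr
    refine ContinuousOn.intervalIntegrable fun y hy => (hball y ?_).continuousWithinAt
    exact (convex_ball a e).ordConnected.uIcc_subset (Metric.mem_ball_self he) hr hy
  have hSint : ∀ a ∈ S, ∀ c ∈ S, IntervalIntegrable w MeasureTheory.volume a c :=
    fun a ha c hc => ((continuousOn_of_eventually hw).mono
      (hS.uIcc_subset ha hc)).intervalIntegrable
  have e1 : ∀ᶠ z : ℝ × ℝ in 𝓝 (s, x), IntervalIntegrable w MeasureTheory.volume s z.1 :=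
    (continuous_fst.tendsto (s, x)).eventually (hint s hs)
  have e2 : ∀ᶠ z : ℝ × ℝ in 𝓝 (s, x), IntervalIntegrable w MeasureTheory.volume x z.2 :=
    (continuous_snd.tendsto (s, x)).eventually (hint x hx)
  filter_upwards [e1, e2] with z h1 h2
  rw [orbit, orbit, orbit, ← Real.exp_add, ← neg_add,
    intervalIntegral.integral_add_adjacent_intervals h1.symm ((hSint s hs x hx).trans h2)]

/-- The derivative of the time integral with respect to the initial point. Differentiating the
integrand amounts to replacing `u` by `∂_y (y u)`. -/
theorem hasDerivAt_orbitTime {w m : ℝ → ℝ} {u : ℝ → ℝ → ℝ} {X s : ℝ} (hs : 0 < s) (hsX : s ≤ X)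
    (hw : ∀ x ∈ Ioc 0 X, ∀ᶠ y in 𝓝 x, ContinuousAt w y)
    (hm : ∀ x ∈ Ioc 0 X, ∀ᶠ y in 𝓝 x, ContinuousAt m y)
    (hu : ∀ x ∈ Ioc 0 X, ∀ y ∈ Icc (0 : ℝ) 1, AnalyticAt ℝ (fun z : ℝ × ℝ => u z.1 z.2) (x, y))
    (h1 : ∀ x ∈ Icc s X, orbit w s x ≤ 1) :
    HasDerivAt (orbitTime w m u X)
      (-(u s 1 * m s) + w s * orbitTime w m (fun x y => deriv (fun y => y * u x y) y) X s) s := by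
  have hsub : ∀ x ∈ Icc s X, x ∈ Ioc 0 X := fun x hx => ⟨hs.trans_le hx.1, hx.2⟩
  have hsS : s ∈ Ioc 0 X := ⟨hs, hsX⟩
  set u' : ℝ → ℝ → ℝ := fun x y => deriv (fun y => y * u x y) y with hu'
  have hanY : ∀ x ∈ Icc s X, ∀ᶠ z : ℝ × ℝ in 𝓝 (s, x),
      AnalyticAt ℝ (fun z : ℝ × ℝ => u z.1 z.2) (z.2, orbit w z.1 z.2) := by
    intro x hx
    have hc : ContinuousAt (fun z : ℝ × ℝ => (z.2, orbit w z.1 z.2)) (s, x) :=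
      continuousAt_snd.prodMk (continuousAt_orbit_prod ordConnected_Ioc hw hsS (hsub x hx))
    exact hc.eventually
      (hu x (hsub x hx) _ ⟨(orbit_pos w s x).le, h1 x hx⟩).eventually_analyticAt
  have hSev : ∀ x ∈ Icc s X, ∀ᶠ z : ℝ × ℝ in 𝓝 (s, x),
      ContinuousAt (fun z : ℝ × ℝ => orbit w z.1 z.2) z ∧
      HasDerivAt (fun r => orbit w r z.2) (w z.1 * orbit w z.1 z.2) z.1 ∧
      ContinuousAt w z.1 ∧ ContinuousAt m z.2 := by
    intro x hx
    -- continuity of `w` persists on a slightly larger interval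
    have hcmp : ∀ᶠ e in 𝓝 (0 : ℝ), ∀ y ∈ Icc s X, ∀ᶠ t in 𝓝 (y + e), ContinuousAt w t := by
      refine isCompact_Icc.eventually_forall_of_forall_eventually fun y hy => ?_
      have hc : Tendsto (fun z : ℝ × ℝ => z.2 + z.1) (𝓝 ((0 : ℝ), y)) (𝓝 y) := by
        have : Continuous (fun z : ℝ × ℝ => z.2 + z.1) := by fun_prop
        simpa using this.tendsto ((0 : ℝ), y)
      exact hc.eventually (hw y (hsub y hy)).eventually_nhds
    obtain ⟨e, he, hball⟩ := Metric.eventually_nhds_iff_ball.1 hcmp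
    have hwS : ∀ y ∈ Ioo (s - e) (X + e), ∀ᶠ t in 𝓝 y, ContinuousAt w t := by
      intro y hy
      have hp : max s (min y X) ∈ Icc s X := ⟨le_max_left _ _, max_le hsX (min_le_right _ _)⟩
      have := hball (y - max s (min y X)) (by
        rw [Metric.mem_ball, Real.dist_eq, sub_zero, abs_lt]
        have h1 := hy.1
        have h2 := hy.2
        rcases le_total y X with h | h
        · rw [min_eq_left h]
          rcases le_total s y with h' | h'
          · rw [max_eq_right h']; constructor <;> linarith
          · rw [max_eq_left h']; constructor <;> linarith
        · rw [min_eq_right h, max_eq_right hsX]; constructor <;> linarith) _ hp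
      simpa using this
    have hO : Ioo (s - e) (X + e) ×ˢ Ioo (s - e) (X + e) ∈ 𝓝 (s, x) := by
      refine (isOpen_Ioo.prod isOpen_Ioo).mem_nhds ⟨⟨by linarith, by linarith⟩, ?_, ?_⟩
      · have := hx.1
        simp only
        linarith
      · have := hx.2
        simp only
        linarith
    have hm' : ∀ᶠ z : ℝ × ℝ in 𝓝 (s, x), ContinuousAt m z.2 :=
      (continuous_snd.tendsto (s, x)).eventually (hm x (hsub x hx))
    filter_upwards [hO, hm'] with z hz hmz
    exact ⟨continuousAt_orbit_prod ordConnected_Ioo hwS hz.1 hz.2,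
      hasDerivAt_orbit_left fun y hy => hwS y (ordConnected_Ioo.uIcc_subset hz.1 hz.2 hy),
      (hwS _ hz.1).self_of_nhds, hmz⟩
  have han' : ∀ a : ℝ × ℝ, AnalyticAt ℝ (fun z : ℝ × ℝ => u z.1 z.2) a →
      ContinuousAt (fun z : ℝ × ℝ => u' z.1 z.2) a ∧
      HasDerivAt (fun y => y * u a.1 y) (u' a.1 a.2) a.2 := by
    intro a ha
    have hyu : AnalyticAt ℝ (fun z : ℝ × ℝ => z.2 * u z.1 z.2) a := analyticAt_snd.mul ha
    have hder : ∀ z : ℝ × ℝ, AnalyticAt ℝ (fun z : ℝ × ℝ => z.2 * u z.1 z.2) z →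
        HasDerivAt (fun y => y * u z.1 y)
          (fderiv ℝ (fun z : ℝ × ℝ => z.2 * u z.1 z.2) z (0, 1)) z.2 := by
      intro z hz
      have h2 : HasDerivAt (fun y : ℝ => (z.1, y)) ((0 : ℝ), (1 : ℝ)) z.2 :=
        (hasDerivAt_const z.2 z.1).prodMk (hasDerivAt_id z.2)
      exact HasFDerivAt.comp_hasDerivAt (l := fun z : ℝ × ℝ => z.2 * u z.1 z.2) z.2
        hz.differentiableAt.hasFDerivAt h2
    refine ⟨?_, ?_⟩
    · have hc : ContinuousAt (fun z => fderiv ℝ (fun z : ℝ × ℝ => z.2 * u z.1 z.2) z (0, 1)) a :=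
        hyu.fderiv.continuousAt.clm_apply continuousAt_const
      refine hc.congr ?_
      filter_upwards [hyu.eventually_analyticAt] with z hz
      exact ((hder z hz).deriv).symm
    · have := hder a hyu
      rwa [← this.deriv] at this
  have key := hasDerivAt_integral_of_left_param
    (F := fun s x => orbit w s x * u x (orbit w s x) * m x)
    (F' := fun s x => w s * (orbit w s x * u' x (orbit w s x) * m x)) hsX ?_ ?_ ?_
  · refine key.congr_deriv ?_
    rw [intervalIntegral.integral_const_mul, orbit_self, one_mul]
    rfl
  · intro x hx
    filter_upwards [hanY x hx, hSev x hx] with z hz hz2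
    have hc : ContinuousAt (fun z : ℝ × ℝ => (z.2, orbit w z.1 z.2)) z :=
      continuousAt_snd.prodMk hz2.1
    refine (hz2.1.mul ?_).mul (hz2.2.2.2.comp continuousAt_snd)
    exact ContinuousAt.comp (g := fun z : ℝ × ℝ => u z.1 z.2)
      (f := fun z : ℝ × ℝ => (z.2, orbit w z.1 z.2)) hz.continuousAt hc
  · intro x hx
    filter_upwards [hanY x hx, hSev x hx] with z hz hz2
    have hc : ContinuousAt (fun z : ℝ × ℝ => (z.2, orbit w z.1 z.2)) z :=
      continuousAt_snd.prodMk hz2.1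
    refine (hz2.2.2.1.comp continuousAt_fst).mul
      ((hz2.1.mul ?_).mul (hz2.2.2.2.comp continuousAt_snd))
    exact ContinuousAt.comp (g := fun z : ℝ × ℝ => u' z.1 z.2)
      (f := fun z : ℝ × ℝ => (z.2, orbit w z.1 z.2)) (han' _ hz).1 hc
  · intro x hx
    filter_upwards [hanY x hx, hSev x hx] with z hz hz2
    have h2 := ((han' _ hz).2.comp z.1 hz2.2.1).mul_const (m z.2)
    refine h2.congr_deriv ?_
    ring

/-- The comparison of the time integral with the approximate solution. The function
`W = ∑ xⁿ y fₙ(y)` changes along the orbit by the integral of `-y u`, up to the integral of the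
remainder, and the latter is controlled by the decay of `x ^ (N + 1) y` along the orbit. -/
lemma near_estimate {δ s C : ℝ} {N : ℕ} {q Y J : ℝ → ℝ} {f d : ℕ → C(unitInterval, ℝ)}
    {U : ℝ → C(unitInterval, ℝ)} (hs : 0 < s) (hsδ : s ≤ δ)
    (hq : ∀ x ∈ Icc s δ, 0 < q x ∧ 2 * (N + 1) * q x ≤ 1)
    (hYs : Y s = 1) (hYm : ∀ x ∈ Icc s δ, Y x ∈ Icc (0 : ℝ) 1)
    (hY : ∀ x ∈ Icc s δ, HasDerivAt Y (-(Y x / (x * q x))) x)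
    (hfd : ∀ n ≤ N, avg (d n) = f n)
    (hR : ∀ x ∈ Icc s δ, ‖U x + q x • ∑ n ∈ Finset.range (N + 1), (n * x ^ n) • f n
        - ∑ n ∈ Finset.range (N + 1), x ^ n • d n‖ ≤ C * x ^ (N + 1))
    (hJ : ∀ x ∈ Icc s δ,
      HasDerivAt J (Y x * U x (projIcc 0 1 zero_le_one (Y x)) / (x * q x)) x) :
    Y δ * δ ^ (N + 1) ≤ s ^ (N + 1) ∧
    |J δ - J s - ∑ n ∈ Finset.range (N + 1), f n 1 * s ^ n
      + Y δ * ∑ n ∈ Finset.range (N + 1), δ ^ n * f n (projIcc 0 1 zero_le_one (Y δ))|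
      ≤ 2 * C * s ^ (N + 1) := by
  have hpr : ∀ x ∈ Icc s δ, ∀ n ≤ N,
      primitive (d n) (Y x) = Y x * f n (projIcc 0 1 zero_le_one (Y x)) := by
    intro x hx n hn
    rw [primitive_eq (d n) (hYm x hx), hfd n hn, projIcc_of_mem zero_le_one (hYm x hx)]
  let W : ℝ → ℝ := fun x => ∑ n ∈ Finset.range (N + 1), x ^ n * primitive (d n) (Y x)
  have hWeq : ∀ x ∈ Icc s δ, W x = Y x * ∑ n ∈ Finset.range (N + 1),
      x ^ n * f n (projIcc 0 1 zero_le_one (Y x)) := by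
    intro x hx
    simp only [W]
    rw [Finset.mul_sum]
    refine Finset.sum_congr rfl fun n hn => ?_
    rw [hpr x hx n (Nat.lt_succ_iff.1 (Finset.mem_range.1 hn))]
    ring
  let R : ℝ → C(unitInterval, ℝ) := fun x =>
    U x + q x • ∑ n ∈ Finset.range (N + 1), (n * x ^ n) • f n
        - ∑ n ∈ Finset.range (N + 1), x ^ n • d n
  have hJW : ∀ x ∈ Icc s δ, HasDerivAt (fun x => J x + W x)
      (Y x * R x (projIcc 0 1 zero_le_one (Y x)) / (x * q x)) x := by
    intro x hx
    have hx0 : x ≠ 0 := (hs.trans_le hx.1).ne'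
    have hq0 : q x ≠ 0 := (hq x hx).1.ne'
    have hW : HasDerivAt W (∑ n ∈ Finset.range (N + 1),
        ((n : ℝ) * x ^ (n - 1) * primitive (d n) (Y x)
          + x ^ n * (d n (projIcc 0 1 zero_le_one (Y x)) * -(Y x / (x * q x))))) x := by
      refine HasDerivAt.fun_sum fun n _ => ?_
      exact (hasDerivAt_pow n x).mul ((hasDerivAt_primitive (d n) (Y x)).comp x (hY x hx))
    refine ((hJ x hx).add hW).congr_deriv ?_
    simp only [R, ContinuousMap.sub_apply, ContinuousMap.add_apply, ContinuousMap.smul_apply,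
      ContinuousMap.sum_apply, smul_eq_mul]
    have h1 : ∑ n ∈ Finset.range (N + 1),
        ((n : ℝ) * x ^ (n - 1) * primitive (d n) (Y x)
          + x ^ n * (d n (projIcc 0 1 zero_le_one (Y x)) * -(Y x / (x * q x))))
        = Y x / (x * q x) * (q x * ∑ n ∈ Finset.range (N + 1),
            (n * x ^ n) * f n (projIcc 0 1 zero_le_one (Y x))
          - ∑ n ∈ Finset.range (N + 1), x ^ n * d n (projIcc 0 1 zero_le_one (Y x))) := by
      rw [Finset.mul_sum, ← Finset.sum_sub_distrib, Finset.mul_sum]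
      refine Finset.sum_congr rfl fun n hn => ?_
      rw [hpr x hx n (Nat.lt_succ_iff.1 (Finset.mem_range.1 hn))]
      rcases n with _ | n
      · simp; ring
      · simp only [Nat.add_sub_cancel]
        field_simp
        ring
    rw [h1]
    ring
  have hZ : ∀ x ∈ Icc s δ, HasDerivAt (fun x => x ^ (N + 1) * Y x)
      (((N + 1 : ℕ) : ℝ) * x ^ N * Y x + x ^ (N + 1) * -(Y x / (x * q x))) x := by
    intro x hx
    exact (hasDerivAt_pow (N + 1) x).mul (hY x hx)
  -- the decay of `x ^ (N + 1) y`, from `q ≤ 1 / (2 (N + 1))`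
  have hdecay : ∀ x ∈ Icc s δ, x ^ (N + 1) * (Y x / (x * q x))
      ≤ -2 * (((N + 1 : ℕ) : ℝ) * x ^ N * Y x + x ^ (N + 1) * -(Y x / (x * q x))) := by
    intro x hx
    have hx0 : 0 < x := hs.trans_le hx.1
    obtain ⟨hq0, hq1⟩ := hq x hx
    have hy0 := (hYm x hx).1
    have h1 : x ^ (N + 1) * (Y x / (x * q x)) = x ^ N * Y x / q x := by
      field_simp
      ring
    have h2 : 2 * ((N + 1 : ℕ) : ℝ) * (x ^ N * Y x) ≤ x ^ N * Y x / q x := by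
      rw [le_div_iff₀ hq0]
      have : 0 ≤ x ^ N * Y x := by positivity
      push_cast
      nlinarith
    rw [mul_neg, h1]
    linarith
  have hbound : ∀ (G G' : ℝ → ℝ) (D : ℝ), 0 ≤ D → (∀ x ∈ Icc s δ, HasDerivAt G (G' x) x) →
      (∀ x ∈ Icc s δ, |G' x| ≤ D * (x ^ (N + 1) * (Y x / (x * q x)))) →
      |G δ - G s| ≤ 2 * D * (s ^ (N + 1) - δ ^ (N + 1) * Y δ) := by
    intro G G' D hD hG hG'
    have := image_norm_le_of_norm_deriv_right_le_deriv_boundary' (a := s) (b := δ)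
      (f := fun x => G x - G s) (f' := G')
      (B := fun x => 2 * D * (s ^ (N + 1) * Y s - x ^ (N + 1) * Y x))
      (B' := fun x => 2 * D * -(((N + 1 : ℕ) : ℝ) * x ^ N * Y x
        + x ^ (N + 1) * -(Y x / (x * q x))))
      (fun x hx => ((hG x hx).continuousAt.sub continuousAt_const).continuousWithinAt)
      (fun x hx => ((hG x (Ico_subset_Icc_self hx)).sub_const _).hasDerivWithinAt)
      (by simp)
      (fun x hx => (((hZ x hx).const_sub _).const_mul _).continuousAt.continuousWithinAt)
      (fun x hx => (((hZ x (Ico_subset_Icc_self hx)).const_sub _).const_mul _).hasDerivWithinAt)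
      (fun x hx => by
        have h1 := hG' x (Ico_subset_Icc_self hx)
        have h2 := hdecay x (Ico_subset_Icc_self hx)
        rw [Real.norm_eq_abs]
        nlinarith)
      (x := δ) ⟨hsδ, le_rfl⟩
    simpa [hYs] using this
  refine ⟨?_, ?_⟩
  · have h := hbound (fun _ => 0) (fun _ => 0) 1 zero_le_one
      (fun x _ => hasDerivAt_const x 0) (fun x hx => by
        have hx0 : 0 < x := hs.trans_le hx.1
        have hq0 := (hq x hx).1
        have hy0 := (hYm x hx).1
        rw [abs_zero]
        positivity)
    simp only [sub_self, abs_zero] at h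
    linarith [mul_comm (δ ^ (N + 1)) (Y δ)]
  · have hC : 0 ≤ C := by
      have h1 := (norm_nonneg _).trans (hR s ⟨le_rfl, hsδ⟩)
      exact nonneg_of_mul_nonneg_left h1 (pow_pos hs _)
    have h := hbound _ _ C hC hJW (fun x hx => by
      have hx0 : 0 < x := hs.trans_le hx.1
      have hq0 := (hq x hx).1
      have hy0 := (hYm x hx).1
      have h2 := ((R x).norm_coe_le_norm (projIcc 0 1 zero_le_one (Y x))).trans (hR x hx)
      rw [Real.norm_eq_abs] at h2
      rw [abs_div, abs_mul, abs_of_nonneg hy0, abs_of_pos (mul_pos hx0 hq0)]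
      calc Y x * |R x (projIcc 0 1 zero_le_one (Y x))| / (x * q x)
          = |R x (projIcc 0 1 zero_le_one (Y x))| * (Y x / (x * q x)) := by ring
        _ ≤ C * x ^ (N + 1) * (Y x / (x * q x)) := by gcongr
        _ = _ := by ring)
    have hYδ := (hYm δ ⟨hsδ, le_rfl⟩).1
    have hsum : W s = ∑ n ∈ Finset.range (N + 1), f n 1 * s ^ n := by
      rw [hWeq s ⟨le_rfl, hsδ⟩, hYs, one_mul]
      refine Finset.sum_congr rfl fun n _ => ?_
      rw [projIcc_right, mul_comm]
      rfl
    rw [← hWeq δ ⟨hsδ, le_rfl⟩, ← hsum]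
    have h3 : J δ - J s - W s + W δ = J δ + W δ - (J s + W s) := by ring
    rw [h3]
    refine h.trans ?_
    have : 0 ≤ δ ^ (N + 1) * Y δ := mul_nonneg (pow_nonneg (hs.le.trans hsδ) _) hYδ
    nlinarith

/-! ### The Dulac time as an integral -/

lemma orbit_translate (w : ℝ → ℝ) (θ s x : ℝ) :
    orbit (fun t => w (t + θ)) s x = orbit w (s + θ) (x + θ) := by
  rw [orbit, orbit, intervalIntegral.integral_comp_add_right w θ]

lemma orbitTime_translate (w m : ℝ → ℝ) (u : ℝ → ℝ → ℝ) (θ X s : ℝ) :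
    orbitTime (fun t => w (t + θ)) (fun t => m (t + θ)) (fun t => u (t + θ)) X s
      = orbitTime w m u (X + θ) (s + θ) := by
  rw [orbitTime, orbitTime, ← intervalIntegral.integral_comp_add_right _ θ]
  simp only [orbit_translate]

section Dulac

variable {p : Polynomial ℝ} {v : ℝ → ℝ} {u : ℝ → ℝ → ℝ} {x₀ : ℝ}

lemma eventually_continuousAt_inv_eval (hp : ∀ x ∈ Icc x₀ 1, 0 < p.eval x) :
    ∀ x ∈ Icc x₀ 1, ∀ᶠ y in 𝓝 x, ContinuousAt (fun x => (p.eval x)⁻¹) y := by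
  intro x hx
  filter_upwards [p.continuous.continuousAt.eventually (eventually_gt_nhds (hp x hx))] with y hy
  exact p.continuous.continuousAt.inv₀ hy.ne'

lemma eventually_continuousAt_div_eval (hp : ∀ x ∈ Icc x₀ 1, 0 < p.eval x)
    (hv : ∀ x ∈ Icc x₀ 1, AnalyticAt ℝ v x) :
    ∀ x ∈ Icc x₀ 1, ∀ᶠ y in 𝓝 x, ContinuousAt (fun x => v x * (p.eval x)⁻¹) y := by
  intro x hx
  filter_upwards [eventually_continuousAt_inv_eval hp x hx, (hv x hx).eventually_analyticAt]
    with y h1 h2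
  exact h2.continuousAt.mul h1

/-- The integrand of the time integral is continuous near every point at which the orbit satisfies
`y ≤ 1`. -/
lemma eventually_continuousAt_integrand (hp : ∀ x ∈ Icc x₀ 1, 0 < p.eval x)
    (hv : ∀ x ∈ Icc x₀ 1, AnalyticAt ℝ v x)
    (hu : ∀ x ∈ Icc x₀ 1, ∀ y ∈ Icc (0 : ℝ) 1, AnalyticAt ℝ (fun z : ℝ × ℝ => u z.1 z.2) (x, y))
    {x : ℝ} (hx : x ∈ Icc x₀ 1) (h1 : orbit (fun x => v x * (p.eval x)⁻¹) x₀ x ≤ 1) :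
    ∀ᶠ y in 𝓝 x, ContinuousAt (fun x => orbit (fun x => v x * (p.eval x)⁻¹) x₀ x *
      u x (orbit (fun x => v x * (p.eval x)⁻¹) x₀ x) * (p.eval x)⁻¹) y := by
  set w : ℝ → ℝ := fun x => v x * (p.eval x)⁻¹
  have hw := eventually_continuousAt_div_eval hp hv
  have hx₀ : x₀ ∈ Icc x₀ 1 := ⟨le_rfl, hx.1.trans hx.2⟩
  have hs : ∀ y ∈ Icc x₀ 1, uIcc x₀ y ⊆ Icc x₀ 1 := fun y hy =>
    ordConnected_Icc.uIcc_subset hx₀ hy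
  have hYc : ∀ᶠ y in 𝓝 x, ContinuousAt (orbit w x₀) y := by
    obtain ⟨e, he, hball⟩ := Metric.eventually_nhds_iff_ball.1 (hw x hx)
    filter_upwards [Metric.ball_mem_nhds x he] with y hy
    refine (hasDerivAt_orbit fun t ht => ?_).continuousAt
    by_cases htx : t ∈ Metric.ball x e
    · exact eventually_nhds_iff.2 ⟨Metric.ball x e, hball, Metric.isOpen_ball, htx⟩
    · refine hw t (hs x hx ?_)
      have hxe := Metric.mem_ball.1 hy
      rw [Metric.mem_ball] at htx
      rw [Real.dist_eq, abs_lt] at hxe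
      rw [Real.dist_eq, abs_lt, not_and_or, not_lt, not_lt] at htx
      rw [uIcc_of_le hx.1]
      rcases mem_uIcc.1 ht with h | h <;> rcases htx with h' | h' <;> constructor <;>
        linarith [h.1, h.2, hxe.1, hxe.2, hx.1]
  have hua : ∀ᶠ y in 𝓝 x, AnalyticAt ℝ (fun z : ℝ × ℝ => u z.1 z.2) (y, orbit w x₀ y) := by
    have hc : ContinuousAt (fun y => (y, orbit w x₀ y)) x :=
      continuousAt_id.prodMk hYc.self_of_nhds
    exact hc.eventually (hu x hx _ ⟨(orbit_pos w x₀ x).le, h1⟩).eventually_analyticAt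
  filter_upwards [hYc, hua, eventually_continuousAt_inv_eval hp x hx] with y h2 h3 h4
  have hc : ContinuousAt (fun y => (y, orbit w x₀ y)) y := continuousAt_id.prodMk h2
  exact (h2.mul (ContinuousAt.comp (g := fun z : ℝ × ℝ => u z.1 z.2)
    (f := fun y => (y, orbit w x₀ y)) h3.continuousAt hc)).mul h4

/-- If the Dulac time is defined, it is given by the time integral. -/
theorem IsDulacTime.eq_orbitTime {T : ℝ} (h : IsDulacTime p v u x₀ T)
    (hp : ∀ x ∈ Icc x₀ 1, 0 < p.eval x) (hv : ∀ x ∈ Icc x₀ 1, AnalyticAt ℝ v x)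
    (hu : ∀ x ∈ Icc x₀ 1, ∀ y ∈ Icc (0 : ℝ) 1, AnalyticAt ℝ (fun z : ℝ × ℝ => u z.1 z.2) (x, y)) :
    T = orbitTime (fun x => v x * (p.eval x)⁻¹) (fun x => (p.eval x)⁻¹) u 1 x₀ := by
  obtain ⟨τ₁, hτ₁, x, y, t, hx0, hy0, ht0, hx1, ht1, hode⟩ := h
  set w : ℝ → ℝ := fun x => v x * (p.eval x)⁻¹
  have hw := eventually_continuousAt_div_eval hp hv
  have hright : ∀ {f : ℝ → ℝ} {f' τ : ℝ}, τ ∈ Ico 0 τ₁ → HasDerivWithinAt f f' (Icc 0 τ₁) τ →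
      HasDerivWithinAt f f' (Ici τ) τ := fun hτ hf =>
    hf.mono_of_mem_nhdsWithin (Icc_mem_nhdsGE_of_mem hτ)
  have hxc : ContinuousOn x (Icc 0 τ₁) := fun τ hτ => (hode τ hτ).2.2.1.continuousWithinAt
  have hyc : ContinuousOn y (Icc 0 τ₁) := fun τ hτ => (hode τ hτ).2.2.2.1.continuousWithinAt
  have htc : ContinuousOn t (Icc 0 τ₁) := fun τ hτ => (hode τ hτ).2.2.2.2.continuousWithinAt
  have hx₀1 : x₀ ≤ 1 := by
    have := (hode 0 ⟨le_rfl, hτ₁⟩).1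
    rw [hx0] at this
    exact (le_abs_self _).trans this
  -- the orbit cannot cross `x = x₀` to the left, since `p` is positive there
  have hge : ∀ τ ∈ Icc 0 τ₁, x₀ ≤ x τ := by
    intro τ hτ
    refine image_le_of_deriv_right_lt_deriv_boundary' (f := fun _ => x₀) (f' := fun _ => 0)
      (B := x) (B' := fun τ => p.eval (x τ)) continuousOn_const
      (fun τ _ => hasDerivWithinAt_const _ _ _) hx0.ge hxc
      (fun τ hτ => hright hτ (hode τ (Ico_subset_Icc_self hτ)).2.2.1) ?_ hτ
    intro τ _ heq
    rw [← show x₀ = x τ from heq]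
    exact hp x₀ ⟨le_rfl, hx₀1⟩
  have hmem : ∀ τ ∈ Icc 0 τ₁, x τ ∈ Icc x₀ 1 := fun τ hτ =>
    ⟨hge τ hτ, (le_abs_self _).trans (hode τ hτ).1⟩
  have hs : ∀ y ∈ Icc x₀ 1, uIcc x₀ y ⊆ Icc x₀ 1 := fun y hy =>
    ordConnected_Icc.uIcc_subset ⟨le_rfl, hx₀1⟩ hy
  have hYd : ∀ τ ∈ Icc 0 τ₁, HasDerivAt (orbit w x₀) (-(w (x τ) * orbit w x₀ (x τ))) (x τ) :=
    fun τ hτ => hasDerivAt_orbit fun r hr => hw r (hs _ (hmem τ hτ) hr)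
  have hyY : ∀ τ ∈ Icc 0 τ₁, y τ = orbit w x₀ (x τ) := by
    have hc := constant_of_has_deriv_right_zero (a := 0) (b := τ₁)
      (f := fun τ => y τ * (orbit w x₀ (x τ))⁻¹)
      (hyc.mul (ContinuousOn.inv₀ (fun τ hτ => ContinuousWithinAt.comp_of_eq (g := orbit w x₀)
        (hYd τ hτ).continuousAt.continuousWithinAt (hxc τ hτ) (mapsTo_univ _ _) rfl)
        fun τ _ => (orbit_pos w x₀ (x τ)).ne')) ?_
    · intro τ hτ
      have := hc τ hτ
      simp only [hy0, hx0, orbit_self, inv_one, mul_one] at this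
      have h2 := (orbit_pos w x₀ (x τ)).ne'
      field_simp at this
      exact this
    · intro τ hτ
      have hτ' := Ico_subset_Icc_self hτ
      obtain ⟨-, -, h1, h2, -⟩ := hode τ hτ'
      have h3 := ((hYd τ hτ').comp_hasDerivWithinAt τ (hright hτ h1)).inv (orbit_pos w x₀ (x τ)).ne'
      refine ((hright hτ h2).mul h3).congr_deriv ?_
      have h4 := (orbit_pos w x₀ (x τ)).ne'
      have h5 : w (x τ) * p.eval (x τ) = v (x τ) :=
        inv_mul_cancel_right₀ (hp _ (hmem τ hτ')).ne' _
      simp only [Function.comp_def, Pi.inv_apply]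
      rw [← h5]
      field_simp
      ring
  have hYle : ∀ τ ∈ Icc 0 τ₁, orbit w x₀ (x τ) ≤ 1 := fun τ hτ => by
    rw [← hyY τ hτ]; exact (le_abs_self _).trans (hode τ hτ).2.1
  -- by the intermediate value theorem the orbit passes over every point of `[x₀, 1]`
  have hsurj : ∀ ξ ∈ Icc x₀ 1, ∃ τ ∈ Icc 0 τ₁, x τ = ξ := by
    intro ξ hξ
    have := intermediate_value_Icc hτ₁ hxc
    rw [hx0, hx1] at this
    exact this hξ
  have hint : ∀ ξ ∈ Icc x₀ 1, ∀ᶠ r in 𝓝 ξ, ContinuousAt (fun x => orbit w x₀ x *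
      u x (orbit w x₀ x) * (p.eval x)⁻¹) r := by
    intro ξ hξ
    obtain ⟨τ, hτ, rfl⟩ := hsurj ξ hξ
    exact eventually_continuousAt_integrand hp hv hu hξ (hYle τ hτ)
  set g : ℝ → ℝ := fun x => orbit w x₀ x * u x (orbit w x₀ x) * (p.eval x)⁻¹
  have hGd : ∀ τ ∈ Icc 0 τ₁, HasDerivAt (fun ξ => ∫ r in x₀..ξ, g r) (g (x τ)) (x τ) :=
    fun τ hτ => hasDerivAt_integral_right fun r hr => hint r (hs _ (hmem τ hτ) hr)
  have hc := constant_of_has_deriv_right_zero (a := 0) (b := τ₁)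
      (f := fun τ => t τ - ∫ r in x₀..(x τ), g r)
      (htc.sub fun τ hτ => ContinuousWithinAt.comp_of_eq (g := fun ξ => ∫ r in x₀..ξ, g r)
        (hGd τ hτ).continuousAt.continuousWithinAt (hxc τ hτ) (mapsTo_univ _ _) rfl) ?_
      τ₁ ⟨hτ₁, le_rfl⟩
  · simp only [ht0, ht1, hx0, hx1, intervalIntegral.integral_same, sub_zero] at hc
    rw [orbitTime]
    linarith
  · intro τ hτ
    have hτ' := Ico_subset_Icc_self hτ
    obtain ⟨-, -, h1, -, h2⟩ := hode τ hτ'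
    refine ((hright hτ h2).sub
      ((hGd τ hτ').comp_hasDerivWithinAt τ (hright hτ h1))).congr_deriv ?_
    have h5 := (hp _ (hmem τ hτ')).ne'
    rw [hyY τ hτ']
    simp only [g]
    field_simp
    ring

/-- A solution of `x' = p(x)` from `x₀` to `1`, namely the inverse function of
`ξ ↦ ∫_{x₀}^ξ dx / p(x)`. -/
lemma exists_solution (hx₀ : x₀ ≤ 1) (hp : ∀ x ∈ Icc x₀ 1, 0 < p.eval x) :
    ∃ τ₁ : ℝ, 0 ≤ τ₁ ∧ ∃ x : ℝ → ℝ, x 0 = x₀ ∧ x τ₁ = 1 ∧ ∀ τ ∈ Icc 0 τ₁,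
      x τ ∈ Icc x₀ 1 ∧ HasDerivAt x (p.eval (x τ)) τ := by
  let r : ℝ → ℝ := fun t => (p.eval (projIcc x₀ 1 hx₀ t : ℝ))⁻¹
  have hpc : Continuous fun t : ℝ => p.eval (projIcc x₀ 1 hx₀ t : ℝ) :=
    p.continuous.comp (continuous_subtype_val.comp continuous_projIcc)
  have hppos : ∀ t, 0 < p.eval (projIcc x₀ 1 hx₀ t : ℝ) := fun t => hp _ (projIcc x₀ 1 hx₀ t).2
  have hrc : Continuous r := hpc.inv₀ fun t => (hppos t).ne'
  have hrpos : ∀ t, 0 < r t := fun t => inv_pos.2 (hppos t)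
  obtain ⟨M, hM⟩ := isCompact_Icc.exists_bound_of_continuousOn
    (p.continuous.continuousOn (s := Icc x₀ 1))
  have hM0 : 0 < M := (hp x₀ ⟨le_rfl, hx₀⟩).trans_le
    ((le_abs_self _).trans (hM x₀ ⟨le_rfl, hx₀⟩))
  have hrM : ∀ t, M⁻¹ ≤ r t := fun t => inv_anti₀ (hppos t)
    ((le_abs_self _).trans (hM _ (projIcc x₀ 1 hx₀ t).2))
  let φ : ℝ → ℝ := fun ξ => ∫ t in x₀..ξ, r t
  have hφd : ∀ ξ, HasDerivAt φ (r ξ) ξ := fun ξ =>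
    hasDerivAt_integral_right fun t _ => Eventually.of_forall fun y => hrc.continuousAt
  have hφc : Continuous φ := continuous_iff_continuousAt.2 fun ξ => (hφd ξ).continuousAt
  have hφm : StrictMono φ := strictMono_of_hasDerivAt_pos hφd hrpos
  -- `φ` grows at least linearly
  have hlin : Monotone fun ξ => φ ξ - M⁻¹ * ξ := by
    refine monotone_of_hasDerivAt_nonneg
      (fun ξ => (hφd ξ).sub ((hasDerivAt_id ξ).const_mul M⁻¹)) fun ξ => ?_
    have := hrM ξ
    simp only [Pi.zero_apply, mul_one, sub_nonneg]
    exact this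
  have hsurj : Function.Surjective φ := by
    have hMi : 0 < M⁻¹ := inv_pos.2 hM0
    refine hφc.surjective ?_ ?_
    · refine tendsto_atTop_mono' atTop (f₁ := fun ξ => M⁻¹ * ξ + (φ 0 - M⁻¹ * 0)) ?_ ?_
      · filter_upwards [eventually_ge_atTop 0] with ξ hξ
        have := hlin hξ
        simp only at this
        linarith
      · exact tendsto_atTop_add_const_right _ _ (tendsto_id.const_mul_atTop hMi)
    · refine tendsto_atBot_mono' atBot (f₁ := fun ξ => M⁻¹ * ξ + (φ 0 - M⁻¹ * 0)) ?_ ?_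
      · filter_upwards [eventually_le_atBot 0] with ξ hξ
        have := hlin hξ
        simp only at this
        linarith
      · exact tendsto_atBot_add_const_right _ _ (tendsto_id.const_mul_atBot hMi)
  let e : ℝ ≃o ℝ := hφm.orderIsoOfSurjective φ hsurj
  have he : ∀ ξ, e ξ = φ ξ := fun ξ => rfl
  have hφx₀ : φ x₀ = 0 := intervalIntegral.integral_same
  have hes0 : e.symm 0 = x₀ := by rw [← hφx₀, ← he, e.symm_apply_apply]
  have hes1 : e.symm (φ 1) = 1 := by rw [← he, e.symm_apply_apply]
  refine ⟨φ 1, ?_, e.symm, hes0, hes1, fun τ hτ => ?_⟩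
  · rw [← hφx₀]; exact hφm.monotone hx₀
  · have hmem : e.symm τ ∈ Icc x₀ 1 := by
      constructor
      · rw [← hes0]; exact e.symm.monotone hτ.1
      · rw [← hes1]; exact e.symm.monotone hτ.2
    refine ⟨hmem, ?_⟩
    have h1 := HasDerivAt.of_local_left_inverse (f := φ) (g := e.symm) (a := τ)
      e.symm.continuous.continuousAt (hφd (e.symm τ)) (hrpos _).ne'
      (Eventually.of_forall fun y => by rw [← he, e.apply_symm_apply])
    refine h1.congr_deriv ?_
    simp only [r, inv_inv]
    rw [projIcc_of_mem hx₀ hmem]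

/-- The Dulac time is defined as soon as the orbit stays in `y ≤ 1`. -/
theorem isDulacTime_orbitTime (hx₀ : -1 ≤ x₀) (hx₀1 : x₀ ≤ 1)
    (hp : ∀ x ∈ Icc x₀ 1, 0 < p.eval x) (hv : ∀ x ∈ Icc x₀ 1, AnalyticAt ℝ v x)
    (hu : ∀ x ∈ Icc x₀ 1, ∀ y ∈ Icc (0 : ℝ) 1, AnalyticAt ℝ (fun z : ℝ × ℝ => u z.1 z.2) (x, y))
    (hY : ∀ x ∈ Icc x₀ 1, orbit (fun x => v x * (p.eval x)⁻¹) x₀ x ≤ 1) :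
    IsDulacTime p v u x₀
      (orbitTime (fun x => v x * (p.eval x)⁻¹) (fun x => (p.eval x)⁻¹) u 1 x₀) := by
  set w : ℝ → ℝ := fun x => v x * (p.eval x)⁻¹
  have hw := eventually_continuousAt_div_eval hp hv
  obtain ⟨τ₁, hτ₁, x, hx0, hx1, hx⟩ := exists_solution hx₀1 hp
  have hs : ∀ y ∈ Icc x₀ 1, uIcc x₀ y ⊆ Icc x₀ 1 := fun y hy =>
    ordConnected_Icc.uIcc_subset ⟨le_rfl, hx₀1⟩ hy
  refine ⟨τ₁, hτ₁, x, fun τ => orbit w x₀ (x τ), fun τ => ∫ r in x₀..(x τ),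
    orbit w x₀ r * u r (orbit w x₀ r) * (p.eval r)⁻¹, hx0, ?_, ?_, hx1, ?_, ?_⟩
  · simp [hx0]
  · simp [hx0]
  · simp only [hx1, orbitTime]
  · intro τ hτ
    obtain ⟨hmem, hd⟩ := hx τ hτ
    have hne := (hp _ hmem).ne'
    refine ⟨abs_le.2 ⟨hx₀.trans hmem.1, hmem.2⟩, ?_, hd.hasDerivWithinAt, ?_, ?_⟩
    · rw [abs_of_pos (orbit_pos _ _ _)]
      exact hY _ hmem
    · have h1 := (hasDerivAt_orbit fun r hr => hw r (hs _ hmem hr)).comp τ hd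
      have h5 : w (x τ) * p.eval (x τ) = v (x τ) := inv_mul_cancel_right₀ hne _
      refine (h1.congr_deriv ?_).hasDerivWithinAt
      change -(w (x τ) * orbit w x₀ (x τ)) * p.eval (x τ) = -(v (x τ) * orbit w x₀ (x τ))
      rw [← h5]
      ring
    · have h1 := (hasDerivAt_integral_right fun r hr => eventually_continuousAt_integrand hp hv hu
        (hs _ hmem hr) (hY r (hs _ hmem hr))).comp τ hd
      refine (h1.congr_deriv ?_).hasDerivWithinAt
      field_simp
      rfl

end Dulac

/-! ### The polynomial family and its biggest root -/

lemma biggestRoot_isRoot {p : Polynomial ℝ} (hp : p ≠ 0) (h : ∃ x, p.IsRoot x) :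
    p.IsRoot (biggestRoot p) := by
  have hfin : {x : ℝ | p.IsRoot x}.Finite := Polynomial.finite_setOfPred_isRoot hp
  exact (Set.Nonempty.csSup_mem (s := {x : ℝ | p.IsRoot x}) h hfin)

lemma le_biggestRoot {p : Polynomial ℝ} (hp : p ≠ 0) {x : ℝ} (h : p.IsRoot x) :
    x ≤ biggestRoot p :=
  le_csSup (Polynomial.finite_setOfPred_isRoot hp).bddAbove h

lemma biggestRoot_X_pow (n : ℕ) (hn : n ≠ 0) :
    biggestRoot ((Polynomial.X : Polynomial ℝ) ^ n) = 0 := by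
  have : {x : ℝ | ((Polynomial.X : Polynomial ℝ) ^ n).IsRoot x} = {0} := by
    ext x
    simp [Polynomial.IsRoot, hn]
  rw [biggestRoot, this, csSup_singleton]

variable {μ ρ ν : ℕ} {P : ℝ → Polynomial ℝ} {σ : ℝ → ℝ}

lemma Q_coeff (P : ℝ → Polynomial ℝ) (ρ : ℕ) (σ : ℝ → ℝ) (z : ℝ) {N : ℕ}
    (h : (P (z ^ ρ)).natDegree < N) (i : ℕ) :
    (Q P ρ σ z).coeff i = ∑ m ∈ Finset.range N,
      (P (z ^ ρ)).coeff m * (σ z ^ (m - (i + 1)) * (m.choose (i + 1) : ℕ)) := by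
  rw [Q, Polynomial.coeff_divX]
  conv_lhs => rw [Polynomial.as_sum_range' (P (z ^ ρ)) N h]
  rw [map_sum, Polynomial.finsetSum_coeff]
  refine Finset.sum_congr rfl fun m _ => ?_
  rw [Polynomial.taylor_monomial, Polynomial.coeff_C_mul, Polynomial.coeff_X_add_C_pow]

lemma Q_natDegree (P : ℝ → Polynomial ℝ) (ρ : ℕ) (σ : ℝ → ℝ) (z : ℝ) :
    (Q P ρ σ z).natDegree = (P (z ^ ρ)).natDegree - 1 := by
  rw [Q, Polynomial.natDegree_divX_eq_natDegree_tsub_one, Polynomial.natDegree_taylor]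

lemma mul_Q_eval {z : ℝ} (h : (P (z ^ ρ)).IsRoot (σ z)) (t : ℝ) :
    t * (Q P ρ σ z).eval t = (P (z ^ ρ)).eval (t + σ z) := by
  have h1 := Polynomial.divX_mul_X_add (Polynomial.taylor (σ z) (P (z ^ ρ)))
  rw [Polynomial.taylor_coeff_zero, h, map_zero, add_zero] at h1
  have h2 := congrArg (Polynomial.eval t) h1
  rw [Polynomial.eval_mul, Polynomial.eval_X, Polynomial.taylor_eval] at h2
  rw [← h2, Q, mul_comm]

lemma tendsto_pow_nhds_zero (hρ : 0 < ρ) : Tendsto (fun z : ℝ => z ^ ρ) (𝓝 0) (𝓝 0) := by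
  have : Continuous fun z : ℝ => z ^ ρ := by fun_prop
  simpa [hρ.ne'] using this.tendsto 0

lemma tendsto_pow_nhdsGE_zero (hρ : 0 < ρ) :
    Tendsto (fun z : ℝ => z ^ ρ) (𝓝[≥] 0) (𝓝[≥] 0) := by
  refine tendsto_nhdsWithin_iff.2
    ⟨(tendsto_pow_nhds_zero hρ).mono_left nhdsWithin_le_nhds, ?_⟩
  filter_upwards [self_mem_nhdsWithin] with z hz
  exact pow_nonneg (mem_Ici.1 hz) _

lemma analyticAt_Q_coeff (hPan : ∀ i : ℕ, AnalyticAt ℝ (fun ε => (P ε).coeff i) 0)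
    (hPdeg : ∀ᶠ ε in 𝓝 (0 : ℝ), (P ε).natDegree = μ + 1) (hρ : 0 < ρ) (hσ : AnalyticAt ℝ σ 0)
    (i : ℕ) : AnalyticAt ℝ (fun z => (Q P ρ σ z).coeff i) 0 := by
  have h : AnalyticAt ℝ (fun z => ∑ m ∈ Finset.range (μ + 2),
      (P (z ^ ρ)).coeff m * (σ z ^ (m - (i + 1)) * (m.choose (i + 1) : ℕ))) 0 := by
    refine Finset.analyticAt_fun_sum _ fun m _ => ?_
    refine AnalyticAt.mul ?_ ((hσ.pow _).mul analyticAt_const)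
    refine AnalyticAt.comp (g := fun ε => (P ε).coeff m) (f := fun z : ℝ => z ^ ρ) ?_
      (analyticAt_id.pow ρ)
    rw [zero_pow hρ.ne']
    exact hPan m
  refine h.congr ?_
  filter_upwards [(tendsto_pow_nhds_zero hρ).eventually hPdeg] with z hz
  exact (Q_coeff P ρ σ z (by omega) i).symm

lemma eventually_Q_eval (hPdeg : ∀ᶠ ε in 𝓝 (0 : ℝ), (P ε).natDegree = μ + 1) (hρ : 0 < ρ) :
    ∀ᶠ z in 𝓝 (0 : ℝ), ∀ s : ℝ,
      (Q P ρ σ z).eval s = ∑ i ∈ Finset.range (μ + 1), (Q P ρ σ z).coeff i * s ^ i := by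
  filter_upwards [(tendsto_pow_nhds_zero hρ).eventually hPdeg] with z hz s
  refine Polynomial.eval_eq_sum_range' ?_ s
  rw [Q_natDegree, hz]
  omega

lemma analyticAt_Q_eval (hPan : ∀ i : ℕ, AnalyticAt ℝ (fun ε => (P ε).coeff i) 0)
    (hPdeg : ∀ᶠ ε in 𝓝 (0 : ℝ), (P ε).natDegree = μ + 1) (hρ : 0 < ρ) (hσ : AnalyticAt ℝ σ 0)
    (s : ℝ) : AnalyticAt ℝ (fun w : ℝ × ℝ => (Q P ρ σ w.2).eval w.1) (s, 0) := by
  have h : AnalyticAt ℝ (fun w : ℝ × ℝ => ∑ i ∈ Finset.range (μ + 1),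
      (Q P ρ σ w.2).coeff i * w.1 ^ i) (s, 0) := by
    refine Finset.analyticAt_fun_sum _ fun i _ => AnalyticAt.mul ?_ (analyticAt_fst.pow i)
    exact AnalyticAt.comp (g := fun z => (Q P ρ σ z).coeff i) (f := fun w : ℝ × ℝ => w.2)
      (analyticAt_Q_coeff hPan hPdeg hρ hσ i) analyticAt_snd
  refine h.congr ?_
  have := (continuous_snd.tendsto (s, (0 : ℝ))).eventually (eventually_Q_eval (σ := σ) hPdeg hρ)
  filter_upwards [this] with w hw
  exact (hw _).symm

/-- For `p = X ^ (μ + 1)` the quotient `p (s) / s` is `s ^ μ`. -/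
lemma Q_zero_eval (hP0 : P 0 = Polynomial.X ^ (μ + 1)) (hρ : 0 < ρ) (h0 : σ 0 = 0) (s : ℝ) :
    (Q P ρ σ 0).eval s = s ^ μ := by
  rw [Q, zero_pow hρ.ne', hP0, h0, Polynomial.taylor_zero, Polynomial.divX_X_pow]
  simp

/-- In terms of `z`, the Puiseux parametrization says that `σ z` is the biggest root of
`P (z ^ ρ)`. -/
lemma eventually_puiseux (hPdeg : ∀ᶠ ε in 𝓝 (0 : ℝ), (P ε).natDegree = μ + 1)
    (hroot : ∀ᶠ ε in 𝓝[≥] (0 : ℝ), ∃ x : ℝ, (P ε).IsRoot x) (hρ : 0 < ρ)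
    (hpuiseux : ∀ᶠ ε in 𝓝[≥] (0 : ℝ), biggestRoot (P ε) = σ (ε ^ (1 / (ρ : ℝ)))) :
    ∀ᶠ z in 𝓝[≥] (0 : ℝ), biggestRoot (P (z ^ ρ)) = σ z ∧ (P (z ^ ρ)).IsRoot (σ z) ∧
      ∀ x, (P (z ^ ρ)).IsRoot x → x ≤ σ z := by
  have h := tendsto_pow_nhdsGE_zero hρ
  filter_upwards [h.eventually hroot, h.eventually hpuiseux,
    h.eventually (hPdeg.filter_mono nhdsWithin_le_nhds), self_mem_nhdsWithin] with z h1 h2 h3 hz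
  have hne : P (z ^ ρ) ≠ 0 := by
    intro h0
    rw [h0, Polynomial.natDegree_zero] at h3
    omega
  have hb : biggestRoot (P (z ^ ρ)) = σ z := by
    rw [h2, one_div, Real.pow_rpow_inv_natCast hz hρ.ne']
  refine ⟨hb, ?_, fun x hx => ?_⟩
  · rw [← hb]; exact biggestRoot_isRoot hne h1
  · rw [← hb]; exact le_biggestRoot hne hx

/-! ### The lower bound coming from quasi-homogeneity -/

/-- Weighted polar coordinates near the origin of the first quadrant. -/
lemma exists_weighted_polar (hν : 0 < ν) {L s z : ℝ} (hL0 : 0 < L) (hL : L ≤ 1)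
    (hs : 0 < s) (hsL : s ≤ L ^ ν / 2) (hz : 0 ≤ z) (hzL : z ≤ L ^ μ / 2) :
    ∃ l θ : ℝ, 0 < l ∧ l ≤ L ∧ θ ∈ Icc 0 (Real.pi / 2) ∧ s = l ^ ν * Real.sin θ ∧
      z = l ^ μ * Real.cos θ := by
  have hLν : L ^ ν ≤ L := pow_le_of_le_one hL0.le hL hν.ne'
  have hLν0 : 0 < L ^ ν := pow_pos hL0 ν
  have hLμ0 : 0 < L ^ μ := pow_pos hL0 μ
  have hsL' : s ≤ L := by linarith
  have hcont : ContinuousOn (fun l : ℝ => (s / l ^ ν) ^ 2 + (z / l ^ μ) ^ 2) (Icc s L) := by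
    intro l hl
    have : l ≠ 0 := (hs.trans_le hl.1).ne'
    exact ContinuousAt.continuousWithinAt (by fun_prop (disch := positivity))
  have hone : (1 : ℝ) ∈ Icc ((s / L ^ ν) ^ 2 + (z / L ^ μ) ^ 2)
      ((s / s ^ ν) ^ 2 + (z / s ^ μ) ^ 2) := by
    constructor
    · have h1 : s / L ^ ν ≤ 1 / 2 := by rw [div_le_iff₀ hLν0]; linarith
      have h2 : z / L ^ μ ≤ 1 / 2 := by rw [div_le_iff₀ hLμ0]; linarith
      have h3 : 0 ≤ s / L ^ ν := by positivity
      have h4 : 0 ≤ z / L ^ μ := by positivity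
      nlinarith
    · have h1 : 1 ≤ s / s ^ ν := by
        rw [le_div_iff₀ (pow_pos hs ν), one_mul]
        exact pow_le_of_le_one hs.le (hsL'.trans hL) hν.ne'
      nlinarith [sq_nonneg (z / s ^ μ)]
  obtain ⟨l, hl, hl1⟩ := intermediate_value_Icc' hsL' hcont hone
  have hl0 : 0 < l := hs.trans_le hl.1
  simp only at hl1
  have hx0 : 0 ≤ s / l ^ ν := by positivity
  have hx1 : s / l ^ ν ≤ 1 := by nlinarith [sq_nonneg (z / l ^ μ)]
  have hsin : Real.sin (Real.arcsin (s / l ^ ν)) = s / l ^ ν := Real.sin_arcsin (by linarith) hx1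
  have hcos : Real.cos (Real.arcsin (s / l ^ ν)) = z / l ^ μ := by
    rw [Real.cos_arcsin]
    have : 1 - (s / l ^ ν) ^ 2 = (z / l ^ μ) ^ 2 := by linarith
    rw [this, Real.sqrt_sq (by positivity)]
  refine ⟨l, Real.arcsin (s / l ^ ν), hl0, hl.2,
    ⟨Real.arcsin_nonneg.2 hx0, Real.arcsin_le_pi_div_two _⟩, ?_, ?_⟩
  · rw [hsin]; field_simp
  · rw [hcos]; field_simp

/-- Taylor's formula in `z` for the coefficients of `Q(·, z)`. -/
lemma eventually_taylor_q (hPan : ∀ i : ℕ, AnalyticAt ℝ (fun ε => (P ε).coeff i) 0)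
    (hPdeg : ∀ᶠ ε in 𝓝 (0 : ℝ), (P ε).natDegree = μ + 1) (hρ : 0 < ρ) (hσ : AnalyticAt ℝ σ 0)
    (i m : ℕ) : ∃ C, 0 ≤ C ∧ ∀ᶠ z in 𝓝 (0 : ℝ),
      |(Q P ρ σ z).coeff i - ∑ j ∈ Finset.range m, q P ρ σ i j * z ^ j| ≤ C * |z| ^ m := by
  have h := (analyticAt_Q_coeff hPan hPdeg hρ hσ i).hasFPowerSeriesAt.isBigO_sub_partialSum_pow m
  obtain ⟨C, hC0, hC⟩ := h.exists_nonneg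
  refine ⟨C, hC0, ?_⟩
  filter_upwards [hC.bound] with z hz
  simp only [zero_add, Real.norm_eq_abs, abs_pow, abs_abs] at hz
  refine le_trans (le_of_eq ?_) hz
  congr 2
  rw [FormalMultilinearSeries.partialSum]
  refine Finset.sum_congr rfl fun j _ => ?_
  rw [FormalMultilinearSeries.ofScalars_apply_eq, smul_eq_mul, q]

/-- By (H1) and (H2) the principal part dominates: `Q(s, z) ≥ c s ^ μ` near the origin of the
first quadrant. -/
theorem exists_Q_lower_bound (hμ : 0 < μ)
    (hPan : ∀ i : ℕ, AnalyticAt ℝ (fun ε => (P ε).coeff i) 0)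
    (hPdeg : ∀ᶠ ε in 𝓝 (0 : ℝ), (P ε).natDegree = μ + 1) (hρ : 0 < ρ) (hσ : AnalyticAt ℝ σ 0)
    (hν : 0 < ν) (hH1 : H1 P ρ σ μ ν) (hH2 : H2 P ρ σ μ ν) :
    ∃ c > 0, ∃ r > 0, ∀ s z : ℝ, 0 < s → s ≤ r → 0 ≤ z → z ≤ r →
      c * s ^ μ ≤ (Q P ρ σ z).eval s := by
  -- the minimum of the principal part over the angles
  obtain ⟨c₀, hc₀, hmin⟩ : ∃ c₀ > 0, ∀ θ ∈ Icc (0 : ℝ) (Real.pi / 2), c₀ ≤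
      ∑ ij ∈ (Finset.range (μ + 1) ×ˢ Finset.range (ν + 1)).filter
          (fun ij => ij.1 * ν + ij.2 * μ = μ * ν),
        q P ρ σ ij.1 ij.2 * Real.sin θ ^ ij.1 * Real.cos θ ^ ij.2 := by
    obtain ⟨θ₀, hθ₀, hθmin⟩ := isCompact_Icc.exists_isMinOn
      (s := Icc (0 : ℝ) (Real.pi / 2)) (nonempty_Icc.2 (by positivity))
      (f := fun θ => ∑ ij ∈ (Finset.range (μ + 1) ×ˢ Finset.range (ν + 1)).filter
          (fun ij => ij.1 * ν + ij.2 * μ = μ * ν),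
        q P ρ σ ij.1 ij.2 * Real.sin θ ^ ij.1 * Real.cos θ ^ ij.2)
      (Continuous.continuousOn (by fun_prop))
    exact ⟨_, hH2 θ₀ hθ₀, fun θ hθ => hθmin hθ⟩
  choose C hC0 hC using fun i => eventually_taylor_q hPan hPdeg hρ hσ i (ν + 1)
  have hev : ∀ᶠ z in 𝓝 (0 : ℝ), (∀ s : ℝ, (Q P ρ σ z).eval s
        = ∑ i ∈ Finset.range (μ + 1), (Q P ρ σ z).coeff i * s ^ i) ∧
      ∀ i ∈ Finset.range (μ + 1), |(Q P ρ σ z).coeff i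
        - ∑ j ∈ Finset.range (ν + 1), q P ρ σ i j * z ^ j| ≤ C i * |z| ^ (ν + 1) :=
    (eventually_Q_eval hPdeg hρ).and ((Finset.eventually_all _).2 fun i _ => hC i)
  obtain ⟨e, he, hball⟩ := Metric.eventually_nhds_iff_ball.1 hev
  -- the terms off the principal part are at most `D * l ^ (μ * ν + 1)` in the polar radius `l`
  set D : ℝ := ∑ i ∈ Finset.range (μ + 1), C i
    + ∑ ij ∈ Finset.range (μ + 1) ×ˢ Finset.range (ν + 1), |q P ρ σ ij.1 ij.2| with hD
  have hD0 : 0 ≤ D := add_nonneg (Finset.sum_nonneg fun i _ => hC0 i)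
    (Finset.sum_nonneg fun _ _ => abs_nonneg _)
  set L : ℝ := min 1 (c₀ / (2 * (D + 1))) with hLdef
  have hL0 : 0 < L := lt_min one_pos (by positivity)
  have hL1 : L ≤ 1 := min_le_left _ _
  have hLD : D * L ≤ c₀ / 2 := by
    have h1 : L ≤ c₀ / (2 * (D + 1)) := min_le_right _ _
    rw [le_div_iff₀ (by positivity)] at h1
    nlinarith
  refine ⟨c₀ / 2, by positivity, min (min (L ^ ν / 2) (L ^ μ / 2)) (e / 2), by positivity, ?_⟩
  intro s z hs hsr hz hzr
  have hs1 : s ≤ L ^ ν / 2 := hsr.trans ((min_le_left _ _).trans (min_le_left _ _))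
  have hz1 : z ≤ L ^ μ / 2 := hzr.trans ((min_le_left _ _).trans (min_le_right _ _))
  have hz2 : z ≤ e / 2 := hzr.trans (min_le_right _ _)
  obtain ⟨l, θ, hl0, hlL, hθ, hsl, hzl⟩ := exists_weighted_polar hν hL0 hL1 hs hs1 hz hz1
  have hl1 : l ≤ 1 := hlL.trans hL1
  have hsin0 : 0 ≤ Real.sin θ := Real.sin_nonneg_of_nonneg_of_le_pi hθ.1
    (by linarith [hθ.2, Real.pi_pos])
  have hcos0 : 0 ≤ Real.cos θ := Real.cos_nonneg_of_mem_Icc ⟨by linarith [hθ.1, Real.pi_pos], hθ.2⟩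
  have hslν : s ≤ l ^ ν := by
    rw [hsl]; exact mul_le_of_le_one_right (by positivity) (Real.sin_le_one θ)
  have hzlμ : z ≤ l ^ μ := by
    rw [hzl]; exact mul_le_of_le_one_right (by positivity) (Real.cos_le_one θ)
  have hs1' : s ≤ 1 := hslν.trans (pow_le_one₀ hl0.le hl1)
  obtain ⟨hQ, hcoef⟩ := hball z (by
    rw [Metric.mem_ball, Real.dist_eq, sub_zero, abs_of_nonneg hz]; linarith)
  have hmono : ∀ i j : ℕ, s ^ i * z ^ j ≤ l ^ (i * ν + j * μ) := by
    intro i j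
    calc s ^ i * z ^ j ≤ (l ^ ν) ^ i * (l ^ μ) ^ j := by gcongr
      _ = l ^ (i * ν + j * μ) := by rw [← pow_mul, ← pow_mul, ← pow_add]; ring_nf
  -- the tails of the Taylor expansions in `z`
  have htail : |(Q P ρ σ z).eval s - ∑ i ∈ Finset.range (μ + 1), ∑ j ∈ Finset.range (ν + 1),
      q P ρ σ i j * (s ^ i * z ^ j)| ≤ (∑ i ∈ Finset.range (μ + 1), C i) * l ^ (μ * ν + 1) := by
    rw [hQ s, ← Finset.sum_sub_distrib, Finset.sum_mul]
    refine (Finset.abs_sum_le_sum_abs _ _).trans (Finset.sum_le_sum fun i hi => ?_)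
    have h1 : (Q P ρ σ z).coeff i * s ^ i - ∑ j ∈ Finset.range (ν + 1),
        q P ρ σ i j * (s ^ i * z ^ j)
        = ((Q P ρ σ z).coeff i - ∑ j ∈ Finset.range (ν + 1), q P ρ σ i j * z ^ j) * s ^ i := by
      rw [sub_mul, Finset.sum_mul]
      congr 1
      exact Finset.sum_congr rfl fun j _ => by ring
    rw [h1, abs_mul, abs_of_nonneg (pow_nonneg hs.le i)]
    have h2 := hcoef i hi
    rw [abs_of_nonneg hz] at h2
    calc _ ≤ C i * z ^ (ν + 1) * s ^ i := by gcongr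
      _ ≤ C i * (l ^ μ) ^ (ν + 1) * 1 := by
          have := hC0 i
          gcongr
          exact pow_le_one₀ hs.le hs1'
      _ ≤ C i * l ^ (μ * ν + 1) := by
          rw [mul_one, ← pow_mul]
          refine mul_le_mul_of_nonneg_left (pow_le_pow_of_le_one hl0.le hl1 ?_) (hC0 i)
          rw [mul_add, mul_one]
          omega
  -- the monomials off the Newton segment
  have hprin : ∑ i ∈ Finset.range (μ + 1), ∑ j ∈ Finset.range (ν + 1),
      q P ρ σ i j * (s ^ i * z ^ j) ≥ c₀ * l ^ (μ * ν)
        - (∑ ij ∈ Finset.range (μ + 1) ×ˢ Finset.range (ν + 1), |q P ρ σ ij.1 ij.2|)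
          * l ^ (μ * ν + 1) := by
    rw [← Finset.sum_product', ← Finset.sum_filter_add_sum_filter_not _
      (fun ij : ℕ × ℕ => ij.1 * ν + ij.2 * μ = μ * ν), sub_eq_add_neg, ge_iff_le]
    refine add_le_add ?_ ?_
    · refine (mul_le_mul_of_nonneg_right (hmin θ hθ) (by positivity)).trans (le_of_eq ?_)
      rw [Finset.sum_mul]
      refine Finset.sum_congr rfl fun ij hij => ?_
      rw [Finset.mem_filter] at hij
      rw [← hij.2, hsl, hzl, mul_pow, mul_pow, ← pow_mul, ← pow_mul, pow_add,
        mul_comm ij.1 ν, mul_comm ij.2 μ]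
      ring
    · rw [Finset.sum_mul]
      refine (neg_le_neg (Finset.sum_le_sum_of_subset_of_nonneg
        (Finset.filter_subset (fun ij : ℕ × ℕ => ¬ij.1 * ν + ij.2 * μ = μ * ν) _)
        fun ij _ _ => by positivity)).trans ?_
      rw [← Finset.sum_neg_distrib]
      refine Finset.sum_le_sum fun ij hij => ?_
      rw [Finset.mem_filter] at hij
      rcases lt_or_gt_of_ne hij.2 with hlt | hgt
      · have hq0 : q P ρ σ ij.1 ij.2 = 0 := by
          refine hH1 _ _ ?_
          have hμ' : (0 : ℝ) < μ := by exact_mod_cast hμ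
          have hν' : (0 : ℝ) < ν := by exact_mod_cast hν
          rw [div_add_div _ _ hμ'.ne' hν'.ne', div_lt_one (by positivity)]
          rw [mul_comm (μ : ℝ) (ij.2 : ℝ)]
          exact_mod_cast hlt
        rw [hq0]; simp
      · refine neg_le_of_abs_le ?_
        rw [abs_mul, abs_of_nonneg (by positivity : 0 ≤ s ^ ij.1 * z ^ ij.2)]
        refine mul_le_mul_of_nonneg_left ((hmono _ _).trans ?_) (abs_nonneg _)
        exact pow_le_pow_of_le_one hl0.le hl1 hgt
  have hsum : c₀ * l ^ (μ * ν) - D * l ^ (μ * ν + 1) ≤ (Q P ρ σ z).eval s := by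
    have := (abs_le.1 htail).1
    rw [hD, add_mul]
    linarith
  have hpow : 0 < l ^ (μ * ν) := by positivity
  have h3 : D * l ^ (μ * ν + 1) ≤ c₀ / 2 * l ^ (μ * ν) := by
    rw [pow_succ]
    have : D * l ≤ c₀ / 2 := (mul_le_mul_of_nonneg_left hlL hD0).trans hLD
    nlinarith
  have h4 : s ^ μ ≤ l ^ (μ * ν) := by
    have := hmono μ 0
    simpa using this
  nlinarith

/-! ### Formal solutions depending on parameters -/

section CoeffFam

variable {E : Type*} [NormedAddCommGroup E] [NormedSpace ℝ E]
  {q : ℝ × E → ℝ} {u u' : ℝ × E → C(unitInterval, ℝ)} {p₀ : E}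

/-- The coefficients of the formal solution of `∂_y (y f) = q s ∂_s f + u`, as functions of the
parameter. -/
def coeffFam (q : ℝ × E → ℝ) (u : ℝ × E → C(unitInterval, ℝ)) (n : ℕ) (p : E) :
    C(unitInterval, ℝ) :=
  formalCoeff avg (fun n => taylorCoeff q n p) (fun n => taylorCoeff u n p) n

/-- The quotient by `s ^ (N + 1)` of the defect of the `N`-th partial sum of the formal solution. -/
def defectQuot (q : ℝ × E → ℝ) (u : ℝ × E → C(unitInterval, ℝ)) (N : ℕ) (w : ℝ × E) :
    C(unitInterval, ℝ) :=
  taylorQuot u (N + 1) w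
    + ∑ n ∈ Finset.range (N + 1), (n * taylorQuot q (N + 1 - n) w) • coeffFam q u n w.2

lemma abs_mul_taylorCoeff_zero_lt (hq0 : q (0, p₀) = 0) (n : ℕ) :
    |n * taylorCoeff q 0 p₀| < 1 := by
  have : taylorCoeff q 0 p₀ = 0 := hq0
  simp [this]

lemma analyticAt_coeffFam (hq : AnalyticAt ℝ q (0, p₀)) (hq0 : q (0, p₀) = 0)
    (hu : AnalyticAt ℝ u (0, p₀)) (n : ℕ) : AnalyticAt ℝ (coeffFam q u n) p₀ :=
  analyticAt_formalCoeff norm_avg_le (fun n => analyticAt_taylorCoeff hq n)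
    (fun n => analyticAt_taylorCoeff hu n) n (abs_mul_taylorCoeff_zero_lt hq0 n)

lemma analyticAt_defectQuot (hq : AnalyticAt ℝ q (0, p₀)) (hq0 : q (0, p₀) = 0)
    (hu : AnalyticAt ℝ u (0, p₀)) (N : ℕ) : AnalyticAt ℝ (defectQuot q u N) (0, p₀) := by
  refine (analyticAt_taylorQuot hu (N + 1)).add (Finset.analyticAt_fun_sum _ fun n _ => ?_)
  refine (analyticAt_const.mul (analyticAt_taylorQuot hq _)).smul ?_
  exact AnalyticAt.comp (g := coeffFam q u n) (f := fun w : ℝ × E => w.2)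
    (analyticAt_coeffFam hq hq0 hu n) analyticAt_snd

/-- If `avg u' = u`, then the coefficients of the two formal solutions are related in the same way,
and the equation solved by the one for `u` expresses the one for `u'` through it. -/
lemma eventually_coeffFam_avg (hq : AnalyticAt ℝ q (0, p₀)) (hq0 : q (0, p₀) = 0)
    (hu' : AnalyticAt ℝ u' (0, p₀)) (hL : ∀ᶠ w in 𝓝 ((0 : ℝ), p₀), avg (u' w) = u w) (N : ℕ) :
    ∀ᶠ p in 𝓝 p₀, ∀ n ≤ N, avg (coeffFam q u' n p) = coeffFam q u n p ∧
      coeffFam q u' n p = taylorCoeff u n p + ∑ j ∈ Finset.range (n + 1),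
        ((j : ℕ) * taylorCoeff q (n - j) p) • coeffFam q u j p := by
  have h1 : ∀ᶠ p in 𝓝 p₀, |N * taylorCoeff q 0 p| < 1 := by
    have hc : ContinuousAt (fun p => |N * taylorCoeff q 0 p|) p₀ :=
      (continuousAt_const.mul (analyticAt_taylorCoeff hq 0).continuousAt).abs
    exact hc.eventually (eventually_lt_nhds (abs_mul_taylorCoeff_zero_lt hq0 N))
  have h2 : ∀ᶠ p in 𝓝 p₀, ∀ n ∈ Finset.range (N + 1),
      avg (taylorCoeff u' n p) = taylorCoeff u n p :=
    (Finset.eventually_all _).2 fun n _ => eventually_taylorCoeff_map avg hu' hL n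
  filter_upwards [h1, h2] with p h1 h2
  exact formalCoeff_map norm_avg_le h1 fun n hn => h2 n (Finset.mem_range.2 (Nat.lt_succ_of_le hn))

/-- The partial sums of the formal solution solve the equation up to `s ^ (N + 1) • defectQuot`. -/
lemma eventually_defect (hq : AnalyticAt ℝ q (0, p₀)) (hq0 : q (0, p₀) = 0)
    (hu : AnalyticAt ℝ u (0, p₀)) (hu' : AnalyticAt ℝ u' (0, p₀))
    (hL : ∀ᶠ w in 𝓝 ((0 : ℝ), p₀), avg (u' w) = u w) (N : ℕ) :
    ∀ᶠ w in 𝓝 ((0 : ℝ), p₀),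
      u w + q w • ∑ n ∈ Finset.range (N + 1), (n * w.1 ^ n) • coeffFam q u n w.2
        - ∑ n ∈ Finset.range (N + 1), w.1 ^ n • coeffFam q u' n w.2
      = w.1 ^ (N + 1) • defectQuot q u N w := by
  have h1 := (continuous_snd.tendsto ((0 : ℝ), p₀)).eventually
    (eventually_coeffFam_avg hq hq0 hu' hL N)
  have h2 : ∀ᶠ w in 𝓝 ((0 : ℝ), p₀), ∀ m ∈ Finset.range (N + 2), q w =
      ∑ i ∈ Finset.range m, w.1 ^ i • taylorCoeff q i w.2 + w.1 ^ m • taylorQuot q m w :=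
    (Finset.eventually_all _).2 fun m _ => eventually_taylor hq m
  filter_upwards [h1, h2, eventually_taylor hu (N + 1)] with w h1 h2 h3
  exact formalCoeff_remainder (qr := fun m => taylorQuot q m w) (q := fun n => taylorCoeff q n w.2)
    (fun n hn => (h1 n hn).2) h3
    fun m hm => h2 m (Finset.mem_range.2 (Nat.lt_succ_of_le hm))

end CoeffFam

/-! ### The asymptotic expansion of the time integral -/

section UniformFamily

variable {E : Type*} [NormedAddCommGroup E] [NormedSpace ℝ E]

/-- A family of time integrals, with parameter in the compact set `S`, for which the asymptotic
expansion can be proved.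

The orbits are described by `w = v / b` and `m = 1 / b` on `(0, X p]`, and on `(0, η]` by
`q = b / (s v)`. The functions `u i` are the iterates of `u 0` under `u ↦ ∂_y (y u)`, and `U i`
is `u i / v` as a function with values in `C([0, 1], ℝ)`; `f i n` are the coefficients of the formal
solution for `U i`, and `G i` is the quotient of its defect by `s ^ (N + 1)`. -/
structure IsUniformFamily (S : Set E) (η : ℝ) (N k μ : ℕ) (X : E → ℝ) (w m : E → ℝ → ℝ)
    (u : ℕ → E → ℝ → ℝ → ℝ) (q : ℝ × E → ℝ) (U : ℕ → ℝ × E → C(unitInterval, ℝ))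
    (f : ℕ → ℕ → E → C(unitInterval, ℝ)) (G : ℕ → ℝ × E → C(unitInterval, ℝ)) : Prop where
  compact : IsCompact S
  eta_pos : 0 < η
  eta_le : η ≤ 1
  le_X : ∀ p ∈ S, η ≤ X p
  X_le : ∀ p ∈ S, X p ≤ 2
  cont_w : ∀ p ∈ S, ∀ x ∈ Ioc 0 (X p), ∀ᶠ y in 𝓝 x, ContinuousAt (w p) y
  cont_m : ∀ p ∈ S, ∀ x ∈ Ioc 0 (X p), ∀ᶠ y in 𝓝 x, ContinuousAt (m p) y
  analytic_u : ∀ i, ∀ p ∈ S, ∀ x ∈ Ioc 0 (X p), ∀ y ∈ Icc (0 : ℝ) 1,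
    AnalyticAt ℝ (fun z : ℝ × ℝ => u i p z.1 z.2) (x, y)
  u_succ : ∀ i p x y, u (i + 1) p x y = deriv (fun y => y * u i p x y) y
  q_pos : ∀ p ∈ S, ∀ x ∈ Ioc 0 η, 0 < q (x, p)
  q_le : ∀ p ∈ S, ∀ x ∈ Ioc 0 η, 2 * (N + 1) * q (x, p) ≤ 1
  w_eq : ∀ p ∈ S, ∀ x ∈ Ioc 0 η, w p x = (x * q (x, p))⁻¹
  U_eq : ∀ i, ∀ p ∈ S, ∀ x ∈ Ioc 0 η, ∀ y : unitInterval,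
    u i p x y * m p x = U i (x, p) y / (x * q (x, p))
  bound_w : ∃ C, ∀ p ∈ S, ∀ x ∈ Icc η (X p), |w p x| ≤ C
  bound_m : ∃ C, ∀ p ∈ S, ∀ x ∈ Icc η (X p), |m p x| ≤ C
  bound_u : ∀ i ≤ k, ∃ C, ∀ p ∈ S, ∀ x ∈ Icc η (X p), ∀ y ∈ Icc (0 : ℝ) 1, |u i p x y| ≤ C
  bound_f : ∀ i ≤ k, ∀ n ≤ N, ∃ C, ∀ p ∈ S, ‖f i n p‖ ≤ C
  avg_f : ∀ i ≤ k, ∀ n ≤ N, ∀ p ∈ S, avg (f (i + 1) n p) = f i n p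
  defect : ∀ i ≤ k, ∀ p ∈ S, ∀ x ∈ Ioc 0 η,
    U i (x, p) + q (x, p) • ∑ n ∈ Finset.range (N + 1), (n * x ^ n) • f i n p
      - ∑ n ∈ Finset.range (N + 1), x ^ n • f (i + 1) n p = x ^ (N + 1) • G i (x, p)
  analytic_q : AnalyticOnNhd ℝ q (Icc 0 η ×ˢ S)
  analytic_G : ∀ i ≤ k, AnalyticOnNhd ℝ (G i) (Icc 0 η ×ˢ S)
  q_lower : ∃ c > 0, ∀ p ∈ S, ∀ x ∈ Ioc 0 η, c * x ^ μ ≤ q (x, p)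

variable {S : Set E} {η : ℝ} {N k μ : ℕ} {X : E → ℝ} {w m : E → ℝ → ℝ}
    {u : ℕ → E → ℝ → ℝ → ℝ} {q : ℝ × E → ℝ} {U : ℕ → ℝ × E → C(unitInterval, ℝ)}
    {f : ℕ → ℕ → E → C(unitInterval, ℝ)} {G : ℕ → ℝ × E → C(unitInterval, ℝ)}

namespace IsUniformFamily

variable (h : IsUniformFamily S η N k μ X w m u q U f G)

/-- The remainder of the expansion to order `N` of the time integral of `u i`. -/
def remainder (N : ℕ) (X : E → ℝ) (w m : E → ℝ → ℝ) (u : ℕ → E → ℝ → ℝ → ℝ)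
    (f : ℕ → ℕ → E → C(unitInterval, ℝ)) (i : ℕ) (p : E) (s : ℝ) : ℝ :=
  orbitTime (w p) (m p) (u i p) (X p) s - ∑ n ∈ Finset.range (N + 1), f i n p 1 * s ^ n

include h

lemma hasDerivAt_orbit {p : E} (hp : p ∈ S) {s x : ℝ} (hs : 0 < s) (hsx : s ≤ x) (hx : x ≤ X p) :
    HasDerivAt (orbit (w p) s) (-(w p x * orbit (w p) s x)) x := by
  refine SaddleNode.hasDerivAt_orbit fun t ht => h.cont_w p hp t ?_
  rw [uIcc_of_le hsx] at ht
  exact ⟨hs.trans_le ht.1, ht.2.trans hx⟩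

lemma orbit_le_one_near {p : E} (hp : p ∈ S) {s x : ℝ} (hs : 0 < s) (hx : x ∈ Icc s η) :
    orbit (w p) s x ≤ 1 := by
  rw [orbit, Real.exp_le_one_iff, neg_nonpos]
  refine intervalIntegral.integral_nonneg hx.1 fun t ht => ?_
  have ht' : t ∈ Ioc 0 η := ⟨hs.trans_le ht.1, ht.2.trans hx.2⟩
  rw [h.w_eq p hp t ht']
  exact inv_nonneg.2 (mul_nonneg ht'.1.le (h.q_pos p hp t ht').le)

/-- Up to `x = η` the time integral is given by the formal solution, up to `O(s ^ (N + 1))`. -/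
lemma near {i : ℕ} (hi : i ≤ k) : ∃ C, ∀ p ∈ S, ∀ s ∈ Ioc 0 η,
    orbit (w p) s η * η ^ (N + 1) ≤ s ^ (N + 1) ∧
    |(∫ x in s..η, orbit (w p) s x * u i p x (orbit (w p) s x) * m p x)
      - ∑ n ∈ Finset.range (N + 1), f i n p 1 * s ^ n| ≤ C * s ^ (N + 1) := by
  obtain ⟨CG, hCG⟩ := (isCompact_Icc.prod h.compact).exists_bound_of_continuousOn
    (h.analytic_G i hi).continuousOn
  choose! Cf hCf using fun n (hn : n ≤ N) => h.bound_f i hi n hn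
  have hη0 : (0 : ℝ) < η ^ (N + 1) := pow_pos h.eta_pos _
  refine ⟨2 * CG + (η ^ (N + 1))⁻¹ * ∑ n ∈ Finset.range (N + 1), Cf n, fun p hp s hs => ?_⟩
  have hIoc : ∀ x ∈ Icc s η, x ∈ Ioc 0 η := fun x hx => ⟨hs.1.trans_le hx.1, hx.2⟩
  have hIocX : ∀ x ∈ Icc s η, x ∈ Ioc 0 (X p) := fun x hx =>
    ⟨hs.1.trans_le hx.1, hx.2.trans (h.le_X p hp)⟩
  have hYd : ∀ x ∈ Icc s η, HasDerivAt (orbit (w p) s) (-(w p x * orbit (w p) s x)) x :=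
    fun x hx => h.hasDerivAt_orbit hp hs.1 hx.1 (hx.2.trans (h.le_X p hp))
  have hY01 : ∀ x ∈ Icc s η, orbit (w p) s x ∈ Icc (0 : ℝ) 1 := fun x hx =>
    ⟨(orbit_pos _ _ _).le, h.orbit_le_one_near hp hs.1 hx⟩
  set g : ℝ → ℝ := fun x => orbit (w p) s x * u i p x (orbit (w p) s x) * m p x with hg
  have hgc : ∀ x ∈ Icc s η, ∀ᶠ y in 𝓝 x, ContinuousAt g y := by
    intro x hx
    have hYc : ∀ᶠ y in 𝓝 x, ContinuousAt (orbit (w p) s) y := by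
      obtain ⟨e, he, hball⟩ := Metric.eventually_nhds_iff_ball.1 (h.cont_w p hp x (hIocX x hx))
      filter_upwards [Metric.ball_mem_nhds x he] with y hy
      refine (SaddleNode.hasDerivAt_orbit fun t ht => ?_).continuousAt
      by_cases htx : t ∈ Metric.ball x e
      · exact eventually_nhds_iff.2 ⟨Metric.ball x e, hball, Metric.isOpen_ball, htx⟩
      · refine h.cont_w p hp t (hIocX t ?_)
        have hxe := Metric.mem_ball.1 hy
        rw [Metric.mem_ball] at htx
        rw [Real.dist_eq, abs_lt] at hxe
        rw [Real.dist_eq, abs_lt, not_and_or, not_lt, not_lt] at htx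
        rcases mem_uIcc.1 ht with h | h <;> rcases htx with h' | h' <;> constructor <;>
          linarith [h.1, h.2, hxe.1, hxe.2, hx.1, hx.2]
    have hc : ContinuousAt (fun y => (y, orbit (w p) s y)) x :=
      continuousAt_id.prodMk hYc.self_of_nhds
    filter_upwards [hYc, h.cont_m p hp x (hIocX x hx), hc.eventually
      (h.analytic_u i p hp x (hIocX x hx) _ (hY01 x hx)).eventually_analyticAt] with y h1 h2 h3
    exact (h1.mul (ContinuousAt.comp (g := fun z : ℝ × ℝ => u i p z.1 z.2)
      (f := fun y => (y, orbit (w p) s y)) h3.continuousAt (continuousAt_id.prodMk h1))).mul h2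
  obtain ⟨h1, h2⟩ := near_estimate (δ := η) (s := s) (C := CG) (N := N) (q := fun x => q (x, p))
    (Y := orbit (w p) s) (J := fun x => ∫ r in s..x, g r) (f := fun n => f i n p)
    (d := fun n => f (i + 1) n p) (U := fun x => U i (x, p)) hs.1 hs.2
    (fun x hx => ⟨h.q_pos p hp x (hIoc x hx), h.q_le p hp x (hIoc x hx)⟩)
    (orbit_self _ _) hY01
    (fun x hx => by
      refine (hYd x hx).congr_deriv ?_
      rw [h.w_eq p hp x (hIoc x hx)]
      ring)
    (fun n hn => h.avg_f i hi n hn p hp)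
    (fun x hx => by
      rw [h.defect i hi p hp x (hIoc x hx), norm_smul, Real.norm_eq_abs,
        abs_of_nonneg (pow_nonneg (hIoc x hx).1.le _), mul_comm]
      exact mul_le_mul_of_nonneg_right (hCG (x, p) ⟨Ioc_subset_Icc_self (hIoc x hx), hp⟩)
        (pow_nonneg (hIoc x hx).1.le _))
    (fun x hx => by
      refine (hasDerivAt_integral_right fun t ht => hgc t ?_).congr_deriv ?_
      · rw [uIcc_of_le hx.1] at ht
        exact ⟨ht.1, ht.2.trans hx.2⟩
      · have := h.U_eq i p hp x (hIoc x hx) ⟨_, hY01 x hx⟩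
        rw [hg, projIcc_of_mem zero_le_one (hY01 x hx)]
        simp only at this ⊢
        rw [mul_assoc, this, mul_div_assoc])
  refine ⟨h1, ?_⟩
  simp only [intervalIntegral.integral_same, sub_zero] at h2
  set B : ℝ := ∑ n ∈ Finset.range (N + 1), η ^ n * f i n p (projIcc 0 1 zero_le_one
    (orbit (w p) s η)) with hB
  have hBle : |B| ≤ ∑ n ∈ Finset.range (N + 1), Cf n := by
    refine (Finset.abs_sum_le_sum_abs _ _).trans (Finset.sum_le_sum fun n hn => ?_)
    rw [abs_mul, abs_of_nonneg (pow_nonneg h.eta_pos.le n)]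
    have h3 := ((f i n p).norm_coe_le_norm (projIcc 0 1 zero_le_one (orbit (w p) s η))).trans
      (hCf n (Nat.lt_succ_iff.1 (Finset.mem_range.1 hn)) p hp)
    rw [Real.norm_eq_abs] at h3
    refine (mul_le_of_le_one_left (abs_nonneg _) (pow_le_one₀ h.eta_pos.le h.eta_le)).trans h3
  have hYη : orbit (w p) s η ≤ (η ^ (N + 1))⁻¹ * s ^ (N + 1) := by
    rw [← div_eq_inv_mul, le_div_iff₀ hη0]; exact h1
  have h4 : |orbit (w p) s η * B|
      ≤ (η ^ (N + 1))⁻¹ * s ^ (N + 1) * ∑ n ∈ Finset.range (N + 1), Cf n := by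
    rw [abs_mul, abs_of_pos (orbit_pos _ _ _)]
    have := pow_pos hs.1 (N + 1)
    exact mul_le_mul hYη hBle (abs_nonneg _) (by positivity)
  have h5 := abs_sub_le_iff.1 (abs_sub _ _ |>.trans (add_le_add h2 h4) : |_ - _| ≤ _)
  rw [abs_le]
  constructor <;> nlinarith [h5.1, h5.2]

/-- Between `x = η` and `x = X` the orbits can be compared uniformly with their value at `η`. -/
lemma exists_orbit_le : ∃ C, 1 ≤ C ∧ ∀ p ∈ S, ∀ x ∈ Icc η (X p), orbit (w p) η x ≤ C := by
  obtain ⟨C, hC⟩ := h.bound_w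
  refine ⟨Real.exp (|C| * 2), Real.one_le_exp (by positivity), fun p hp x hx => ?_⟩
  rw [orbit, Real.exp_le_exp]
  have h1 := intervalIntegral.norm_integral_le_of_norm_le_const (a := η) (b := x) (f := w p)
    (C := |C|) fun t ht => by
      rw [uIoc_of_le hx.1] at ht
      exact (hC p hp t ⟨ht.1.le, ht.2.trans hx.2⟩).trans (le_abs_self C)
  rw [Real.norm_eq_abs, abs_of_nonneg (sub_nonneg.2 hx.1)] at h1
  refine (neg_le_abs _).trans (h1.trans ?_)
  have := h.eta_pos
  have := hx.2.trans (h.X_le p hp)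
  gcongr
  linarith

lemma orbit_far {C : ℝ} (hC : ∀ p ∈ S, ∀ x ∈ Icc η (X p), orbit (w p) η x ≤ C) {p : E}
    (hp : p ∈ S) {s x : ℝ} (hs : s ∈ Ioc 0 η) (hx : x ∈ Icc η (X p)) :
    orbit (w p) s x ≤ C * (η ^ (N + 1))⁻¹ * s ^ (N + 1) := by
  have hη0 : (0 : ℝ) < η ^ (N + 1) := pow_pos h.eta_pos _
  obtain ⟨_, h1⟩ := h.near (Nat.zero_le k)
  have h2 := (h1 p hp s hs).1
  have hc : ContinuousOn (w p) (Ioc 0 (X p)) := continuousOn_of_eventually (h.cont_w p hp)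
  have hη : η ∈ Ioc 0 (X p) := ⟨h.eta_pos, h.le_X p hp⟩
  rw [← orbit_mul_orbit ordConnected_Ioc ⟨hs.1, hs.2.trans hη.2⟩ hη ⟨h.eta_pos.trans_le hx.1, hx.2⟩
    hc]
  have h3 : orbit (w p) s η ≤ (η ^ (N + 1))⁻¹ * s ^ (N + 1) := by
    rw [← div_eq_inv_mul, le_div_iff₀ hη0]; exact h2
  calc _ ≤ ((η ^ (N + 1))⁻¹ * s ^ (N + 1)) * C :=
        mul_le_mul h3 (hC p hp x hx) (orbit_pos _ _ _).le
          ((orbit_pos _ _ _).le.trans h3)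
    _ = _ := by ring

/-- All orbits starting close enough to `s = 0` stay in `y ≤ 1`. -/
lemma exists_orbit_le_one : ∃ s₀, 0 < s₀ ∧ s₀ ≤ η ∧ ∀ p ∈ S, ∀ s ∈ Ioo 0 s₀, ∀ x ∈ Icc s (X p),
    orbit (w p) s x ≤ 1 := by
  obtain ⟨C, hC1, hC⟩ := h.exists_orbit_le
  have hη := h.eta_pos
  refine ⟨η / C, by positivity, div_le_self hη.le hC1, fun p hp s hs x hx => ?_⟩
  have hsη : s ≤ η := hs.2.le.trans (div_le_self hη.le hC1)
  rcases le_total x η with hxη | hxη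
  · exact h.orbit_le_one_near hp hs.1 ⟨hx.1, hxη⟩
  · refine (h.orbit_far hC hp ⟨hs.1, hsη⟩ ⟨hxη, hx.2⟩).trans ?_
    have h1 : s / η ≤ 1 := (div_le_one hη).2 hsη
    have h2 : (s / η) ^ (N + 1) ≤ s / η :=
      pow_le_of_le_one (div_nonneg hs.1.le hη.le) h1 (Nat.succ_ne_zero N)
    have h3 : s < η / C := hs.2
    rw [lt_div_iff₀ (by linarith)] at h3
    calc C * (η ^ (N + 1))⁻¹ * s ^ (N + 1) = C * (s / η) ^ (N + 1) := by
          rw [div_pow]; ring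
      _ ≤ C * (s / η) := by gcongr
      _ ≤ 1 := by rw [mul_div_assoc', div_le_one hη]; linarith

lemma hasDerivAt_time {s₀ : ℝ} (hs₀ : s₀ ≤ η)
    (h1 : ∀ p ∈ S, ∀ s ∈ Ioo 0 s₀, ∀ x ∈ Icc s (X p), orbit (w p) s x ≤ 1) (i : ℕ) {p : E}
    (hp : p ∈ S) {s : ℝ} (hs : s ∈ Ioo 0 s₀) :
    HasDerivAt (orbitTime (w p) (m p) (u i p) (X p))
      (-(u i p s 1 * m p s) + w p s * orbitTime (w p) (m p) (u (i + 1) p) (X p) s) s := by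
  have h2 := hasDerivAt_orbitTime hs.1 (hs.2.le.trans (hs₀.trans (h.le_X p hp))) (h.cont_w p hp)
    (h.cont_m p hp) (h.analytic_u i p hp) (h1 p hp s hs)
  have h3 : (fun x y => deriv (fun y => y * u i p x y) y) = u (i + 1) p := by
    funext x y
    exact (h.u_succ i p x y).symm
  rwa [h3] at h2

lemma hasDerivAt_remainder {s₀ : ℝ} (hs₀ : s₀ ≤ η)
    (h1 : ∀ p ∈ S, ∀ s ∈ Ioo 0 s₀, ∀ x ∈ Icc s (X p), orbit (w p) s x ≤ 1) (i : ℕ) {p : E}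
    (hp : p ∈ S) {s : ℝ} (hs : s ∈ Ioo 0 s₀) :
    HasDerivAt (remainder N X w m u f i p)
      (-(u i p s 1 * m p s) + w p s * orbitTime (w p) (m p) (u (i + 1) p) (X p) s
        - ∑ n ∈ Finset.range (N + 1), f i n p 1 * (n * s ^ (n - 1))) s :=
  (h.hasDerivAt_time hs₀ h1 i hp hs).sub
    (HasDerivAt.fun_sum fun n _ => (hasDerivAt_pow n s).const_mul _)

/-- The formal relation between the expansions for `u i` and `u (i + 1)` holds for the actual
remainders: `q Θ ρ_i = ρ_{i + 1} - s ^ (N + 1) G_i`. -/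
lemma theta_remainder {s₀ : ℝ} (hs₀ : s₀ ≤ η)
    (h1 : ∀ p ∈ S, ∀ s ∈ Ioo 0 s₀, ∀ x ∈ Icc s (X p), orbit (w p) s x ≤ 1) {i : ℕ} (hi : i ≤ k)
    {p : E} (hp : p ∈ S) {s : ℝ} (hs : s ∈ Ioo 0 s₀) :
    Theta (remainder N X w m u f i p) s =
      (remainder N X w m u f (i + 1) p s - s ^ ((N + 1 : ℕ) : ℤ) * G i (s, p) 1)
        * (q (s, p))⁻¹ := by
  have hsη : s ∈ Ioc 0 η := ⟨hs.1, hs.2.le.trans hs₀⟩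
  have hs0 : s ≠ 0 := hs.1.ne'
  have hq := (h.q_pos p hp s hsη).ne'
  have hd := congrArg (fun φ : C(unitInterval, ℝ) => φ 1) (h.defect i hi p hp s hsη)
  simp only [ContinuousMap.sub_apply, ContinuousMap.add_apply, ContinuousMap.smul_apply,
    ContinuousMap.sum_apply, smul_eq_mul] at hd
  rw [Theta, (h.hasDerivAt_remainder hs₀ h1 i hp hs).deriv, remainder, zpow_natCast, ← hd]
  have hU := h.U_eq i p hp s hsη 1
  rw [show ((1 : unitInterval) : ℝ) = 1 from rfl] at hU
  rw [hU, h.w_eq p hp s hsη]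
  have e1 : ∑ n ∈ Finset.range (N + 1), f i n p 1 * (n * s ^ (n - 1))
      = s⁻¹ * ∑ n ∈ Finset.range (N + 1), n * s ^ n * f i n p 1 := by
    rw [Finset.mul_sum]
    refine Finset.sum_congr rfl fun n _ => ?_
    rcases n with _ | n
    · simp
    · rw [Nat.add_sub_cancel]
      field_simp
      ring
  have e2 : ∑ n ∈ Finset.range (N + 1), f (i + 1) n p 1 * s ^ n
      = ∑ n ∈ Finset.range (N + 1), s ^ n * f (i + 1) n p 1 :=
    Finset.sum_congr rfl fun n _ => mul_comm _ _
  rw [e1, e2]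
  -- the terms `u i p s 1 * m p s` from the boundary and from the defect cancel
  field_simp
  ring

lemma rateBound_remainder {s₀ : ℝ} (hs₀ : s₀ ≤ η)
    (h1 : ∀ p ∈ S, ∀ s ∈ Ioo 0 s₀, ∀ x ∈ Icc s (X p), orbit (w p) s x ≤ 1) {i : ℕ} (hi : i ≤ k) :
    RateBound S s₀ ((N + 1 : ℕ) : ℤ) (remainder N X w m u f i) := by
  obtain ⟨C, hC1, hC⟩ := h.exists_orbit_le
  obtain ⟨C₁, hC₁⟩ := h.near hi
  obtain ⟨Cm, hCm⟩ := h.bound_m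
  obtain ⟨Cu, hCu⟩ := h.bound_u i hi
  have hη0 : (0 : ℝ) < η ^ (N + 1) := pow_pos h.eta_pos _
  refine ⟨fun p hp s hs =>
    (h.hasDerivAt_remainder hs₀ h1 i hp hs).continuousAt.continuousWithinAt,
    C₁ + C * (η ^ (N + 1))⁻¹ * |Cu| * |Cm| * 2, fun p hp s hs => ?_⟩
  have hsη : s ∈ Ioc 0 η := ⟨hs.1, hs.2.le.trans hs₀⟩
  have hX := h.le_X p hp
  have hc : ContinuousOn (fun x => orbit (w p) s x * u i p x (orbit (w p) s x) * m p x)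
      (Icc s (X p)) := by
    intro x hx
    have hx' : x ∈ Ioc 0 (X p) := ⟨hs.1.trans_le hx.1, hx.2⟩
    have hYc := (h.hasDerivAt_orbit hp hs.1 hx.1 hx.2).continuousAt
    refine ContinuousAt.continuousWithinAt
      ((hYc.mul ?_).mul (h.cont_m p hp x hx').self_of_nhds)
    exact ContinuousAt.comp (g := fun z : ℝ × ℝ => u i p z.1 z.2)
      (f := fun y => (y, orbit (w p) s y)) (h.analytic_u i p hp x hx' _
        ⟨(orbit_pos _ _ _).le, h1 p hp s hs x hx⟩).continuousAt (continuousAt_id.prodMk hYc)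
  have hint : ∀ a ∈ Icc s (X p), ∀ b ∈ Icc s (X p), IntervalIntegrable
      (fun x => orbit (w p) s x * u i p x (orbit (w p) s x) * m p x) MeasureTheory.volume a b :=
    fun a ha b hb => (hc.mono (ordConnected_Icc.uIcc_subset ha hb)).intervalIntegrable
  have hsplit := intervalIntegral.integral_add_adjacent_intervals
    (hint s ⟨le_rfl, hsη.2.trans hX⟩ η ⟨hsη.2, hX⟩)
    (hint η ⟨hsη.2, hX⟩ (X p) ⟨hsη.2.trans hX, le_rfl⟩)
  have hfar := intervalIntegral.norm_integral_le_of_norm_le_const (a := η) (b := X p)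
    (f := fun x => orbit (w p) s x * u i p x (orbit (w p) s x) * m p x)
    (C := C * (η ^ (N + 1))⁻¹ * s ^ (N + 1) * |Cu| * |Cm|) fun x hx => by
      rw [uIoc_of_le hX] at hx
      have hx' : x ∈ Icc η (X p) := Ioc_subset_Icc_self hx
      have hY1 := h1 p hp s hs x ⟨hsη.2.trans hx'.1, hx'.2⟩
      rw [Real.norm_eq_abs, abs_mul, abs_mul, abs_of_pos (orbit_pos _ _ _)]
      have e1 := h.orbit_far hC hp hsη hx'
      have e2 := (hCu p hp x hx' _ ⟨(orbit_pos (w p) s x).le, hY1⟩).trans (le_abs_self Cu)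
      have e3 := (hCm p hp x hx').trans (le_abs_self Cm)
      have e4 := (orbit_pos (w p) s x).le.trans e1
      gcongr
  rw [Real.norm_eq_abs, abs_of_nonneg (sub_nonneg.2 hX)] at hfar
  have hnear := (hC₁ p hp s hsη).2
  rw [zpow_natCast, remainder, orbitTime, ← hsplit, add_sub_right_comm]
  refine (abs_add_le _ _).trans ((add_le_add hnear hfar).trans ?_)
  have hsN : 0 ≤ s ^ (N + 1) := pow_nonneg hs.1.le _
  have : C * (η ^ (N + 1))⁻¹ * s ^ (N + 1) * |Cu| * |Cm| * (X p - η)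
      ≤ C * (η ^ (N + 1))⁻¹ * s ^ (N + 1) * |Cu| * |Cm| * 2 := by
    have := h.eta_pos
    have := h.X_le p hp
    gcongr
    linarith
  linarith

/-- The remainders of the expansions together with their derivatives: each `Θ` costs a fixed power
of `s`, lost in the division by `q`. -/
theorem thetaBound_remainder {s₀ : ℝ} (hs₀ : s₀ ≤ η)
    (h1 : ∀ p ∈ S, ∀ s ∈ Ioo 0 s₀, ∀ x ∈ Icc s (X p), orbit (w p) s x ≤ 1) (r : ℕ) :
    ∀ i, i + r ≤ k → ThetaBound S s₀ r (((N + 1 : ℕ) : ℤ) - r * (μ * 2 ^ k : ℕ))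
      (remainder N X w m u f i) := by
  have hs₀1 : s₀ ≤ 1 := hs₀.trans h.eta_le
  obtain ⟨c, hc, hlow⟩ := h.q_lower
  have hq : ThetaBound S s₀ k (-((μ * 2 ^ k : ℕ) : ℤ)) (fun p s => (q (s, p))⁻¹) :=
    ((thetaBound_of_analyticOnNhd h.compact h.analytic_q k).mono_right hs₀).inv hc
      (fun p hp s hs => hlow p hp s ⟨hs.1, hs.2.le.trans hs₀⟩) hs₀1
  induction r with
  | zero =>
    intro i hi
    have := h.rateBound_remainder hs₀ h1 (i := i) (by omega)
    simpa [ThetaBound] using this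
  | succ r ih =>
    intro i hi
    have h2 := ih (i + 1) (by omega)
    have hGan : AnalyticOnNhd ℝ (fun w => G i w 1) (Icc 0 η ×ˢ S) := fun w hw =>
      AnalyticAt.comp (g := fun φ : C(unitInterval, ℝ) => φ 1) (f := G i)
        ((ContinuousMap.evalCLM ℝ (1 : unitInterval) : C(unitInterval, ℝ) →L[ℝ] ℝ).analyticAt
          (G i w))
        (h.analytic_G i (by omega) w hw)
    have h3 : ThetaBound S s₀ r ((N + 1 : ℕ) : ℤ)
        (fun p s => s ^ ((N + 1 : ℕ) : ℤ) * G i (s, p) 1) := by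
      have := (ThetaBound.zpow (S := S) (δ := s₀) r ((N + 1 : ℕ) : ℤ)).mul
        ((thetaBound_of_analyticOnNhd h.compact hGan r).mono_right hs₀)
      rwa [add_zero] at this
    have h4 := (h2.sub (h3.mono_exponent hs₀1 (by
      have : (0 : ℤ) ≤ r * (μ * 2 ^ k : ℕ) := by positivity
      omega))).mul (hq.of_le (by omega : r ≤ k))
    have he : ((N + 1 : ℕ) : ℤ) - r * (μ * 2 ^ k : ℕ) + -((μ * 2 ^ k : ℕ) : ℤ)
        = ((N + 1 : ℕ) : ℤ) - (r + 1 : ℕ) * (μ * 2 ^ k : ℕ) := by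
      push_cast; ring
    rw [he] at h4
    refine ⟨?_, fun p hp s hs =>
      (h.hasDerivAt_remainder hs₀ h1 i hp hs).differentiableAt.differentiableWithinAt,
      h4.congr fun p hp s hs => (h.theta_remainder hs₀ h1 (by omega) hp hs).symm⟩
    refine ThetaBound.mono_exponent (k := 0) (h.rateBound_remainder hs₀ h1 (i := i) (by omega))
      hs₀1 ?_
    have : (0 : ℤ) ≤ (r + 1 : ℕ) * (μ * 2 ^ k : ℕ) := by positivity
    omega

end IsUniformFamily

end UniformFamily

/-! ### The transport equation at the saddle-node -/

section Data

variable {E : Type*} [NormedAddCommGroup E] [NormedSpace ℝ E]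

/-- The iterates of `U` under the operator `u ↦ ∂_y (y u)`, which is what the derivative of the
time integral in its starting point amounts to. -/
def iterU (U : E → ℝ → ℝ → ℝ) : ℕ → E → ℝ → ℝ → ℝ
  | 0 => U
  | i + 1 => fun a x y => deriv (fun y => y * iterU U i a x y) y

lemma analyticAt_iterU {U : E → ℝ → ℝ → ℝ} {w : ℝ × ℝ × E}
    (h : AnalyticAt ℝ (fun w : ℝ × ℝ × E => U w.2.2 w.1 w.2.1) w) (i : ℕ) :
    AnalyticAt ℝ (fun w : ℝ × ℝ × E => iterU U i w.2.2 w.1 w.2.1) w := by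
  induction i with
  | zero => exact h
  | succ i ih =>
    set g : ℝ × ℝ × E → ℝ := fun w => w.2.1 * iterU U i w.2.2 w.1 w.2.1
    have hg : AnalyticAt ℝ g w := (analyticAt_fst.comp analyticAt_snd).mul ih
    have h1 : AnalyticAt ℝ (fun w => fderiv ℝ g w (0, 1, 0)) w :=
      AnalyticAt.comp (g := fun L : ℝ × ℝ × E →L[ℝ] ℝ => L (0, 1, 0)) (f := fderiv ℝ g)
        ((ContinuousLinearMap.apply ℝ ℝ ((0, 1, 0) : ℝ × ℝ × E)).analyticAt _) hg.fderiv
    refine h1.congr ?_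
    filter_upwards [hg.eventually_analyticAt] with v hv
    have h2 : HasDerivAt (fun y : ℝ => ((v.1, y, v.2.2) : ℝ × ℝ × E)) (0, 1, 0) v.2.1 :=
      (hasDerivAt_const _ _).prodMk ((hasDerivAt_id _).prodMk (hasDerivAt_const _ _))
    exact (HasFDerivAt.comp_hasDerivAt (f := fun y : ℝ => ((v.1, y, v.2.2) : ℝ × ℝ × E)) v.2.1
      hv.differentiableAt.hasFDerivAt h2).deriv.symm

lemma analyticAt_iterU_right {U : E → ℝ → ℝ → ℝ} {x y : ℝ} {a : E}
    (h : AnalyticAt ℝ (fun w : ℝ × ℝ × E => U w.2.2 w.1 w.2.1) (x, y, a)) (i : ℕ) :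
    AnalyticAt ℝ (fun y => iterU U i a x y) y :=
  AnalyticAt.comp (g := fun w : ℝ × ℝ × E => iterU U i w.2.2 w.1 w.2.1)
    (f := fun y => (x, y, a)) (analyticAt_iterU h i)
    (analyticAt_const.prod (analyticAt_id.prod analyticAt_const))

lemma hasDerivAt_mul_iterU {U : E → ℝ → ℝ → ℝ} {x y : ℝ} {a : E}
    (h : AnalyticAt ℝ (fun w : ℝ × ℝ × E => U w.2.2 w.1 w.2.1) (x, y, a)) (i : ℕ) :
    HasDerivAt (fun y => y * iterU U i a x y) (iterU U (i + 1) a x y) y :=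
  (differentiableAt_id.mul (analyticAt_iterU_right h i).differentiableAt).hasDerivAt

lemma continuous_iterU {U : E → ℝ → ℝ → ℝ} {x : ℝ} {a : E}
    (h : ∀ y ∈ Icc (0 : ℝ) 1,
      AnalyticAt ℝ (fun w : ℝ × ℝ × E => U w.2.2 w.1 w.2.1) (x, y, a)) (i : ℕ) :
    Continuous fun y : unitInterval => iterU U i a x y :=
  continuous_iff_continuousAt.2 fun y => ContinuousAt.comp (g := fun y => iterU U i a x y)
    (f := fun y : unitInterval => (y : ℝ)) (analyticAt_iterU_right (h y y.2) i).continuousAt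
    continuous_subtype_val.continuousAt

/-- The averaging operator inverts `u ↦ ∂_y (y u)`. -/
lemma avg_iterU {U : E → ℝ → ℝ → ℝ} {x : ℝ} {a : E}
    (h : ∀ y ∈ Icc (0 : ℝ) 1,
      AnalyticAt ℝ (fun w : ℝ × ℝ × E => U w.2.2 w.1 w.2.1) (x, y, a)) (i : ℕ) :
    avg (toC fun y : unitInterval => iterU U (i + 1) a x y)
      = toC fun y : unitInterval => iterU U i a x y := by
  ext y
  rw [toC_apply (continuous_iterU h i)]
  rcases eq_or_lt_of_le y.2.1 with hy | hy
  · have hy0 : y = 0 := Subtype.ext hy.symm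
    have h0 := h 0 ⟨le_rfl, zero_le_one⟩
    have h1 := (hasDerivAt_id (0 : ℝ)).mul (analyticAt_iterU_right h0 i).differentiableAt.hasDerivAt
    have h2 := (hasDerivAt_mul_iterU h0 i).unique h1
    simp only [id, one_mul, zero_mul, add_zero] at h2
    simp [hy0, avg_apply, toC_apply (continuous_iterU h (i + 1)), h2]
  · have h1 := primitive_eq (toC fun y : unitInterval => iterU U (i + 1) a x y) y.2
    have h2 : primitive (toC fun y : unitInterval => iterU U (i + 1) a x y) y
        = y * iterU U i a x y := by
      have hsub : uIcc 0 (y : ℝ) ⊆ Icc 0 1 :=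
        ordConnected_Icc.uIcc_subset ⟨le_rfl, zero_le_one⟩ y.2
      have h3 := intervalIntegral.integral_eq_sub_of_hasDerivAt (a := 0) (b := y)
        (f := fun y => y * iterU U i a x y) (f' := fun y => iterU U (i + 1) a x y)
        (fun t ht => hasDerivAt_mul_iterU (h t (hsub ht)) i)
        (ContinuousOn.intervalIntegrable fun t ht =>
          (analyticAt_iterU_right (h t (hsub ht)) (i + 1)).continuousAt.continuousWithinAt)
      rw [zero_mul, sub_zero] at h3
      rw [← h3, primitive]
      refine intervalIntegral.integral_congr fun t ht => ?_
      simp only [toC_apply (continuous_iterU h (i + 1)), projIcc_of_mem zero_le_one (hsub ht)]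
    rw [h2] at h1
    exact (mul_left_cancel₀ hy.ne' h1).symm

variable {P : ℝ → Polynomial ℝ} {ρ : ℕ} {σ : ℝ → ℝ} {V : E → ℝ → ℝ} {U : E → ℝ → ℝ → ℝ}
  {μ : ℕ} {a₀ : E}

/-- The function `Q / V` of `(s, z, a)`, the coefficient of `s ∂_s` in the transport equation. -/
def transportQ (P : ℝ → Polynomial ℝ) (ρ : ℕ) (σ : ℝ → ℝ) (V : E → ℝ → ℝ) (w : ℝ × ℝ × E) : ℝ :=
  (Q P ρ σ w.2.1).eval w.1 / V w.2.2 (w.1 + σ w.2.1)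

/-- The right hand sides `U / V` of the transport equation, as functions of `(s, z, a)` with values
in `C([0, 1], ℝ)`, and their iterates under `u ↦ ∂_y (y u)`. -/
def transportU (V : E → ℝ → ℝ) (U : E → ℝ → ℝ → ℝ) (σ : ℝ → ℝ) (i : ℕ) (w : ℝ × ℝ × E) :
    C(unitInterval, ℝ) :=
  (V w.2.2 (w.1 + σ w.2.1))⁻¹ •
    toC fun y : unitInterval => iterU U i w.2.2 (w.1 + σ w.2.1) y

lemma analyticAt_shift (hσ : AnalyticAt ℝ σ 0) :
    AnalyticAt ℝ (fun w : ℝ × ℝ × E => w.1 + σ w.2.1) (0, 0, a₀) :=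
  analyticAt_fst.add (AnalyticAt.comp (g := σ) (f := fun w : ℝ × ℝ × E => w.2.1) hσ
    (analyticAt_fst.comp analyticAt_snd))

lemma analyticAt_V_shift (hσ : AnalyticAt ℝ σ 0) (h0 : σ 0 = 0)
    (hV : AnalyticAt ℝ (fun w : ℝ × E => V w.2 w.1) (0, a₀)) :
    AnalyticAt ℝ (fun w : ℝ × ℝ × E => V w.2.2 (w.1 + σ w.2.1)) (0, 0, a₀) := by
  refine AnalyticAt.comp (g := fun w : ℝ × E => V w.2 w.1)
    (f := fun w : ℝ × ℝ × E => (w.1 + σ w.2.1, w.2.2)) ?_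
    ((analyticAt_shift hσ).prod (analyticAt_snd.comp analyticAt_snd))
  simpa [h0] using hV

lemma analyticAt_transportQ (hPan : ∀ i : ℕ, AnalyticAt ℝ (fun ε => (P ε).coeff i) 0)
    (hPdeg : ∀ᶠ ε in 𝓝 (0 : ℝ), (P ε).natDegree = μ + 1) (hρ : 0 < ρ) (hσ : AnalyticAt ℝ σ 0)
    (h0 : σ 0 = 0) (hV : AnalyticAt ℝ (fun w : ℝ × E => V w.2 w.1) (0, a₀)) (hV0 : V a₀ 0 ≠ 0) :
    AnalyticAt ℝ (transportQ P ρ σ V) (0, 0, a₀) := by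
  refine AnalyticAt.div ?_ (analyticAt_V_shift hσ h0 hV) (by simpa [h0] using hV0)
  exact AnalyticAt.comp (g := fun w : ℝ × ℝ => (Q P ρ σ w.2).eval w.1)
    (f := fun w : ℝ × ℝ × E => (w.1, w.2.1)) (analyticAt_Q_eval hPan hPdeg hρ hσ 0)
    (analyticAt_fst.prod (analyticAt_fst.comp analyticAt_snd))

lemma transportQ_zero {E : Type*} {V : E → ℝ → ℝ} {a₀ : E} (hμ : 0 < μ)
    (hP0 : P 0 = Polynomial.X ^ (μ + 1)) (hρ : 0 < ρ) (h0 : σ 0 = 0) :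
    transportQ P ρ σ V (0, 0, a₀) = 0 := by
  simp [transportQ, Q_zero_eval hP0 hρ h0, hμ.ne']

lemma analyticAt_transportU (hσ : AnalyticAt ℝ σ 0) (h0 : σ 0 = 0)
    (hV : AnalyticAt ℝ (fun w : ℝ × E => V w.2 w.1) (0, a₀)) (hV0 : V a₀ 0 ≠ 0)
    (hU : ∀ y ∈ Icc (0 : ℝ) 1,
      AnalyticAt ℝ (fun w : ℝ × ℝ × E => U w.2.2 w.1 w.2.1) (0, y, a₀)) (i : ℕ) :
    AnalyticAt ℝ (transportU V U σ i) (0, 0, a₀) := by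
  refine ((analyticAt_V_shift hσ h0 hV).inv (by simpa [h0] using hV0)).smul ?_
  refine analyticAt_toC (E := ℝ × ℝ × E)
    (g := fun v => iterU U i v.1.2.2 (v.1.1 + σ v.1.2.1) v.2) fun y hy => ?_
  refine AnalyticAt.comp (g := fun w : ℝ × ℝ × E => iterU U i w.2.2 w.1 w.2.1)
    (f := fun v : (ℝ × ℝ × E) × ℝ => (v.1.1 + σ v.1.2.1, v.2, v.1.2.2)) ?_ ?_
  · simpa [h0] using analyticAt_iterU (hU y hy) i
  · exact (AnalyticAt.comp (g := fun w : ℝ × ℝ × E => w.1 + σ w.2.1)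
      (f := fun v : (ℝ × ℝ × E) × ℝ => v.1) (analyticAt_shift hσ) analyticAt_fst).prod
      (analyticAt_snd.prod ((analyticAt_snd.comp analyticAt_snd).comp analyticAt_fst))

lemma eventually_avg_transportU {A : Set E} (hA : IsOpen A)
    (hU : AnalyticOnNhd ℝ (fun w : ℝ × ℝ × E => U w.2.2 w.1 w.2.1)
      (Icc (-1) 1 ×ˢ Icc (-1) 1 ×ˢ A)) (hσ : AnalyticAt ℝ σ 0) (h0 : σ 0 = 0) (ha₀ : a₀ ∈ A)
    (i : ℕ) : ∀ᶠ w in 𝓝 ((0 : ℝ), (0 : ℝ), a₀),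
      avg (transportU V U σ (i + 1) w) = transportU V U σ i w := by
  have h1 : ∀ᶠ w : ℝ × ℝ × E in 𝓝 (0, 0, a₀), w.1 + σ w.2.1 ∈ Icc (-1 : ℝ) 1 :=
    (analyticAt_shift (a₀ := a₀) hσ).continuousAt.eventually
      (Icc_mem_nhds (by norm_num [h0]) (by norm_num [h0]))
  have h2 : ∀ᶠ w : ℝ × ℝ × E in 𝓝 (0, 0, a₀), w.2.2 ∈ A :=
    (continuous_snd.comp continuous_snd).continuousAt.eventually (hA.mem_nhds ha₀)
  filter_upwards [h1, h2] with w h1 h2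
  rw [transportU, map_smul, avg_iterU (fun y hy => hU _ ⟨h1, ⟨by linarith [hy.1], hy.2⟩, h2⟩) i,
    transportU]

end Data

/-- A property that holds near `(0, 0, a)` for every `a` in a compact set holds for all small
`s, z ≥ 0` uniformly in `a`. -/
lemma exists_radius {E : Type*} [TopologicalSpace E] {K : Set E} (hK : IsCompact K)
    {φ : ℝ × ℝ × E → Prop} (h : ∀ a ∈ K, ∀ᶠ w in 𝓝 ((0 : ℝ), (0 : ℝ), a), φ w) :
    ∃ η > 0, ∀ s ∈ Icc 0 η, ∀ z ∈ Icc 0 η, ∀ a ∈ K, φ (s, z, a) := by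
  have h1 : ∀ᶠ x : ℝ × ℝ in 𝓝 (0, 0), ∀ a ∈ K, φ (x.1, x.2, a) := by
    refine hK.eventually_forall_of_forall_eventually
      (P := fun (x : ℝ × ℝ) a => φ (x.1, x.2, a)) fun a ha => ?_
    have hc : Continuous fun x : (ℝ × ℝ) × E => (x.1.1, x.1.2, x.2) := by fun_prop
    exact (hc.tendsto ((0, 0), a)).eventually (h a ha)
  obtain ⟨η, hη, hball⟩ := Metric.eventually_nhds_iff_ball.1 h1
  refine ⟨η / 2, half_pos hη, fun s hs z hz a ha => hball (s, z) ?_ a ha⟩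
  rw [Metric.mem_ball, Prod.dist_eq, max_lt_iff, Real.dist_eq, Real.dist_eq]
  simp only [sub_zero, abs_of_nonneg hs.1, abs_of_nonneg hz.1]
  exact ⟨by linarith [hs.2], by linarith [hz.2]⟩

/-- A polynomial with no roots beyond `θ` is positive there if it is positive close to `θ`. -/
lemma eval_pos_of_forall_isRoot_le {p : Polynomial ℝ} {θ r x : ℝ} (hr : 0 < r)
    (hnear : ∀ t, 0 < t → t ≤ r → 0 < p.eval (t + θ)) (hroot : ∀ x, p.IsRoot x → x ≤ θ)
    (hx : θ < x) : 0 < p.eval x := by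
  by_contra! hneg
  have ht : 0 < min r (x - θ) := lt_min hr (sub_pos.2 hx)
  obtain ⟨y, hy, hy0⟩ := intermediate_value_Icc' (f := fun x => p.eval x)
    (show min r (x - θ) + θ ≤ x by linarith [min_le_right r (x - θ)])
    p.continuous.continuousOn ⟨hneg, (hnear _ ht (min_le_left _ _)).le⟩
  linarith [hroot y hy0, hy.1]

/-! ### The expansion of the Dulac time -/

section Family

variable {E : Type*} [NormedAddCommGroup E] [NormedSpace ℝ E]

/-- The coefficient of `s ^ n` in the expansion of the Dulac time of `U`, as a function of
`(z, a)`: the formal solution of the transport equation evaluated at `y = 1`. -/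
def dulacCoeff (P : ℝ → Polynomial ℝ) (ρ : ℕ) (σ : ℝ → ℝ) (V : E → ℝ → ℝ) (U : E → ℝ → ℝ → ℝ)
    (n : ℕ) (z : ℝ) (a : E) : ℝ :=
  coeffFam (transportQ P ρ σ V) (transportU V U σ 0) n (z, a) 1

/-- `V / P` along the orbits, in the coordinate centred at the biggest root. -/
def shiftedW (P : ℝ → Polynomial ℝ) (ρ : ℕ) (σ : ℝ → ℝ) (V : E → ℝ → ℝ) (p : ℝ × E) (t : ℝ) : ℝ :=
  V p.2 (t + σ p.1) * ((P (p.1 ^ ρ)).eval (t + σ p.1))⁻¹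

/-- `1 / P` along the orbits, in the coordinate centred at the biggest root. -/
def shiftedM (P : ℝ → Polynomial ℝ) (ρ : ℕ) (σ : ℝ → ℝ) (p : ℝ × E) (t : ℝ) : ℝ :=
  ((P (p.1 ^ ρ)).eval (t + σ p.1))⁻¹

/-- The iterates of `U`, in the coordinate centred at the biggest root. -/
def shiftedU (U : E → ℝ → ℝ → ℝ) (σ : ℝ → ℝ) (i : ℕ) (p : ℝ × E) (t : ℝ) : ℝ → ℝ :=
  iterU U i p.2 (t + σ p.1)

variable {P : ℝ → Polynomial ℝ} {ρ μ ν : ℕ} {σ : ℝ → ℝ} {V : E → ℝ → ℝ} {U : E → ℝ → ℝ → ℝ}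
  {A K : Set E}

/-- On a small enough compact neighbourhood of `{z = 0}` all the assumptions on the family of time
integrals are satisfied. -/
theorem exists_isUniformFamily (hμ : 0 < μ)
    (hPan : ∀ i : ℕ, AnalyticAt ℝ (fun ε => (P ε).coeff i) 0)
    (hPdeg : ∀ᶠ ε in 𝓝 (0 : ℝ), (P ε).natDegree = μ + 1)
    (hP0 : P 0 = Polynomial.X ^ (μ + 1))
    (hroot : ∀ᶠ ε in 𝓝[≥] (0 : ℝ), ∃ x : ℝ, (P ε).IsRoot x)
    (hρ : 0 < ρ) (hσ : AnalyticAt ℝ σ 0)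
    (hpuiseux : ∀ᶠ ε in 𝓝[≥] (0 : ℝ), biggestRoot (P ε) = σ (ε ^ (1 / (ρ : ℝ))))
    (hν : 0 < ν) (hH1 : H1 P ρ σ μ ν) (hH2 : H2 P ρ σ μ ν) (hA : IsOpen A)
    (hVan : AnalyticOnNhd ℝ (fun w : ℝ × E => V w.2 w.1) (Icc (-1) 1 ×ˢ A))
    (hV0 : ∀ a ∈ A, 0 < V a 0)
    (hUan : AnalyticOnNhd ℝ (fun w : ℝ × ℝ × E => U w.2.2 w.1 w.2.1)
      (Icc (-1) 1 ×ˢ Icc (-1) 1 ×ˢ A))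
    (hK : IsCompact K) (hKA : K ⊆ A) (N k : ℕ) :
    ∃ η : ℝ, 0 < η ∧ η ≤ 1 ∧
      (∀ z ∈ Icc 0 η, |σ z| ≤ 1 / 4 ∧ biggestRoot (P (z ^ ρ)) = σ z ∧
        ∀ x, σ z < x → 0 < (P (z ^ ρ)).eval x) ∧
      (∀ n ≤ N, AnalyticOnNhd ℝ (fun p : ℝ × E => dulacCoeff P ρ σ V U n p.1 p.2)
        (Icc 0 η ×ˢ K)) ∧
      IsUniformFamily (Icc 0 η ×ˢ K) η N k μ (fun p => 1 - σ p.1) (shiftedW P ρ σ V)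
        (shiftedM P ρ σ) (shiftedU U σ) (transportQ P ρ σ V) (transportU V U σ)
        (fun i => coeffFam (transportQ P ρ σ V) (transportU V U σ i))
        (fun i => defectQuot (transportQ P ρ σ V) (transportU V U σ i) N) := by
  have h0 : σ 0 = 0 := by
    have h := hpuiseux.self_of_nhdsWithin (mem_Ici.2 le_rfl)
    rw [hP0, biggestRoot_X_pow _ (Nat.succ_ne_zero μ), Real.zero_rpow (by positivity)] at h
    exact h.symm
  have hzero : (0 : ℝ) ∈ Icc (-1 : ℝ) 1 := by norm_num
  have hVa : ∀ a ∈ A, AnalyticAt ℝ (fun w : ℝ × E => V w.2 w.1) (0, a) := fun a ha =>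
    hVan _ ⟨hzero, ha⟩
  have hUa : ∀ a ∈ A, ∀ y ∈ Icc (0 : ℝ) 1,
      AnalyticAt ℝ (fun w : ℝ × ℝ × E => U w.2.2 w.1 w.2.1) (0, y, a) := fun a ha y hy =>
    hUan _ ⟨hzero, ⟨by linarith [hy.1], hy.2⟩, ha⟩
  have hq : ∀ a ∈ A, AnalyticAt ℝ (transportQ P ρ σ V) (0, 0, a) := fun a ha =>
    analyticAt_transportQ hPan hPdeg hρ hσ h0 (hVa a ha) (hV0 a ha).ne'
  have hq0 : ∀ a : E, transportQ P ρ σ V (0, 0, a) = 0 := fun a =>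
    transportQ_zero hμ hP0 hρ h0
  have hu : ∀ a ∈ A, ∀ i, AnalyticAt ℝ (transportU V U σ i) (0, 0, a) := fun a ha i =>
    analyticAt_transportU hσ h0 (hVa a ha) (hV0 a ha).ne' (hUa a ha) i
  have hL : ∀ a ∈ A, ∀ i, ∀ᶠ w in 𝓝 ((0 : ℝ), (0 : ℝ), a),
      avg (transportU V U σ (i + 1) w) = transportU V U σ i w := fun a ha i =>
    eventually_avg_transportU hA hUan hσ h0 ha i
  have hsnd : ∀ a : E, Tendsto (fun w : ℝ × ℝ × E => w.2) (𝓝 (0, 0, a)) (𝓝 (0, a)) := fun a =>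
    continuous_snd.tendsto _
  have hz : ∀ a : E, Tendsto (fun w : ℝ × ℝ × E => w.2.1) (𝓝 (0, 0, a)) (𝓝 0) := fun a =>
    (continuous_fst.comp continuous_snd).tendsto _
  -- the properties that hold near `s = z = 0`, uniformly on the compact set `K`
  obtain ⟨η₁, hη₁, H₁⟩ := exists_radius hK (φ := fun w => AnalyticAt ℝ (transportQ P ρ σ V) w ∧
      2 * (N + 1) * transportQ P ρ σ V w < 1 ∧ 0 < V w.2.2 (w.1 + σ w.2.1)) fun a ha => by
    have h1 : ContinuousAt (fun w => 2 * (N + 1) * transportQ P ρ σ V w) (0, 0, a) :=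
      continuousAt_const.mul (hq a (hKA ha)).continuousAt
    exact (hq a (hKA ha)).eventually_analyticAt.and
      ((h1.eventually (eventually_lt_nhds (by simp [hq0]))).and
        ((analyticAt_V_shift hσ h0 (hVa a (hKA ha))).continuousAt.eventually
          (eventually_gt_nhds (by simpa [h0] using hV0 a (hKA ha)))))
  obtain ⟨η₂, hη₂, H₂⟩ := exists_radius hK (φ := fun w => ∀ i ∈ Iic k,
      AnalyticAt ℝ (defectQuot (transportQ P ρ σ V) (transportU V U σ i) N) w ∧
      (transportU V U σ i w + transportQ P ρ σ V w • ∑ n ∈ Finset.range (N + 1), (n * w.1 ^ n) •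
          coeffFam (transportQ P ρ σ V) (transportU V U σ i) n w.2
        - ∑ n ∈ Finset.range (N + 1), w.1 ^ n •
          coeffFam (transportQ P ρ σ V) (transportU V U σ (i + 1)) n w.2
        = w.1 ^ (N + 1) • defectQuot (transportQ P ρ σ V) (transportU V U σ i) N w) ∧
      (∀ n ≤ N, avg (coeffFam (transportQ P ρ σ V) (transportU V U σ (i + 1)) n w.2)
        = coeffFam (transportQ P ρ σ V) (transportU V U σ i) n w.2) ∧
      ∀ n ∈ Iic N, AnalyticAt ℝ (coeffFam (transportQ P ρ σ V) (transportU V U σ i) n) w.2)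
      fun a ha => (eventually_all_finite (finite_Iic k)).2 fun i _ => by
    have ha := hKA ha
    refine (analyticAt_defectQuot (hq a ha) (hq0 a) (hu a ha i) N).eventually_analyticAt.and
      ((eventually_defect (hq a ha) (hq0 a) (hu a ha i) (hu a ha (i + 1)) (hL a ha i) N).and
        (((hsnd a).eventually (eventually_coeffFam_avg (hq a ha) (hq0 a) (hu a ha (i + 1))
          (hL a ha i) N)).mono (fun w hw n hn => (hw n hn).1) |>.and ?_))
    exact (eventually_all_finite (finite_Iic N)).2 fun n _ => (hsnd a).eventually
      (analyticAt_coeffFam (hq a ha) (hq0 a) (hu a ha i) n).eventually_analyticAt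
  -- the properties of the polynomials alone
  have hev : ∀ᶠ z in 𝓝[≥] (0 : ℝ), (biggestRoot (P (z ^ ρ)) = σ z ∧ (P (z ^ ρ)).IsRoot (σ z) ∧
      ∀ x, (P (z ^ ρ)).IsRoot x → x ≤ σ z) ∧ |σ z| < 1 / 4 ∧ ContinuousAt σ z ∧
      (∀ s : ℝ, (Q P ρ σ z).eval s
        = ∑ i ∈ Finset.range (μ + 1), (Q P ρ σ z).coeff i * s ^ i) ∧
      ∀ i ∈ Finset.range (μ + 1), ContinuousAt (fun z => (Q P ρ σ z).coeff i) z := by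
    refine (eventually_puiseux hPdeg hroot hρ hpuiseux).and
      (Eventually.filter_mono nhdsWithin_le_nhds ?_)
    refine (hσ.continuousAt.abs.eventually (eventually_lt_nhds (by norm_num [h0]))).and
      ((hσ.eventually_analyticAt.mono fun z hz => hz.continuousAt).and
        ((eventually_Q_eval hPdeg hρ).and ((Finset.eventually_all _).2 fun i _ =>
          (analyticAt_Q_coeff hPan hPdeg hρ hσ i).eventually_analyticAt.mono
            fun z hz => hz.continuousAt)))
  obtain ⟨η₃, hη₃, H₃⟩ := mem_nhdsGE_iff_exists_Icc_subset.1 hev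
  obtain ⟨c, hc, r, hr, hlow⟩ := exists_Q_lower_bound hμ hPan hPdeg hρ hσ hν hH1 hH2
  obtain ⟨η, hη, hη1, hη2, hη3, hηr, hη4⟩ : ∃ η : ℝ, 0 < η ∧ η ≤ η₁ ∧ η ≤ η₂ ∧ η ≤ η₃ ∧ η ≤ r ∧
      η ≤ 1 / 4 :=
    ⟨min η₁ (min η₂ (min η₃ (min r (1 / 4)))), by positivity, by simp, by simp, by simp, by simp,
      by simp⟩
  replace H₁ := fun s (hs : s ∈ Icc 0 η) z (hz : z ∈ Icc 0 η) =>
    H₁ s (Icc_subset_Icc_right hη1 hs) z (Icc_subset_Icc_right hη1 hz)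
  replace H₂ := fun s (hs : s ∈ Icc 0 η) z (hz : z ∈ Icc 0 η) =>
    H₂ s (Icc_subset_Icc_right hη2 hs) z (Icc_subset_Icc_right hη2 hz)
  replace H₃ := fun z (hz : z ∈ Icc 0 η) => H₃ (Icc_subset_Icc_right hη3 hz)
  have h0η : (0 : ℝ) ∈ Icc 0 η := ⟨le_rfl, hη.le⟩
  have hSc : IsCompact (Icc 0 η ×ˢ K) := isCompact_Icc.prod hK
  have hσ4 : ∀ z ∈ Icc 0 η, -(1 / 4) ≤ σ z ∧ σ z ≤ 1 / 4 := fun z hz =>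
    abs_le.1 (H₃ z hz).2.1.le
  have hQpos : ∀ z ∈ Icc 0 η, ∀ s, 0 < s → s ≤ r → 0 < (Q P ρ σ z).eval s := fun z hz s hs hsr =>
    lt_of_lt_of_le (by positivity) (hlow s z hs hsr hz.1 (hz.2.trans hηr))
  have hPpos : ∀ z ∈ Icc 0 η, ∀ x, σ z < x → 0 < (P (z ^ ρ)).eval x := by
    intro z hz x hx
    refine eval_pos_of_forall_isRoot_le hr (fun t ht htr => ?_) (H₃ z hz).1.2.2 hx
    rw [← mul_Q_eval (H₃ z hz).1.2.1]
    exact mul_pos ht (hQpos z hz t ht htr)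
  have hshift : ∀ z ∈ Icc 0 η, ∀ x ∈ Ioc 0 (1 - σ z), x + σ z ∈ Icc (-1 : ℝ) 1 :=
    fun z hz x hx => ⟨by linarith [hx.1, (hσ4 z hz).1], by linarith [hx.2]⟩
  have hηX : ∀ z ∈ Icc 0 η, η ≤ 1 - σ z := fun z hz => by linarith [(hσ4 z hz).2]
  have hVat : ∀ a ∈ K, ∀ x ∈ Icc (-1 : ℝ) 1, AnalyticAt ℝ (V a) x := fun a ha x hx =>
    AnalyticAt.comp (g := fun w : ℝ × E => V w.2 w.1) (f := fun x => (x, a)) (hVan _ ⟨hx, hKA ha⟩)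
      (analyticAt_id.prod analyticAt_const)
  -- bounds for `V` and for the reciprocal of `P`
  obtain ⟨CV, hCV⟩ := (isCompact_Icc.prod hK).exists_bound_of_continuousOn
    (hVan.mono (prod_mono_right hKA)).continuousOn
  have hVle : ∀ a ∈ K, ∀ x ∈ Icc (-1 : ℝ) 1, |V a x| ≤ |CV| := fun a ha x hx =>
    (hCV (x, a) ⟨hx, ha⟩).trans (le_abs_self CV)
  obtain ⟨Cm, hCm⟩ : ∃ Cm, ∀ p ∈ Icc 0 η ×ˢ K, ∀ x ∈ Icc η (1 - σ p.1),
      |shiftedM P ρ σ p x| ≤ Cm := by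
    have hcont : ContinuousOn (fun w : ℝ × ℝ => (w.1 * (Q P ρ σ w.2).eval w.1)⁻¹)
        (Icc η 2 ×ˢ Icc 0 η) := by
      refine ContinuousOn.inv₀ (continuousOn_fst.mul ?_) fun w hw => ?_
      · have h1 : ContinuousOn (fun w : ℝ × ℝ => ∑ i ∈ Finset.range (μ + 1),
            (Q P ρ σ w.2).coeff i * w.1 ^ i) (Icc η 2 ×ˢ Icc 0 η) := by
          refine continuousOn_finsetSum _ fun i hi => ContinuousOn.mul ?_ (continuousOn_fst.pow i)
          intro w hw
          exact (ContinuousAt.comp (g := fun z => (Q P ρ σ z).coeff i) (f := fun w : ℝ × ℝ => w.2)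
            ((H₃ w.2 hw.2).2.2.2.2 i hi) continuous_snd.continuousAt).continuousWithinAt
        exact h1.congr fun w hw => (H₃ w.2 hw.2).2.2.2.1 w.1
      · rw [mul_Q_eval (H₃ w.2 hw.2).1.2.1]
        exact (hPpos w.2 hw.2 _ (by linarith [hw.1.1])).ne'
    obtain ⟨C, hC⟩ := (isCompact_Icc.prod isCompact_Icc).exists_bound_of_continuousOn hcont
    refine ⟨C, fun p hp x hx => ?_⟩
    have := hC (x, p.1) ⟨⟨hx.1, by linarith [hx.2, (hσ4 p.1 hp.1).1]⟩, hp.1⟩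
    rwa [mul_Q_eval (H₃ p.1 hp.1).1.2.1] at this
  have hqV : ∀ p ∈ Icc 0 η ×ˢ K, ∀ x ∈ Ioc 0 η, 0 < V p.2 (x + σ p.1) ∧
      0 < (Q P ρ σ p.1).eval x ∧ (P (p.1 ^ ρ)).eval (x + σ p.1) = x * (Q P ρ σ p.1).eval x :=
    fun p hp x hx => ⟨(H₁ x (Ioc_subset_Icc_self hx) p.1 hp.1 p.2 hp.2).2.2,
      hQpos p.1 hp.1 x hx.1 (hx.2.trans hηr), (mul_Q_eval (H₃ p.1 hp.1).1.2.1 x).symm⟩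
  refine ⟨η, hη, by linarith, fun z hz => ⟨(H₃ z hz).2.1.le, (H₃ z hz).1.1, hPpos z hz⟩,
    fun n hn p hp => ?_, ?_⟩
  · exact AnalyticAt.comp (g := fun φ : C(unitInterval, ℝ) => φ 1)
      (f := coeffFam (transportQ P ρ σ V) (transportU V U σ 0) n)
      ((ContinuousMap.evalCLM ℝ (1 : unitInterval) : C(unitInterval, ℝ) →L[ℝ] ℝ).analyticAt _)
      ((H₂ 0 h0η p.1 hp.1 p.2 hp.2 0 (Nat.zero_le k)).2.2.2 n hn)
  · refine
      { compact := hSc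
        eta_pos := hη
        eta_le := by linarith
        le_X := fun p hp => hηX p.1 hp.1
        X_le := fun p hp => by linarith [(hσ4 p.1 hp.1).1]
        cont_w := fun p hp x hx => ?_
        cont_m := fun p hp x hx => ?_
        analytic_u := fun i p hp x hx y hy => ?_
        u_succ := fun _ _ _ _ => rfl
        q_pos := fun p hp x hx => div_pos (hqV p hp x hx).2.1 (hqV p hp x hx).1
        q_le := fun p hp x hx => (H₁ x (Ioc_subset_Icc_self hx) p.1 hp.1 p.2 hp.2).2.1.le
        w_eq := fun p hp x hx => ?_
        U_eq := fun i p hp x hx y => ?_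
        bound_w := ⟨|CV| * Cm, fun p hp x hx => ?_⟩
        bound_m := ⟨Cm, hCm⟩
        bound_u := fun i _ => ?_
        bound_f := fun i hi n hn => ?_
        avg_f := fun i hi n hn p hp => (H₂ 0 h0η p.1 hp.1 p.2 hp.2 i hi).2.2.1 n hn
        defect := fun i hi p hp x hx =>
          (H₂ x (Ioc_subset_Icc_self hx) p.1 hp.1 p.2 hp.2 i hi).2.1
        analytic_q := fun w hw => (H₁ w.1 hw.1 w.2.1 hw.2.1 w.2.2 hw.2.2).1
        analytic_G := fun i hi w hw => (H₂ w.1 hw.1 w.2.1 hw.2.1 w.2.2 hw.2.2 i hi).1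
        q_lower := ⟨c / (|CV| + 1), by positivity, fun p hp x hx => ?_⟩ }
    · have h1 := eventually_continuousAt_div_eval (p := P (p.1 ^ ρ)) (v := V p.2)
        (x₀ := x + σ p.1) (fun y hy => hPpos p.1 hp.1 y (by linarith [hx.1, hy.1]))
        (fun y hy => hVat p.2 hp.2 y ⟨(hshift p.1 hp.1 x hx).1.trans hy.1, hy.2⟩)
        (x + σ p.1) ⟨le_rfl, (hshift p.1 hp.1 x hx).2⟩
      have h2 : Continuous fun y => y + σ p.1 := continuous_id.add continuous_const
      filter_upwards [(h2.tendsto x).eventually h1] with y hy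
      exact ContinuousAt.comp (g := fun x => V p.2 x * ((P (p.1 ^ ρ)).eval x)⁻¹)
        (f := fun y => y + σ p.1) hy h2.continuousAt
    · have h1 := eventually_continuousAt_inv_eval (p := P (p.1 ^ ρ))
        (x₀ := x + σ p.1) (fun y hy => hPpos p.1 hp.1 y (by linarith [hx.1, hy.1]))
        (x + σ p.1) ⟨le_rfl, (hshift p.1 hp.1 x hx).2⟩
      have h2 : Continuous fun y => y + σ p.1 := continuous_id.add continuous_const
      filter_upwards [(h2.tendsto x).eventually h1] with y hy
      exact ContinuousAt.comp (g := fun x => ((P (p.1 ^ ρ)).eval x)⁻¹)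
        (f := fun y => y + σ p.1) hy h2.continuousAt
    · exact AnalyticAt.comp (g := fun w : ℝ × ℝ × E => iterU U i w.2.2 w.1 w.2.1)
        (f := fun z : ℝ × ℝ => (z.1 + σ p.1, z.2, p.2))
        (analyticAt_iterU (hUan _ ⟨hshift p.1 hp.1 x hx, ⟨by linarith [hy.1], hy.2⟩, hKA hp.2⟩) i)
        ((analyticAt_fst.add analyticAt_const).prod (analyticAt_snd.prod analyticAt_const))
    · obtain ⟨h1, h2, h3⟩ := hqV p hp x hx
      rw [shiftedW, h3, transportQ]
      have := hx.1
      field_simp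
    · obtain ⟨h1, h2, h3⟩ := hqV p hp x hx
      have hxX : x ∈ Ioc 0 (1 - σ p.1) := ⟨hx.1, hx.2.trans (hηX p.1 hp.1)⟩
      rw [shiftedM, shiftedU, h3, transportQ, transportU, ContinuousMap.smul_apply,
        toC_apply (continuous_iterU (fun y hy => hUan _
          ⟨hshift p.1 hp.1 x hxX, ⟨by linarith [hy.1], hy.2⟩, hKA hp.2⟩) i)]
      have := hx.1
      simp only [smul_eq_mul]
      field_simp
    · rw [shiftedW, abs_mul]
      exact mul_le_mul (hVle p.2 hp.2 _ (hshift p.1 hp.1 x ⟨hη.trans_le hx.1, hx.2⟩))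
        (hCm p hp x hx) (abs_nonneg _) (abs_nonneg _)
    · obtain ⟨C, hC⟩ := (isCompact_Icc.prod (isCompact_Icc.prod hK)).exists_bound_of_continuousOn
        (f := fun w : ℝ × ℝ × E => iterU U i w.2.2 w.1 w.2.1)
        (s := Icc (-1) 1 ×ˢ Icc (-1) 1 ×ˢ K)
        fun w hw => (analyticAt_iterU (hUan w ⟨hw.1, hw.2.1, hKA hw.2.2⟩)
          i).continuousAt.continuousWithinAt
      exact ⟨C, fun p hp x hx y hy => hC (x + σ p.1, y, p.2)
        ⟨hshift p.1 hp.1 x ⟨hη.trans_le hx.1, hx.2⟩, ⟨by linarith [hy.1], hy.2⟩, hp.2⟩⟩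
    · exact hSc.exists_bound_of_continuousOn fun p hp =>
        ((H₂ 0 h0η p.1 hp.1 p.2 hp.2 i hi).2.2.2 n hn).continuousAt.continuousWithinAt
    · obtain ⟨h1, h2, h3⟩ := hqV p hp x hx
      have h4 := hVle p.2 hp.2 _ (hshift p.1 hp.1 x ⟨hx.1, hx.2.trans (hηX p.1 hp.1)⟩)
      have h5 := hlow x p.1 hx.1 (hx.2.trans hηr) hp.1.1 (hp.1.2.trans hηr)
      have h6 := (le_abs_self _).trans h4
      rw [transportQ, div_mul_eq_mul_div]
      exact div_le_div₀ h2.le h5 h1 (by linarith)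

end Family

/-- Increasing the order of the expansion until the loss of powers of `s` in the derivatives is
compensated: the remainder to order `l` is `s ^ l` times a function that tends to zero together
with its first `k` derivatives under `Θ`. -/
lemma IsUniformFamily.thetaBound_div {E : Type*} [NormedAddCommGroup E] [NormedSpace ℝ E]
    {S : Set E} {η : ℝ} {l k μ : ℕ} {X : E → ℝ} {w m : E → ℝ → ℝ}
    {u : ℕ → E → ℝ → ℝ → ℝ} {q : ℝ × E → ℝ} {U : ℕ → ℝ × E → C(unitInterval, ℝ)}
    {f : ℕ → ℕ → E → C(unitInterval, ℝ)} {G : ℕ → ℝ × E → C(unitInterval, ℝ)}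
    (h : IsUniformFamily S η (l + k * (μ * 2 ^ k)) k μ X w m u q U f G) {s₀ : ℝ} (hs₀ : s₀ ≤ η)
    (h1 : ∀ p ∈ S, ∀ s ∈ Ioo 0 s₀, ∀ x ∈ Icc s (X p), orbit (w p) s x ≤ 1) :
    ThetaBound S s₀ k 1 (fun p s => (orbitTime (w p) (m p) (u 0 p) (X p) s
      - ∑ j ∈ Finset.range (l + 1), f 0 j p 1 * s ^ j) / s ^ l) := by
  set N := l + k * (μ * 2 ^ k) with hN
  have hs₀1 : s₀ ≤ 1 := hs₀.trans h.eta_le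
  have h2 := h.thetaBound_remainder hs₀ h1 k 0 (by omega)
  have hexp : ((N + 1 : ℕ) : ℤ) - k * (μ * 2 ^ k : ℕ) = (l + 1 : ℕ) := by
    rw [hN]; push_cast; ring
  rw [hexp] at h2
  have h3 : ThetaBound S s₀ k ((l + 1 : ℕ) : ℤ)
      (fun p s => ∑ j ∈ Finset.Ico (l + 1) (N + 1), f 0 j p 1 * s ^ (j : ℤ)) := by
    refine ThetaBound.sum _ fun j hj => ?_
    rw [Finset.mem_Ico] at hj
    obtain ⟨C, hC⟩ := h.bound_f 0 (Nat.zero_le k) j (by omega)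
    exact (ThetaBound.const_mul_zpow k (j : ℤ) fun p hp =>
      ((f 0 j p).norm_coe_le_norm 1).trans (hC p hp)).mono_exponent hs₀1 (by omega)
  have h4 := (h2.add h3).mul (ThetaBound.zpow (S := S) (δ := s₀) k (-(l : ℤ)))
  rw [show ((l + 1 : ℕ) : ℤ) + -(l : ℤ) = 1 by push_cast; ring] at h4
  refine h4.congr fun p _ s _ => ?_
  simp only [remainder, zpow_natCast, zpow_neg]
  rw [← Finset.sum_range_add_sum_Ico _ (show l + 1 ≤ N + 1 by omega), div_eq_mul_inv]
  ring

end

end SaddleNode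

open SaddleNode in
theorem theoremB
    -- the family of polynomials `P_ε(x)`
    (μ : ℕ) (hμ : 0 < μ) (P : ℝ → Polynomial ℝ)
    (hPan : ∀ i : ℕ, AnalyticAt ℝ (fun ε => (P ε).coeff i) 0)
    (hPdeg : ∀ᶠ ε in 𝓝 (0 : ℝ), (P ε).natDegree = μ + 1)
    (hP0 : P 0 = Polynomial.X ^ (μ + 1))
    (hroot : ∀ᶠ ε in 𝓝[≥] (0 : ℝ), ∃ x : ℝ, (P ε).IsRoot x)
    -- the Puiseux parametrization of the biggest root
    (ρ : ℕ) (hρ : 0 < ρ) (σ : ℝ → ℝ) (hσ : AnalyticAt ℝ σ 0)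
    (hpuiseux : ∀ᶠ ε in 𝓝[≥] (0 : ℝ),
      SaddleNode.biggestRoot (P ε) = σ (ε ^ (1 / (ρ : ℝ))))
    (ν : ℕ) (hν : 0 < ν)
    (hH1 : SaddleNode.H1 P ρ σ μ ν) (hH2 : SaddleNode.H2 P ρ σ μ ν)
    -- the parameter set and the functions `V_a(x)` and `U_a(x, y)`
    (α : ℕ) (A : Set (EuclideanSpace ℝ (Fin α))) (hA : IsOpen A)
    (V : EuclideanSpace ℝ (Fin α) → ℝ → ℝ)
    (hVan : AnalyticOnNhd ℝ (fun w : ℝ × EuclideanSpace ℝ (Fin α) => V w.2 w.1)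
      (Icc (-1) 1 ×ˢ A))
    (hV0 : ∀ a ∈ A, 0 < V a 0)
    (U : EuclideanSpace ℝ (Fin α) → ℝ → ℝ → ℝ)
    (hUan : AnalyticOnNhd ℝ
      (fun w : ℝ × ℝ × EuclideanSpace ℝ (Fin α) => U w.2.2 w.1 w.2.1)
      (Icc (-1) 1 ×ˢ Icc (-1) 1 ×ˢ A))
    (hUtaylor : ∀ a ∈ A, SaddleNode.HasAbsConvTaylorSeries (U a)) :
    ∃ c : ℕ → ℝ → EuclideanSpace ℝ (Fin α) → ℝ,
      ∀ (l k : ℕ) (K : Set (EuclideanSpace ℝ (Fin α))), IsCompact K → K ⊆ A →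
        ∃ ε₀ : ℝ, 0 < ε₀ ∧ ε₀ ≤ 1 ∧
          (∀ j ≤ l, AnalyticOnNhd ℝ
            (fun w : ℝ × EuclideanSpace ℝ (Fin α) => c j w.1 w.2)
            (Icc 0 (ε₀ ^ (1 / (ρ : ℝ))) ×ˢ K)) ∧
          ∃ h : ℝ → ℝ → EuclideanSpace ℝ (Fin α) → ℝ,
            -- the Dulac time has the expansion wherever it is defined
            (∀ ε ∈ Icc 0 ε₀, ∀ a ∈ K, ∀ s > 0, ∀ T : ℝ,
              SaddleNode.IsDulacTime (P ε) (V a) (U a)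
                (s + SaddleNode.biggestRoot (P ε)) T →
              T = ∑ j ∈ Finset.range (l + 1), c j (ε ^ (1 / (ρ : ℝ))) a * s ^ j
                + s ^ l * h s ε a) ∧
            -- it is defined, and the remainder is differentiable, for small `s`
            (∃ s₀ > 0, ∀ ε ∈ Icc 0 ε₀, ∀ a ∈ K,
              (∀ s ∈ Ioo 0 s₀, ∃ T : ℝ, SaddleNode.IsDulacTime (P ε) (V a) (U a)
                (s + SaddleNode.biggestRoot (P ε)) T) ∧
              ContDiffOn ℝ k (fun s => h s ε a) (Ioo 0 s₀)) ∧
            ∀ r ≤ k, TendstoUniformlyOn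
              (fun (s : ℝ) (w : ℝ × EuclideanSpace ℝ (Fin α)) =>
                (SaddleNode.Theta^[r] (fun s' => h s' w.1 w.2)) s)
              (fun _ => 0) (𝓝[>] 0) (Icc 0 ε₀ ×ˢ K) := by
  have hρ0 : ρ ≠ 0 := hρ.ne'
  refine ⟨dulacCoeff P ρ σ V U, fun l k K hK hKA => ?_⟩
  obtain ⟨η, hη, hη1, hη2, hη3, hfam⟩ := exists_isUniformFamily hμ hPan hPdeg hP0 hroot hρ hσ
    hpuiseux hν hH1 hH2 hA hVan hV0 hUan hK hKA (l + k * (μ * 2 ^ k)) k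
  obtain ⟨s₀, hs₀, hs₀η, hY⟩ := hfam.exists_orbit_le_one
  have hbound := hfam.thetaBound_div hs₀η hY
  have hηρ : (η ^ ρ) ^ (1 / (ρ : ℝ)) = η := by
    rw [one_div, Real.pow_rpow_inv_natCast hη.le hρ0]
  -- the parameter `z = ε ^ (1 / ρ)`
  have hz : ∀ ε ∈ Icc 0 (η ^ ρ), ε ^ (1 / (ρ : ℝ)) ∈ Icc 0 η ∧ (ε ^ (1 / (ρ : ℝ))) ^ ρ = ε := by
    intro ε hε
    refine ⟨⟨Real.rpow_nonneg hε.1 _, ?_⟩, by rw [one_div, Real.rpow_inv_natCast_pow hε.1 hρ0]⟩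
    exact (Real.rpow_le_rpow hε.1 hε.2 (by positivity)).trans hηρ.le
  set T : EuclideanSpace ℝ (Fin α) → ℝ → ℝ → ℝ := fun a z s =>
    orbitTime (shiftedW P ρ σ V (z, a)) (shiftedM P ρ σ (z, a)) (shiftedU U σ 0 (z, a)) (1 - σ z) s
    with hT
  have hTeq : ∀ a z s, T a z s = orbitTime (fun x => V a x * ((P (z ^ ρ)).eval x)⁻¹)
      (fun x => ((P (z ^ ρ)).eval x)⁻¹) (U a) 1 (s + σ z) := by
    intro a z s
    have := orbitTime_translate (fun x => V a x * ((P (z ^ ρ)).eval x)⁻¹)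
      (fun x => ((P (z ^ ρ)).eval x)⁻¹) (U a) (σ z) (1 - σ z) s
    rw [sub_add_cancel] at this
    exact this
  have hVx : ∀ a ∈ K, ∀ x ∈ Icc (-1 : ℝ) 1, AnalyticAt ℝ (V a) x := fun a ha x hx =>
    AnalyticAt.comp (g := fun w : ℝ × EuclideanSpace ℝ (Fin α) => V w.2 w.1) (f := fun x => (x, a))
      (hVan _ ⟨hx, hKA ha⟩) (analyticAt_id.prod analyticAt_const)
  have hUx : ∀ a ∈ K, ∀ x ∈ Icc (-1 : ℝ) 1, ∀ y ∈ Icc (0 : ℝ) 1,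
      AnalyticAt ℝ (fun z : ℝ × ℝ => U a z.1 z.2) (x, y) := fun a ha x hx y hy =>
    AnalyticAt.comp (g := fun w : ℝ × ℝ × EuclideanSpace ℝ (Fin α) => U w.2.2 w.1 w.2.1)
      (f := fun z : ℝ × ℝ => (z.1, z.2, a))
      (hUan _ ⟨hx, ⟨by linarith [hy.1], hy.2⟩, hKA ha⟩)
      (analyticAt_fst.prod (analyticAt_snd.prod analyticAt_const))
  refine ⟨η ^ ρ, by positivity, pow_le_one₀ hη.le hη1, fun j hj => ?_,
    fun s ε a => (T a (ε ^ (1 / (ρ : ℝ))) s - ∑ j ∈ Finset.range (l + 1),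
      dulacCoeff P ρ σ V U j (ε ^ (1 / (ρ : ℝ))) a * s ^ j) / s ^ l,
    fun ε hε a ha s hs τ hτ => ?_, ⟨s₀, hs₀, fun ε hε a ha => ⟨fun s hs => ?_, ?_⟩⟩,
    fun r hr => ?_⟩
  · rw [hηρ]
    exact hη3 j (by omega)
  · obtain ⟨hzη, hzε⟩ := hz ε hε
    obtain ⟨h1, h2, h3⟩ := hη2 _ hzη
    rw [hzε] at h2 h3
    rw [h2] at hτ
    have h4 := neg_le_of_abs_le h1
    have hmem : ∀ x ∈ Icc (s + σ (ε ^ (1 / (ρ : ℝ)))) 1, x ∈ Icc (-1 : ℝ) 1 := fun x hx =>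
      ⟨by linarith [hx.1], hx.2⟩
    have h5 := hτ.eq_orbitTime (fun x hx => h3 x (by linarith [hx.1]))
      (fun x hx => hVx a ha x (hmem x hx)) (fun x hx => hUx a ha x (hmem x hx))
    have h6 := hTeq a (ε ^ (1 / (ρ : ℝ))) s
    rw [hzε, ← h5] at h6
    simp only [h6]
    have hsl : s ^ l ≠ 0 := pow_ne_zero _ (ne_of_gt hs)
    field_simp
    ring
  · obtain ⟨hzη, hzε⟩ := hz ε hε
    obtain ⟨h1, h2, h3⟩ := hη2 _ hzη
    rw [hzε] at h2 h3
    rw [h2]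
    have h4 := neg_le_of_abs_le h1
    have hmem : ∀ x ∈ Icc (s + σ (ε ^ (1 / (ρ : ℝ)))) 1, x ∈ Icc (-1 : ℝ) 1 := fun x hx =>
      ⟨by linarith [hx.1, hs.1], hx.2⟩
    have hX := hfam.le_X (ε ^ (1 / (ρ : ℝ)), a) ⟨hzη, ha⟩
    refine ⟨_, isDulacTime_orbitTime (by linarith [hs.1]) (by linarith [hs.2])
      (fun x hx => h3 x (by linarith [hx.1, hs.1])) (fun x hx => hVx a ha x (hmem x hx))
      (fun x hx => hUx a ha x (hmem x hx)) fun x hx => ?_⟩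
    have h5 := hY (ε ^ (1 / (ρ : ℝ)), a) ⟨hzη, ha⟩ s hs (x - σ (ε ^ (1 / (ρ : ℝ))))
      ⟨by linarith [hx.1], by linarith [hx.2]⟩
    have h6 := orbit_translate (fun x => V a x * ((P ε).eval x)⁻¹) (σ (ε ^ (1 / (ρ : ℝ)))) s
      (x - σ (ε ^ (1 / (ρ : ℝ))))
    rw [sub_add_cancel] at h6
    rw [← h6]
    have h7 : shiftedW P ρ σ V (ε ^ (1 / (ρ : ℝ)), a)
        = fun t => V a (t + σ (ε ^ (1 / (ρ : ℝ)))) *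
          ((P ε).eval (t + σ (ε ^ (1 / (ρ : ℝ)))))⁻¹ := by
      funext t
      simp only [shiftedW, hzε]
    rwa [h7] at h5
  · exact hbound.contDiffOn (p := (ε ^ (1 / (ρ : ℝ)), a)) ⟨(hz ε hε).1, ha⟩
  · have h1 := hbound.tendstoUniformlyOn hs₀ hr
    rw [Metric.tendstoUniformlyOn_iff] at h1 ⊢
    intro e he
    filter_upwards [h1 e he] with s hs w hw
    exact hs (w.1 ^ (1 / (ρ : ℝ)), w.2) ⟨(hz w.1 hw.1).1, hw.2⟩
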